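/- **Notation.** Let $\mathbb{Z}^2\rtimes \mathrm{SL}(2,\mathbb{Z})$ act on $\mathbb{Z}^2$ by $(k,\gamma)\cdot m = k+\gamma m$, and put $\det(k,l)=k_1l_2-k_2l_1$ for $k,l\in\mathbb{Z}^2$. For an abelian group $H$, a normalized scalar $2$-cocycle $\mu\colon H\times H\to\mathbb{T}$ and a character $\chi$ of $H$, let $\Lambda(H)$ be the group of finitely supported $\lambda\colon\mathbb{Z}^2\to H$ with $\sum_k\lambda(k)=0$, on which $\mathbb{Z}^2\rtimes \mathrm{SL}(2,\mathbb{Z})$ acts by $(g\cdot\lambda)(m)=\lambda(g^{-1}\cdot m)$. Let $\widetilde\mu(\lambda_1,\lambda_2)=\prod_{k\in\mathbb{Z}^2}\mu(\lambda_1(k),\lambda_2(k))$, and let $N(H,\mu)=L_{\widetilde\mu}(\Lambda(H))$ be the twisted group von Neumann algebra, generated by the unitaries $u(\lambda)\delta_{\lambda'}=\widetilde\mu(\lambda,\lambda')\delta_{\lambda+\lambda'}$ on $\ell^2(\Lambda(H))$, with its trace $\mathrm{tr}(x)=\langle x\delta_0,\delta_0\rangle$. The twisted Bernoulli shift $\beta(H,\mu,\chi)$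 is the trace preserving action of $\mathbb{Z}^2\rtimes \mathrm{SL}(2,\mathbb{Z})$ on $N(H,\mu)$ with $$\beta(k,\gamma)(u(\lambda))=\Big(\prod_{m\in\mathbb{Z}^2}\chi\big((\gamma\cdot\lambda)(m)\big)^{\det(k,m)}\Big)\,u\big((k,\gamma)\cdot\lambda\big).$$ Two actions of the same group are conjugate if a $*$-isomorphism of the von Neumann algebras intertwines them. The centralizer of an action is the group of all $*$-automorphisms of the von Neumann algebra which commute with the action, with the topology of pointwise convergence in the $2$-norm of the trace. For an odd prime $q$ let $H_q=(\mathbb{Z}/q\mathbb{Z})^2$, $\mu_q\big((s_1,t_1),(s_2,t_2)\big)=e^{2\pi i s_1t_2/q}$, $\chi_q(s,t)=e^{2\pi i s/q}$ and $\beta_q=\beta(H_q,\mu_q,\chi_q)$. **Corollary 5.9.** Let $Q$ be a set of odd prime numbers, and let $\beta_Q=\bigotimes_{q\in Q}\beta_q$ be the tensor product action on the von Neumann algebra tensor product $\bigotimes_{q\in Q}N(H_q,\mu_q)$, taken with respect to the traces. 1. If $Q$ is non-empty, $\bigotimes_{q\in Q}N(H_q,\mu_q)$ is the AFD factor of type $\mathrm{II}_1$.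 2. $\beta_Q$ is conjugate to the twisted Bernoulli shift $\beta(H_Q,\mu_Q,\chi_Q)$, where $H_Q=\bigoplus_{q\in Q}H_q$, $\mu_Q\big((x_q),(y_q)\big)=\prod_{q\in Q}\mu_q(x_q,y_q)$ and $\chi_Q\big((x_q)\big)=\prod_{q\in Q}\chi_q(x_q)$. 3. The centralizer of $\beta_Q$ is isomorphic, as a topological group, to $\prod_{q\in Q}\mathbb{Z}/q\mathbb{Z}$ with the product of the discrete topologies. 4. If $Q'$ is a set of odd prime numbers with $Q'\neq Q$, then $\beta_Q$ and $\beta_{Q'}$ are not conjugate. -/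

import Mathlib

noncomputable section
open scoped ComplexOrder InnerProductSpace
open Filter
namespace TwistedBernoulli

section Kernel
variable {X : Type*}

theorem posSemidef_of_eventually {ι : Type*} {l : Filter ι} [l.NeBot] {L : ι → Matrix X X ℂ}
    {K : Matrix X X ℂ} (hL : ∀ᶠ F in l, (L F).PosSemidef)
    (h : ∀ a b, ∀ᶠ F in l, L F a b = K a b) : K.PosSemidef := by
  constructor
  · ext a b
    obtain ⟨F, hF, h1, h2⟩ := (hL.and ((h a b).and (h b a))).exists
    rw [Matrix.conjTranspose_apply, ← h1, ← h2, ← Matrix.conjTranspose_apply, hF.1]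
  · intro c
    have h' : ∀ᶠ F in l, ∀ a ∈ c.support, ∀ b ∈ c.support, L F a b = K a b := by
      rw [Finset.eventually_all]
      intro a _
      rw [Finset.eventually_all]
      exact fun b _ => h a b
    obtain ⟨F, hF, h1⟩ := (hL.and h').exists
    have := hF.2 c
    convert this using 1
    refine Finset.sum_congr rfl fun a ha => Finset.sum_congr rfl fun b hb => ?_
    simp only [h1 a ha b hb]

/-- The sesquilinear form on the complex vector space with basis `X` determined by a kernel. -/
def kernelForm (K : Matrix X X ℂ) (f g : X →₀ ℂ) : ℂ :=
  f.sum fun x z => g.sum fun y w => star z * K x y * w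

/-- The complex vector space with basis `X`, with the semi-inner product `⟪x, y⟫ = K x y`
determined by a positive semidefinite kernel `K`. -/
def PreKernelSpace (K : Matrix X X ℂ) (_hK : K.PosSemidef) : Type _ := X →₀ ℂ

variable {K : Matrix X X ℂ} {hK : K.PosSemidef}

instance : AddCommGroup (PreKernelSpace K hK) := inferInstanceAs (AddCommGroup (X →₀ ℂ))
instance : Module ℂ (PreKernelSpace K hK) := inferInstanceAs (Module ℂ (X →₀ ℂ))

/-- The identification of `PreKernelSpace` with the finitely supported functions. -/
def PreKernelSpace.equiv (hK : K.PosSemidef) : (X →₀ ℂ) ≃ₗ[ℂ] PreKernelSpace K hK :=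
  LinearEquiv.refl ℂ (X →₀ ℂ)

theorem kernelForm_conj (hK : K.PosSemidef) (f g : X →₀ ℂ) :
    star (kernelForm K g f) = kernelForm K f g := by
  unfold kernelForm
  rw [Finsupp.sum_comm]
  simp only [Finsupp.sum, star_sum]
  refine Finset.sum_congr rfl fun x _ => Finset.sum_congr rfl fun y _ => ?_
  rw [← hK.1.apply x y]
  simp [mul_comm, mul_left_comm]

instance : PreInnerProductSpace.Core ℂ (PreKernelSpace K hK) where
  inner f g := kernelForm K ((PreKernelSpace.equiv hK).symm f) ((PreKernelSpace.equiv hK).symm g)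
  conj_inner_symm f g := kernelForm_conj hK _ _
  add_left f g h := by
    rw [map_add]
    unfold kernelForm
    rw [Finsupp.sum_add_index'] <;> simp [← Finsupp.sum_add, add_mul]
  smul_left f g c := by
    rw [map_smul]
    unfold kernelForm
    rw [Finsupp.sum_smul_index] <;> simp [Finsupp.mul_sum, ← mul_assoc]
  re_inner_nonneg f := (Complex.nonneg_iff.1 (hK.2 ((PreKernelSpace.equiv hK).symm f))).1

instance : SeminormedAddCommGroup (PreKernelSpace K hK) :=
  InnerProductSpace.Core.toSeminormedAddCommGroup (𝕜 := ℂ)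

instance : InnerProductSpace ℂ (PreKernelSpace K hK) := .ofCore _

theorem PreKernelSpace.inner_equiv (f g : X →₀ ℂ) :
    ⟪PreKernelSpace.equiv hK f, PreKernelSpace.equiv hK g⟫_ℂ = kernelForm K f g := rfl

/-- The Hilbert space generated by a positive semidefinite kernel. -/
abbrev KernelSpace (K : Matrix X X ℂ) (hK : K.PosSemidef) : Type _ :=
  UniformSpace.Completion (PreKernelSpace K hK)

namespace KernelSpace

/-- The canonical vectors of the Hilbert space of a kernel: `⟪vec x, vec y⟫ = K x y`. -/
def vec (hK : K.PosSemidef) (x : X) : KernelSpace K hK :=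
  (PreKernelSpace.equiv hK (Finsupp.single x 1) : PreKernelSpace K hK)

theorem inner_vec (x y : X) : ⟪vec hK x, vec hK y⟫_ℂ = K x y := by
  rw [vec, vec, UniformSpace.Completion.inner_coe, PreKernelSpace.inner_equiv]
  simp [kernelForm]

/-- A continuous linear map on the Hilbert space of a kernel is determined by its values
on the canonical vectors. -/
theorem clm_ext {F : Type*} [NormedAddCommGroup F] [NormedSpace ℂ F]
    {S T : KernelSpace K hK →L[ℂ] F} (h : ∀ x, S (vec hK x) = T (vec hK x)) : S = T := by
  have key : ∀ f : X →₀ ℂ, S ((PreKernelSpace.equiv hK f : PreKernelSpace K hK)) =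
      T ((PreKernelSpace.equiv hK f : PreKernelSpace K hK)) := by
    have : (S.toLinearMap ∘ₗ (UniformSpace.Completion.toComplL (𝕜 := ℂ)).toLinearMap ∘ₗ
        (PreKernelSpace.equiv hK).toLinearMap) =
        (T.toLinearMap ∘ₗ (UniformSpace.Completion.toComplL (𝕜 := ℂ)).toLinearMap ∘ₗ
        (PreKernelSpace.equiv hK).toLinearMap) := by
      apply Finsupp.lhom_ext'
      intro x
      ext
      exact h x
    exact fun f => LinearMap.congr_fun this f
  ext v
  induction v using UniformSpace.Completion.induction_on with
  | hp => exact isClosed_eq S.continuous T.continuous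
  | ih f => exact key ((PreKernelSpace.equiv hK).symm f)

theorem kernelForm_mapDomain (φ : X → X) (f g : X →₀ ℂ) :
    kernelForm K (f.mapDomain φ) (g.mapDomain φ) = kernelForm (K.submatrix φ φ) f g := by
  unfold kernelForm
  rw [Finsupp.sum_mapDomain_index]
  · refine Finsupp.sum_congr fun x _ => ?_
    rw [Finsupp.sum_mapDomain_index] <;> simp [mul_add]
  · simp
  · intro b m n
    simp [← Finsupp.sum_add, add_mul]

/-- The bounded operator `vec x ↦ vec (φ x)`, for a map `φ` such that
`C² K(x, y) - K(φ x, φ y)` is positive semidefinite for some `C`. -/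
def map (hK : K.PosSemidef) (φ : X → X)
    (h : ∃ C : ℝ, 0 ≤ C ∧ (C ^ 2 • K - K.submatrix φ φ).PosSemidef) :
    KernelSpace K hK →L[ℂ] KernelSpace K hK :=
  ContinuousLinearMap.completion
    (LinearMap.mkContinuousOfExistsBound
      ((PreKernelSpace.equiv hK).toLinearMap ∘ₗ Finsupp.lmapDomain ℂ ℂ φ ∘ₗ
        (PreKernelSpace.equiv hK).symm.toLinearMap) (by
      obtain ⟨C, hC, h⟩ := h
      refine ⟨C, fun f => ?_⟩
      obtain ⟨f, rfl⟩ := (PreKernelSpace.equiv hK).surjective f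
      refine (sq_le_sq₀ (norm_nonneg _) (by positivity)).1 ?_
      rw [mul_pow, ← inner_self_eq_norm_sq (𝕜 := ℂ), ← inner_self_eq_norm_sq (𝕜 := ℂ)]
      simp only [LinearMap.comp_apply, LinearEquiv.coe_coe, LinearEquiv.symm_apply_apply,
        PreKernelSpace.inner_equiv, Finsupp.lmapDomain_apply, kernelForm_mapDomain]
      have := (Complex.nonneg_iff.1 (h.2 f)).1
      have e : (f.sum fun i xi => f.sum fun j xj =>
          star xi * (C ^ 2 • K - K.submatrix φ φ) i j * xj) =
          (C ^ 2 : ℝ) * kernelForm K f f - kernelForm (K.submatrix φ φ) f f := by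
        simp only [kernelForm, Finsupp.sum, Finset.mul_sum, ← Finset.sum_sub_distrib,
          Matrix.sub_apply, Matrix.smul_apply, Complex.real_smul]
        refine Finset.sum_congr rfl fun i _ => Finset.sum_congr rfl fun j _ => ?_
        ring
      rw [e, Complex.sub_re, Complex.re_ofReal_mul] at this
      simpa using this))

@[simp] theorem map_vec (hK : K.PosSemidef) (φ : X → X) (h) (x : X) :
    map hK φ h (vec hK x) = vec hK (φ x) := by
  rw [map, vec, ContinuousLinearMap.completion_apply_coe, vec]
  congr 1
  change PreKernelSpace.equiv hK (Finsupp.lmapDomain ℂ ℂ φ (Finsupp.single x 1)) = _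
  simp

/-- The unitary operator `vec x ↦ vec (φ x)`, for a bijection `φ` preserving the kernel. -/
def mapEquiv (hK : K.PosSemidef) (φ : Equiv.Perm X) (h : ∀ x y, K (φ x) (φ y) = K x y) :
    KernelSpace K hK ≃ₗᵢ[ℂ] KernelSpace K hK :=
  LinearEquiv.extendOfIsometry
    ((PreKernelSpace.equiv hK).symm ≪≫ₗ Finsupp.domLCongr φ ≪≫ₗ PreKernelSpace.equiv hK)
    (UniformSpace.Completion.toComplL (𝕜 := ℂ)).toLinearMap
    (UniformSpace.Completion.toComplL (𝕜 := ℂ)).toLinearMap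
    UniformSpace.Completion.denseRange_coe UniformSpace.Completion.denseRange_coe (by
      intro f
      obtain ⟨f, rfl⟩ := (PreKernelSpace.equiv hK).surjective f
      refine (sq_eq_sq₀ (norm_nonneg _) (norm_nonneg _)).1 ?_
      simp only [ContinuousLinearMap.coe_coe, UniformSpace.Completion.coe_toComplL,
        UniformSpace.Completion.norm_coe]
      rw [← inner_self_eq_norm_sq (𝕜 := ℂ), ← inner_self_eq_norm_sq (𝕜 := ℂ)]
      simp only [LinearEquiv.trans_apply, LinearEquiv.symm_apply_apply,
        PreKernelSpace.inner_equiv, Finsupp.domLCongr_apply, Finsupp.domCongr_apply,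
        Finsupp.equivMapDomain_eq_mapDomain, kernelForm_mapDomain]
      congr 2
      ext x y
      exact h x y)

@[simp] theorem mapEquiv_vec (hK : K.PosSemidef) (φ : Equiv.Perm X) (h) (x : X) :
    mapEquiv hK φ h (vec hK x) = vec hK (φ x) := by
  rw [mapEquiv, vec]
  refine (LinearEquiv.extendOfIsometry_eq _ _ _ _ _ _ _).trans ?_
  rw [vec]
  simp

end KernelSpace

end Kernel

section TensorProduct
variable {ι : Type*} {E : ι → Type*} [∀ i, NormedAddCommGroup (E i)]
  [∀ i, InnerProductSpace ℂ (E i)]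

/-- The elementary tensors `⊗ᵢ xᵢ` of the tensor product along the vectors `ξ i`:
families with `x i = ξ i` for all but finitely many `i`. -/
def ElemTensor (ξ : ∀ i, E i) : Type _ := {x : ∀ i, E i // {i | x i ≠ ξ i}.Finite}

namespace ElemTensor
variable (ξ : ∀ i, E i)

/-- The inner product `∏ᵢ ⟪xᵢ, yᵢ⟫` of elementary tensors; if the `ξ i` are unit vectors, all but
finitely many factors are equal to `1`. -/
def kernel : Matrix (ElemTensor ξ) (ElemTensor ξ) ℂ :=
  Matrix.of fun x y => ∏ᶠ i, ⟪x.1 i, y.1 i⟫_ℂ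

variable {ξ}

theorem posSemidef_gram {X F : Type*} [NormedAddCommGroup F] [InnerProductSpace ℂ F]
    (v : X → F) : (Matrix.gram ℂ v).PosSemidef := by
  refine ⟨Matrix.isHermitian_gram ℂ v, fun c => ?_⟩
  have e : (c.sum fun i xi => c.sum fun j xj => star xi * Matrix.gram ℂ v i j * xj) =
      ⟪c.sum fun i xi => xi • v i, c.sum fun i xi => xi • v i⟫_ℂ := by
    simp only [Finsupp.sum, sum_inner, inner_sum, inner_smul_left, inner_smul_right,
      Matrix.gram_apply]
    rw [Finset.sum_comm]
    refine Finset.sum_congr rfl fun i _ => ?_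
    rw [Finset.mul_sum]
    refine Finset.sum_congr rfl fun j _ => ?_
    simp [mul_comm, mul_left_comm]
  rw [e, ← inner_self_ofReal_re]
  exact Complex.zero_le_real.2 (inner_self_nonneg (𝕜 := ℂ))

theorem posSemidef_prod_gram {X : Type*} (F : Finset ι) (v : ∀ i, X → E i) :
    (Matrix.of fun x y : X => ∏ i ∈ F, ⟪v i x, v i y⟫_ℂ).PosSemidef := by
  classical
  induction F using Finset.induction_on with
  | empty =>
    have := posSemidef_gram (fun _ : X => (1 : ℂ))
    convert this using 1
    ext x y
    simp
  | insert i F hi ih =>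
    have e : (Matrix.of fun x y : X => ∏ j ∈ insert i F, ⟪v j x, v j y⟫_ℂ) =
        (Matrix.gram ℂ (v i)).hadamard (Matrix.of fun x y : X => ∏ j ∈ F, ⟪v j x, v j y⟫_ℂ) := by
      ext x y
      simp [Finset.prod_insert hi]
    rw [e]
    exact (posSemidef_gram (v i)).hadamard ih

theorem eventually_prod_eq_kernel (h : ∀ i, ‖ξ i‖ = 1) (x y : ElemTensor ξ) :
    ∀ᶠ F : Finset ι in atTop, ∏ i ∈ F, ⟪x.1 i, y.1 i⟫_ℂ = kernel ξ x y := by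
  classical
  filter_upwards [eventually_ge_atTop (x.2.toFinset ∪ y.2.toFinset)] with F hF
  refine (finprod_eq_prod_of_mulSupport_subset _ fun i hi => ?_).symm
  by_contra hiF
  have h1 : x.1 i = ξ i := by
    by_contra hx
    exact hiF (hF (by simp [hx]))
  have h2 : y.1 i = ξ i := by
    by_contra hx
    exact hiF (hF (by simp [hx]))
  simp [h1, h2, inner_self_eq_norm_sq_to_K, h i] at hi

theorem kernel_posSemidef (h : ∀ i, ‖ξ i‖ = 1) : (kernel ξ).PosSemidef :=
  posSemidef_of_eventually (l := (atTop : Filter (Finset ι)))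
    (Eventually.of_forall fun F => posSemidef_prod_gram F fun i (x : ElemTensor ξ) => x.1 i)
    (eventually_prod_eq_kernel h)

variable (ξ) in
/-- The elementary tensor `⊗ᵢ ξᵢ`. -/
def vacuum : ElemTensor ξ := ⟨ξ, by simp⟩

open Classical in
/-- Replace the `i`-th factor `xᵢ` of an elementary tensor by `T xᵢ`. -/
def applyAt (i : ι) (T : E i →L[ℂ] E i) (x : ElemTensor ξ) : ElemTensor ξ :=
  ⟨Function.update x.1 i (T (x.1 i)), (x.2.union (Set.finite_singleton i)).subset fun j hj => by
    by_cases hji : j = i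
    · exact Or.inr hji
    · left
      simpa [Function.update_of_ne hji] using hj⟩

/-- Apply isometries `U i` which fix `ξ i` to all factors of an elementary tensor. -/
def mapIso (U : ∀ i, E i ≃ₗᵢ[ℂ] E i) (hU : ∀ i, U i (ξ i) = ξ i) : Equiv.Perm (ElemTensor ξ) where
  toFun x := ⟨fun i => U i (x.1 i), x.2.subset fun i hi hx => hi (by
    change U i (x.1 i) = ξ i
    rw [hx, hU])⟩
  invFun x := ⟨fun i => (U i).symm (x.1 i), x.2.subset fun i hi hx => hi (by
    change (U i).symm (x.1 i) = ξ i
    rw [hx, LinearIsometryEquiv.symm_apply_eq, hU])⟩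
  left_inv x := Subtype.ext (by funext i; simp)
  right_inv x := Subtype.ext (by funext i; simp)

@[simp] theorem mapIso_val (U : ∀ i, E i ≃ₗᵢ[ℂ] E i) (hU : ∀ i, U i (ξ i) = ξ i)
    (x : ElemTensor ξ) (i : ι) : (mapIso U hU x).1 i = U i (x.1 i) := rfl

theorem applyAt_val_self (i : ι) (T : E i →L[ℂ] E i) (x : ElemTensor ξ) :
    (applyAt i T x).1 i = T (x.1 i) := by
  simp [applyAt]

theorem applyAt_val_ne {i j : ι} (hj : j ≠ i) (T : E i →L[ℂ] E i) (x : ElemTensor ξ) :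
    (applyAt i T x).1 j = x.1 j := by
  simp [applyAt, hj]

theorem applyAt_posSemidef (h : ∀ i, ‖ξ i‖ = 1) (i : ι) (T : E i →L[ℂ] E i) :
    (‖T‖ ^ 2 • kernel ξ - (kernel ξ).submatrix (applyAt i T) (applyAt i T)).PosSemidef := by
  classical
  refine posSemidef_of_eventually (l := (atTop : Filter (Finset ι)))
    (L := fun F => ‖T‖ ^ 2 • (Matrix.of fun x y : ElemTensor ξ => ∏ j ∈ F, ⟪x.1 j, y.1 j⟫_ℂ) -
      (Matrix.of fun x y : ElemTensor ξ =>
        ∏ j ∈ F, ⟪(applyAt i T x).1 j, (applyAt i T y).1 j⟫_ℂ)) ?_ ?_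
  · filter_upwards [eventually_ge_atTop {i}] with F hF
    have hi : i ∈ F := hF (by simp)
    have key := (Matrix.posSemidef_opNorm_smul_gram_sub_gram
      (fun x : ElemTensor ξ => x.1 i) T).hadamard
      (posSemidef_prod_gram (F.erase i) fun j (x : ElemTensor ξ) => x.1 j)
    refine (congrArg Matrix.PosSemidef ?_).mpr key
    ext x y
    have e : ∏ j ∈ F.erase i, ⟪(applyAt i T x).1 j, (applyAt i T y).1 j⟫_ℂ =
        ∏ j ∈ F.erase i, ⟪x.1 j, y.1 j⟫_ℂ := by
      refine Finset.prod_congr rfl fun j hj => ?_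
      simp [applyAt, Function.update_of_ne (Finset.ne_of_mem_erase hj)]
    simp only [Matrix.sub_apply, Matrix.smul_apply, Matrix.of_apply, Matrix.hadamard_apply,
      ← Finset.mul_prod_erase F _ hi, e, Matrix.gram_apply, Function.comp]
    simp [applyAt, sub_mul, mul_assoc]
  · intro x y
    filter_upwards [eventually_prod_eq_kernel h x y,
      eventually_prod_eq_kernel h (applyAt i T x) (applyAt i T y)] with F h1 h2
    simp [Matrix.sub_apply, h1, h2]

end ElemTensor

/-- The (von Neumann) tensor product of Hilbert spaces `E i` along unit vectors `ξ i`: the Hilbert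
space generated by the elementary tensors `⊗ᵢ xᵢ` with `xᵢ = ξᵢ` for all but finitely many `i`,
with inner product `⟪⊗ᵢ xᵢ, ⊗ᵢ yᵢ⟫ = ∏ᵢ ⟪xᵢ, yᵢ⟫`. -/
abbrev HilbertTensor {ξ : ∀ i, E i} (h : ∀ i, ‖ξ i‖ = 1) : Type _ :=
  KernelSpace (ElemTensor.kernel ξ) (ElemTensor.kernel_posSemidef h)

namespace HilbertTensor
variable {ξ : ∀ i, E i} (h : ∀ i, ‖ξ i‖ = 1)

/-- The elementary tensor `⊗ᵢ xᵢ` as a vector; it is multilinear in `x`, as one sees from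
`inner_tmul`, since the vectors `tmul h x` span a dense subspace. -/
def tmul (x : ElemTensor ξ) : HilbertTensor h := KernelSpace.vec (ElemTensor.kernel_posSemidef h) x

theorem inner_tmul (x y : ElemTensor ξ) :
    ⟪tmul h x, tmul h y⟫_ℂ = ∏ᶠ i, ⟪x.1 i, y.1 i⟫_ℂ := KernelSpace.inner_vec x y

/-- The vector `⊗ᵢ ξᵢ`. -/
def vacuum : HilbertTensor h := tmul h (ElemTensor.vacuum ξ)

theorem norm_vacuum : ‖vacuum h‖ = 1 := by
  have : ((‖vacuum h‖ : ℝ) : ℂ) ^ 2 = 1 := by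
    refine (inner_self_eq_norm_sq_to_K (𝕜 := ℂ) (vacuum h)).symm.trans ?_
    rw [vacuum, inner_tmul]
    simp [ElemTensor.vacuum, inner_self_eq_norm_sq_to_K, h]
  have h2 : ‖vacuum h‖ ^ 2 = 1 := by exact_mod_cast this
  exact (pow_eq_one_iff_of_nonneg (norm_nonneg _) two_ne_zero).1 h2

/-- The bounded operator `T ⊗ 1` which acts as `T` on the `i`-th tensor factor and as the identity
on all others. -/
def ampl (i : ι) (T : E i →L[ℂ] E i) : HilbertTensor h →L[ℂ] HilbertTensor h :=
  KernelSpace.map _ (ElemTensor.applyAt i T)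
    ⟨‖T‖, norm_nonneg _, ElemTensor.applyAt_posSemidef h i T⟩

@[simp] theorem ampl_tmul (i : ι) (T : E i →L[ℂ] E i) (x : ElemTensor ξ) :
    ampl h i T (tmul h x) = tmul h (ElemTensor.applyAt i T x) := KernelSpace.map_vec _ _ _ _

/-- The unitary operator `⊗ᵢ Uᵢ`, for unitary operators `U i` which fix `ξ i`. -/
def mapIso (U : ∀ i, E i ≃ₗᵢ[ℂ] E i) (hU : ∀ i, U i (ξ i) = ξ i) :
    HilbertTensor h ≃ₗᵢ[ℂ] HilbertTensor h :=
  KernelSpace.mapEquiv _ (ElemTensor.mapIso U hU) fun x y => by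
    refine finprod_congr fun i => ?_
    exact (U i).inner_map_map _ _

@[simp] theorem mapIso_tmul (U : ∀ i, E i ≃ₗᵢ[ℂ] E i) (hU : ∀ i, U i (ξ i) = ξ i)
    (x : ElemTensor ξ) : mapIso h U hU (tmul h x) = tmul h (ElemTensor.mapIso U hU x) :=
  KernelSpace.mapEquiv_vec _ _ _ _

/-- A continuous linear map on a tensor product is determined by its values on elementary
tensors. -/
theorem clm_ext {F : Type*} [NormedAddCommGroup F] [NormedSpace ℂ F]
    {S T : HilbertTensor h →L[ℂ] F} (hST : ∀ x, S (tmul h x) = T (tmul h x)) : S = T :=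
  KernelSpace.clm_ext hST

theorem iso_ext {U V : HilbertTensor h ≃ₗᵢ[ℂ] HilbertTensor h}
    (hUV : ∀ x, U (tmul h x) = V (tmul h x)) : U = V := by
  have : (U : HilbertTensor h →L[ℂ] HilbertTensor h) = V := clm_ext h hUV
  ext v
  exact DFunLike.congr_fun this v

theorem conj_mapIso_ampl [∀ i, CompleteSpace (E i)] (U : ∀ i, E i ≃ₗᵢ[ℂ] E i)
    (hU : ∀ i, U i (ξ i) = ξ i) (i : ι) (T : E i →L[ℂ] E i) :
    (mapIso h U hU).conjStarAlgEquiv (ampl h i T) = ampl h i ((U i).conjStarAlgEquiv T) := by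
  classical
  apply clm_ext
  intro x
  obtain ⟨x, rfl⟩ := (ElemTensor.mapIso U hU).surjective x
  rw [LinearIsometryEquiv.conjStarAlgEquiv_apply_apply, ampl_tmul, ← mapIso_tmul,
    LinearIsometryEquiv.symm_apply_apply, ampl_tmul, mapIso_tmul]
  congr 1
  apply Subtype.ext
  funext j
  by_cases hj : j = i
  · subst hj
    rw [ElemTensor.mapIso_val, ElemTensor.applyAt_val_self, ElemTensor.applyAt_val_self,
      ElemTensor.mapIso_val, LinearIsometryEquiv.conjStarAlgEquiv_apply_apply,
      LinearIsometryEquiv.symm_apply_apply]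
  · rw [ElemTensor.mapIso_val, ElemTensor.applyAt_val_ne hj, ElemTensor.applyAt_val_ne hj,
      ElemTensor.mapIso_val]

end HilbertTensor
end TensorProduct


section VonNeumann
variable {E : Type*} [NormedAddCommGroup E] [InnerProductSpace ℂ E] [CompleteSpace E]

/-- The von Neumann algebra `(S ∪ S*)''` generated by a set `S` of bounded operators. -/
def vonNeumannClosure (S : Set (E →L[ℂ] E)) : VonNeumannAlgebra E where
  toStarSubalgebra := StarSubalgebra.centralizer ℂ (StarSubalgebra.centralizer ℂ S : Set (E →L[ℂ] E))
  centralizer_centralizer' := by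
    change Set.centralizer (Set.centralizer
      (StarSubalgebra.centralizer ℂ
        (StarSubalgebra.centralizer ℂ S : Set (E →L[ℂ] E)) : Set (E →L[ℂ] E))) =
      (StarSubalgebra.centralizer ℂ
        (StarSubalgebra.centralizer ℂ S : Set (E →L[ℂ] E)) : Set (E →L[ℂ] E))
    rw [StarSubalgebra.coe_centralizer, Set.centralizer_centralizer_centralizer]

theorem mem_vonNeumannClosure {S : Set (E →L[ℂ] E)} {x : E →L[ℂ] E} :
    x ∈ vonNeumannClosure S ↔
      ∀ y : E →L[ℂ] E, (∀ s ∈ S, s * y = y * s ∧ star s * y = y * star s) → y * x = x * y := by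
  change x ∈ StarSubalgebra.centralizer ℂ
    (StarSubalgebra.centralizer ℂ S : Set (E →L[ℂ] E)) ↔ _
  rw [StarSubalgebra.mem_centralizer_iff]
  simp only [SetLike.mem_coe, StarSubalgebra.mem_centralizer_iff]
  refine ⟨fun H y hy => (H y hy).1, fun H y hy => ⟨H y hy, H (star y) fun s hs => ?_⟩⟩
  have h := hy s hs
  constructor
  · simpa using (congrArg star h.2).symm
  · simpa using (congrArg star h.1).symm

theorem subset_vonNeumannClosure (S : Set (E →L[ℂ] E)) : S ⊆ vonNeumannClosure S :=
  fun s hs => mem_vonNeumannClosure.2 fun _ hy => (hy s hs).1.symm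

/-- If conjugation by the unitary `U` maps `S` into `(S ∪ S*)''`, then it maps `(S ∪ S*)''` into
itself. -/
theorem conj_mem_vonNeumannClosure {S : Set (E →L[ℂ] E)} (U : E ≃ₗᵢ[ℂ] E)
    (hU : ∀ s ∈ S, U.conjStarAlgEquiv s ∈ vonNeumannClosure S)
    {x : E →L[ℂ] E} (hx : x ∈ vonNeumannClosure S) :
    U.conjStarAlgEquiv x ∈ vonNeumannClosure S := by
  rw [mem_vonNeumannClosure] at hx ⊢
  intro y hy
  have hsymm : ∀ z, U.conjStarAlgEquiv (U.symm.conjStarAlgEquiv z) = z := fun z => by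
    rw [← LinearIsometryEquiv.symm_conjStarAlgEquiv]
    exact U.conjStarAlgEquiv.apply_symm_apply z
  have key := hx (U.symm.conjStarAlgEquiv y) fun s hs => ?_
  · have := congrArg U.conjStarAlgEquiv key
    simpa only [map_mul, hsymm] using this
  · have e : ∀ t : E →L[ℂ] E, t ∈ vonNeumannClosure S → y * t = t * y :=
      fun t ht => mem_vonNeumannClosure.1 ht y hy
    have h1 := e _ (hU s hs)
    have h2 := e _ (star_mem (hU s hs))
    constructor
    · refine EquivLike.injective U.conjStarAlgEquiv ?_
      rw [map_mul U.conjStarAlgEquiv, map_mul U.conjStarAlgEquiv, hsymm]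
      exact h1.symm
    · refine EquivLike.injective U.conjStarAlgEquiv ?_
      rw [map_mul U.conjStarAlgEquiv, map_mul U.conjStarAlgEquiv, hsymm, map_star]
      exact h2.symm

/-- A von Neumann algebra is a factor if its center consists of the scalars. -/
def IsFactor (N : VonNeumannAlgebra E) : Prop :=
  ∀ x ∈ N, (∀ y ∈ N, x * y = y * x) → ∃ c : ℂ, x = c • 1

/-- A von Neumann algebra is finite if every isometry in it is unitary. -/
def IsFiniteVN (N : VonNeumannAlgebra E) : Prop :=
  ∀ v ∈ N, star v * v = 1 → v * star v = 1

/-- A von Neumann algebra is approximately finite dimensional if it is generated by an increasing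
sequence of finite dimensional `*`-subalgebras. -/
def IsAFD (N : VonNeumannAlgebra E) : Prop :=
  ∃ A : ℕ → StarSubalgebra ℂ (E →L[ℂ] E), Monotone A ∧ (∀ n, FiniteDimensional ℂ (A n)) ∧
    N = vonNeumannClosure (⋃ n, (A n : Set (E →L[ℂ] E)))

/-- `N` is the AFD factor of type II₁: a finite factor which is not finite dimensional (that is, a
factor of type II₁) and approximately finite dimensional. -/
structure IsAFDII₁Factor (N : VonNeumannAlgebra E) : Prop where
  isFactor : IsFactor N
  isFiniteVN : IsFiniteVN N
  infinite_dimensional : ¬ FiniteDimensional ℂ N.toStarSubalgebra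
  isAFD : IsAFD N

end VonNeumann

section Systems

/-- A von Neumann algebra `N` on a Hilbert space `E` with a unit vector `Ω`, and an action of `G` on
`N` preserving the vector state `x ↦ ⟪Ω, x Ω⟫`, given as `x ↦ U g x (U g)⁻¹` for a unitary
representation `U` of `G` fixing `Ω`. -/
structure VNSystem (G : Type*) [Group G] (E : Type*) [NormedAddCommGroup E]
    [InnerProductSpace ℂ E] [CompleteSpace E] where
  alg : VonNeumannAlgebra E
  Ω : E
  norm_Ω : ‖Ω‖ = 1
  U : G →* (E ≃ₗᵢ[ℂ] E)
  U_Ω : ∀ g, U g Ω = Ω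
  conj_mem : ∀ g, ∀ x ∈ alg, (U g).conjStarAlgEquiv x ∈ alg

namespace VNSystem
variable {G : Type*} [Group G]
variable {E : Type*} [NormedAddCommGroup E] [InnerProductSpace ℂ E] [CompleteSpace E]
variable {E' : Type*} [NormedAddCommGroup E'] [InnerProductSpace ℂ E'] [CompleteSpace E']

/-- The von Neumann algebra of a system, as a `*`-algebra. -/
abbrev Alg (S : VNSystem G E) : Type _ := S.alg.toStarSubalgebra

/-- The action of `G` on the von Neumann algebra by `*`-automorphisms. -/
def action (S : VNSystem G E) : G →* (S.Alg ≃⋆ₐ[ℂ] S.Alg) where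
  toFun g :=
    { toFun := fun x => ⟨(S.U g).conjStarAlgEquiv x.1, S.conj_mem g x.1 x.2⟩
      invFun := fun x => ⟨(S.U g⁻¹).conjStarAlgEquiv x.1, S.conj_mem g⁻¹ x.1 x.2⟩
      left_inv := fun x => by
        apply Subtype.ext
        change (S.U g⁻¹).conjStarAlgEquiv ((S.U g).conjStarAlgEquiv x.1) = x.1
        rw [map_inv]
        exact (S.U g).conjStarAlgEquiv.symm_apply_apply x.1
      right_inv := fun x => by
        apply Subtype.ext
        change (S.U g).conjStarAlgEquiv ((S.U g⁻¹).conjStarAlgEquiv x.1) = x.1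
        rw [map_inv]
        exact (S.U g).conjStarAlgEquiv.apply_symm_apply x.1
      map_mul' := fun x y => Subtype.ext (map_mul _ _ _)
      map_add' := fun x y => Subtype.ext (map_add _ _ _)
      map_smul' := fun c x => Subtype.ext (map_smul _ _ _)
      map_star' := fun x => Subtype.ext (map_star _ _) }
  map_one' := by
    ext x v
    simp only [map_one]
    rfl
  map_mul' g h := by
    ext x v
    simp only [map_mul]
    rfl

theorem coe_action (S : VNSystem G E) (g : G) (x : S.Alg) :
    ((S.action g x : S.Alg) : E →L[ℂ] E) = (S.U g).conjStarAlgEquiv x := rfl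

/-- Two actions are conjugate if some `*`-isomorphism of the von Neumann algebras intertwines
them. -/
def Conjugate (S : VNSystem G E) (T : VNSystem G E') : Prop :=
  ∃ θ : S.Alg ≃⋆ₐ[ℂ] T.Alg, ∀ g x, θ (S.action g x) = T.action g (θ x)

/-- The centralizer of the action: the group of all `*`-automorphisms which commute with it. -/
def centralizer (S : VNSystem G E) : Subgroup (S.Alg ≃⋆ₐ[ℂ] S.Alg) :=
  Subgroup.centralizer (Set.range S.action)

theorem mem_centralizer {S : VNSystem G E} {α : S.Alg ≃⋆ₐ[ℂ] S.Alg} :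
    α ∈ S.centralizer ↔ ∀ g x, S.action g (α x) = α (S.action g x) := by
  rw [centralizer, Subgroup.mem_centralizer_iff, Set.forall_mem_range]
  exact forall_congr' fun g => StarAlgEquiv.ext_iff

/-- The topology of pointwise convergence in the 2-norm `‖x‖₂ = ⟪Ω, x* x Ω⟫^(1/2) = ‖x Ω‖`. -/
instance (S : VNSystem G E) : TopologicalSpace S.centralizer :=
  TopologicalSpace.induced
    (fun α (x : S.Alg) => ((α.1 x : S.Alg) : E →L[ℂ] E) S.Ω) inferInstance

section Tensor
variable {ι : Type*} {F : ι → Type*} [∀ i, NormedAddCommGroup (F i)]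
  [∀ i, InnerProductSpace ℂ (F i)] [∀ i, CompleteSpace (F i)]

/-- The tensor product of the actions `S i`: on the Hilbert space tensor product along the vectors
`Ω i`, the von Neumann algebra is generated by the operators `x ⊗ 1` with `x ∈ N i`, and `g` acts
by conjugation with `⊗ᵢ U i g`, so that `⊗ᵢ xᵢ ↦ ⊗ᵢ (S i).action g xᵢ`. -/
def tensor (S : ∀ i, VNSystem G (F i)) :
    VNSystem G (HilbertTensor fun i => (S i).norm_Ω) where
  alg := vonNeumannClosure
    (⋃ i, HilbertTensor.ampl (fun i => (S i).norm_Ω) i '' ((S i).alg : Set (F i →L[ℂ] F i)))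
  Ω := HilbertTensor.vacuum _
  norm_Ω := HilbertTensor.norm_vacuum _
  U :=
    { toFun := fun g => HilbertTensor.mapIso _ (fun i => (S i).U g) fun i => (S i).U_Ω g
      map_one' := by
        refine HilbertTensor.iso_ext _ fun x => ?_
        refine (HilbertTensor.mapIso_tmul _ _ _ _).trans (congrArg _ (Subtype.ext ?_))
        funext i
        rw [ElemTensor.mapIso_val, map_one]
        rfl
      map_mul' := fun g g' => by
        refine HilbertTensor.iso_ext _ fun x => ?_
        refine Eq.trans ?_ (congrArg (HilbertTensor.mapIso _ (fun i => (S i).U g) fun i => (S i).U_Ω g)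
          (HilbertTensor.mapIso_tmul _ _ _ _)).symm
        rw [HilbertTensor.mapIso_tmul, HilbertTensor.mapIso_tmul]
        refine congrArg _ (Subtype.ext ?_)
        funext i
        rw [ElemTensor.mapIso_val, map_mul]
        rfl }
  U_Ω g := by
    refine (HilbertTensor.mapIso_tmul _ _ _ _).trans (congrArg _ (Subtype.ext ?_))
    funext i
    exact (S i).U_Ω g
  conj_mem g x hx := by
    refine conj_mem_vonNeumannClosure _ ?_ hx
    intro s hs
    obtain ⟨i, x, hx, rfl⟩ := Set.mem_iUnion.1 hs
    rw [MonoidHom.coe_mk, OneHom.coe_mk, HilbertTensor.conj_mapIso_ampl]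
    exact subset_vonNeumannClosure _ (Set.mem_iUnion.2 ⟨i, _, (S i).conj_mem g x hx, rfl⟩)

end Tensor
end VNSystem
end Systems


section Cocycles

/-- Normalized scalar 2-cocycles on an abelian group. -/
structure Cocycle (H : Type*) [AddCommGroup H] where
  toFun : H → H → Circle
  assoc' : ∀ g h k, toFun g h * toFun (g + h) k = toFun h k * toFun g (h + k)
  zero_left' : ∀ h, toFun 0 h = 1
  zero_right' : ∀ h, toFun h 0 = 1

namespace Cocycle

instance {H : Type*} [AddCommGroup H] : CoeFun (Cocycle H) fun _ => H → H → Circle := ⟨toFun⟩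

theorem assoc {H : Type*} [AddCommGroup H] (μ : Cocycle H) (g h k : H) :
    μ g h * μ (g + h) k = μ h k * μ g (h + k) := μ.assoc' g h k

@[simp] theorem zero_left {H : Type*} [AddCommGroup H] (μ : Cocycle H) (h : H) : μ 0 h = 1 :=
  μ.zero_left' h

@[simp] theorem zero_right {H : Type*} [AddCommGroup H] (μ : Cocycle H) (h : H) : μ h 0 = 1 :=
  μ.zero_right' h

variable {I : Type*} {Γ : Type*} [AddCommGroup Γ] {H : I → Type*} [∀ i, AddCommGroup (H i)]

theorem finite_mulSupport_comp (μ : ∀ i, Cocycle (H i)) {x y : ∀ i, H i}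
    (hx : {i | x i ≠ 0}.Finite) : (Function.mulSupport fun i => μ i (x i) (y i)).Finite :=
  hx.subset fun i hi h0 => hi (by simp [h0])

/-- The cocycle `(γ, γ') ↦ ∏ᵢ μᵢ (γ(i), γ'(i))`, where `γ(i) = e i γ` are the components of `γ`,
of which all but finitely many vanish. -/
def prod (e : ∀ i, Γ →+ H i) (he : ∀ γ, {i | e i γ ≠ 0}.Finite) (μ : ∀ i, Cocycle (H i)) :
    Cocycle Γ where
  toFun γ γ' := ∏ᶠ i, μ i (e i γ) (e i γ')
  assoc' a b c := by
    rw [← finprod_mul_distrib (finite_mulSupport_comp μ (he a))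
      (finite_mulSupport_comp μ (he (a + b))), ← finprod_mul_distrib
      (finite_mulSupport_comp μ (he b)) (finite_mulSupport_comp μ (he a))]
    refine finprod_congr fun i => ?_
    rw [map_add, map_add, (μ i).assoc]
  zero_left' γ := by simp
  zero_right' γ := by simp

end Cocycle

/-- The character `γ ↦ ∏ᵢ χᵢ (γ(i))`, where `γ(i) = e i γ` are the components of `γ`,
of which all but finitely many vanish. -/
def prodChar {I : Type*} {Γ : Type*} [AddCommGroup Γ] {H : I → Type*} [∀ i, AddCommGroup (H i)]
    (e : ∀ i, Γ →+ H i) (he : ∀ γ, {i | e i γ ≠ 0}.Finite) (χ : ∀ i, AddChar (H i) Circle) :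
    AddChar Γ Circle where
  toFun γ := ∏ᶠ i, χ i (e i γ)
  map_zero_eq_one' := by simp
  map_add_eq_mul' a b := by
    have h : ∀ c, (Function.mulSupport fun i => χ i (e i c)).Finite := fun c =>
      (he c).subset fun i hi h0 => hi (by simp [h0])
    rw [← finprod_mul_distrib (h a) (h b)]
    exact finprod_congr fun i => by rw [map_add, AddChar.map_add_eq_mul]

end Cocycles

section GroupAlgebra
variable {Γ : Type*}

/-- The Hilbert space `ℓ²(Γ)`. -/
abbrev L2 (Γ : Type*) : Type _ := lp (fun _ : Γ => ℂ) 2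

/-- The standard basis vector `δ_γ` of `ℓ²(Γ)`. -/
def delta (γ : Γ) : L2 Γ := by
  classical
  exact lp.single 2 γ 1

theorem norm_circle_mul (c : Circle) (z : ℂ) : ‖(c : ℂ) * z‖ = ‖z‖ := by
  rw [norm_mul, Circle.norm_coe, one_mul]

/-- The unitary operator `δ_γ ↦ c(γ) δ_{σ γ}`. -/
def monomial (σ : Equiv.Perm Γ) (c : Γ → Circle) : L2 Γ ≃ₗᵢ[ℂ] L2 Γ where
  toFun f := ⟨fun x => (c (σ.symm x) : ℂ) * f (σ.symm x), by
    have := (memℓp_gen_iff (by norm_num)).1 (lp.memℓp f)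
    refine (memℓp_gen_iff (by norm_num)).2 ?_
    exact (σ.symm.summable_iff.2 this).congr fun x =>
      congrArg (· ^ (2 : ENNReal).toReal) (norm_circle_mul _ _).symm⟩
  invFun f := ⟨fun x => ((c x)⁻¹ : Circle) * f (σ x), by
    have := (memℓp_gen_iff (by norm_num)).1 (lp.memℓp f)
    refine (memℓp_gen_iff (by norm_num)).2 ?_
    exact (σ.summable_iff.2 this).congr fun x =>
      congrArg (· ^ (2 : ENNReal).toReal) (norm_circle_mul _ _).symm⟩
  left_inv f := by
    ext x
    simp
  right_inv f := by
    ext x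
    simp
  map_add' f g := by
    ext x
    exact mul_add _ _ _
  map_smul' a f := by
    ext x
    simp [mul_left_comm]
  norm_map' f := by
    have h : 0 < (2 : ENNReal).toReal := by norm_num
    rw [lp.norm_eq_tsum_rpow h, lp.norm_eq_tsum_rpow h]
    congr 1
    rw [← σ.symm.tsum_eq fun x => ‖f x‖ ^ (2 : ENNReal).toReal]
    exact tsum_congr fun x => congrArg (· ^ (2 : ENNReal).toReal) (norm_circle_mul _ _)

theorem monomial_apply (σ : Equiv.Perm Γ) (c : Γ → Circle) (f : L2 Γ) (x : Γ) :
    monomial σ c f x = (c (σ.symm x) : ℂ) * f (σ.symm x) := rfl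

theorem monomial_delta (σ : Equiv.Perm Γ) (c : Γ → Circle) (γ : Γ) :
    monomial σ c (delta γ) = (c γ : ℂ) • delta (σ γ) := by
  classical
  ext x
  rw [monomial_apply]
  by_cases hx : x = σ γ
  · subst hx
    simp [delta]
  · have : σ.symm x ≠ γ := fun h => hx (by rw [← h, Equiv.apply_symm_apply])
    simp [delta, lp.single_apply, hx, this]

theorem norm_delta (γ : Γ) : ‖(delta γ : L2 Γ)‖ = 1 := by
  classical
  rw [delta, lp.norm_single (by norm_num)]
  simp

variable [AddCommGroup Γ]

/-- The unitary operators `u_γ δ_g = μ(γ, g) δ_{γ + g}` on `ℓ²(Γ)`. -/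
def twistedUnitary (μ : Cocycle Γ) (γ : Γ) : L2 Γ ≃ₗᵢ[ℂ] L2 Γ := monomial (Equiv.addLeft γ) (μ γ)

/-- The operator `u_γ` as a bounded operator. -/
def twistedOp (μ : Cocycle Γ) (γ : Γ) : L2 Γ →L[ℂ] L2 Γ := (twistedUnitary μ γ : L2 Γ →L[ℂ] L2 Γ)

/-- The twisted group von Neumann algebra `L_μ(Γ)`, generated by the operators `u_γ`. -/
def twistedGroupVN (μ : Cocycle Γ) : VonNeumannAlgebra (L2 Γ) :=
  vonNeumannClosure (Set.range (twistedOp μ))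

end GroupAlgebra


section Group

/-- The group `ℤ²`, as column vectors. -/
abbrev Z2 : Type := Fin 2 → ℤ

/-- The group `SL(2, ℤ)`. -/
abbrev SL2Z : Type := Matrix.SpecialLinearGroup (Fin 2) ℤ

/-- The action of `SL(2, ℤ)` on `ℤ²` by matrix multiplication. -/
def slAct : SL2Z →* MulAut (Multiplicative Z2) where
  toFun γ :=
    { toFun := fun v => Multiplicative.ofAdd (γ.1.mulVec v.toAdd)
      invFun := fun v => Multiplicative.ofAdd (γ⁻¹.1.mulVec v.toAdd)
      left_inv := fun v => by
        change Multiplicative.ofAdd (γ⁻¹.1.mulVec (γ.1.mulVec v.toAdd)) = v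
        rw [Matrix.mulVec_mulVec, ← Matrix.SpecialLinearGroup.coe_mul]
        simp
      right_inv := fun v => by
        change Multiplicative.ofAdd (γ.1.mulVec (γ⁻¹.1.mulVec v.toAdd)) = v
        rw [Matrix.mulVec_mulVec, ← Matrix.SpecialLinearGroup.coe_mul]
        simp
      map_mul' := fun v w => by
        rw [toAdd_mul, Matrix.mulVec_add, ofAdd_add] }
  map_one' := by
    ext v : 1
    change Multiplicative.ofAdd ((1 : SL2Z).1.mulVec v.toAdd) = v
    rw [Matrix.SpecialLinearGroup.coe_one, Matrix.one_mulVec, ofAdd_toAdd]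
  map_mul' γ γ' := by
    ext v : 1
    change Multiplicative.ofAdd ((γ * γ').1.mulVec v.toAdd) =
      Multiplicative.ofAdd (γ.1.mulVec (γ'.1.mulVec v.toAdd))
    rw [Matrix.mulVec_mulVec, Matrix.SpecialLinearGroup.coe_mul]

/-- The group `ℤ² ⋊ SL(2, ℤ)`. -/
abbrev AffineGroup : Type := Multiplicative Z2 ⋊[slAct] SL2Z

/-- The action `(k, γ) · m = k + γ m` of `ℤ² ⋊ SL(2, ℤ)` on `ℤ²`. -/
def affineAct : AffineGroup →* Equiv.Perm Z2 :=
  MonoidHom.toHomPerm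
    { toFun := fun g (m : Z2) => g.left.toAdd + g.right.1.mulVec m
      map_one' := by
        funext m
        change (0 : Z2) + (1 : SL2Z).1.mulVec m = m
        rw [Matrix.SpecialLinearGroup.coe_one, Matrix.one_mulVec, zero_add]
      map_mul' := fun g g' => by
        funext m
        change (g.left.toAdd + g.right.1.mulVec g'.left.toAdd) + (g.right * g'.right).1.mulVec m =
          g.left.toAdd + g.right.1.mulVec (g'.left.toAdd + g'.right.1.mulVec m)
        rw [Matrix.mulVec_add, Matrix.mulVec_mulVec, Matrix.SpecialLinearGroup.coe_mul, add_assoc] }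

theorem affineAct_apply (g : AffineGroup) (m : Z2) :
    affineAct g m = g.left.toAdd + g.right.1.mulVec m := rfl

/-- `det(k, l) = k₁ l₂ - k₂ l₁`. -/
def det (k l : Z2) : ℤ := k 0 * l 1 - k 1 * l 0

theorem det_add_left (k k' l : Z2) : det (k + k') l = det k l + det k' l := by
  simp [det]; ring

theorem det_add_right (k l l' : Z2) : det k (l + l') = det k l + det k l' := by
  simp [det]; ring

theorem det_mulVec (γ : SL2Z) (k l : Z2) : det (γ.1.mulVec k) (γ.1.mulVec l) = det k l := by
  have h := γ.2
  rw [Matrix.det_fin_two] at h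
  simp only [det, Matrix.mulVec, dotProduct, Fin.sum_univ_two]
  linear_combination (k 0 * l 1 - k 1 * l 0) * h

end Group

section TwistedBernoulliShift
variable (H : Type*) [AddCommGroup H]

/-- The group `Λ(H)` of finitely supported functions `λ : ℤ² → H` with `∑ₖ λ(k) = 0`. -/
def Lam : AddSubgroup (Z2 →₀ H) where
  carrier := {l | (l.sum fun _ h => h) = 0}
  add_mem' {a b} ha hb := by
    change ((a + b).sum fun _ h => h) = 0
    rw [Finsupp.sum_add_index' (by simp) (by simp), show (a.sum fun _ h => h) = 0 from ha,
      show (b.sum fun _ h => h) = 0 from hb, add_zero]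
  zero_mem' := Finsupp.sum_zero_index
  neg_mem' {a} ha := by
    change ((-a).sum fun _ h => h) = 0
    rw [Finsupp.sum_neg_index (by simp), Finsupp.sum_neg, show (a.sum fun _ h => h) = 0 from ha,
      neg_zero]

/-- The evaluation homomorphism `λ ↦ λ(k)`. -/
def Lam.eval (k : Z2) : Lam H →+ H := (Finsupp.applyAddHom k).comp (Lam H).subtype

variable {H}

theorem Lam.eval_apply (k : Z2) (l : Lam H) : Lam.eval H k l = l.1 k := rfl

theorem Lam.ext {l l' : Lam H} (h : ∀ k, l.1 k = l'.1 k) : l = l' :=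
  Subtype.ext (Finsupp.ext h)

theorem Lam.finite_eval (l : Lam H) : {k | Lam.eval H k l ≠ 0}.Finite :=
  l.1.hasFiniteSupport

/-- The action `(g · λ)(k) = λ(g⁻¹ · k)` of `ℤ² ⋊ SL(2, ℤ)` on `Λ(H)`. -/
def Lam.act (g : AffineGroup) : Lam H ≃+ Lam H where
  toFun l := ⟨Finsupp.equivMapDomain (affineAct g) l.1, by
    change (Finsupp.equivMapDomain (affineAct g) l.1).sum (fun _ h => h) = 0
    rw [Finsupp.sum_equivMapDomain]
    exact l.2⟩
  invFun l := ⟨Finsupp.equivMapDomain (affineAct g⁻¹) l.1, by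
    change (Finsupp.equivMapDomain (affineAct g⁻¹) l.1).sum (fun _ h => h) = 0
    rw [Finsupp.sum_equivMapDomain]
    exact l.2⟩
  left_inv l := Lam.ext fun k => by
    rw [map_inv]
    exact congrArg l.1 ((affineAct g).symm_apply_apply k)
  right_inv l := Lam.ext fun k => by
    rw [map_inv]
    exact congrArg l.1 ((affineAct g).apply_symm_apply k)
  map_add' l l' := Lam.ext fun k => by
    simp [Finsupp.equivMapDomain_apply]

theorem Lam.act_apply (g : AffineGroup) (l : Lam H) (k : Z2) :
    (Lam.act g l).1 k = l.1 ((affineAct g).symm k) := rfl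

theorem Lam.act_one (l : Lam H) : Lam.act 1 l = l := Lam.ext fun k => by
  rw [Lam.act_apply, map_one]
  rfl

theorem Lam.act_mul (g g' : AffineGroup) (l : Lam H) :
    Lam.act (g * g') l = Lam.act g (Lam.act g' l) := Lam.ext fun k => by
  rw [Lam.act_apply, map_mul]
  rfl

/-- The cocycle `μ̃(λ, λ') = ∏ₖ μ(λ(k), λ'(k))` on `Λ(H)`. -/
def Cocycle.tilde (μ : Cocycle H) : Cocycle (Lam H) :=
  Cocycle.prod (Lam.eval H) Lam.finite_eval fun _ => μ

theorem Cocycle.tilde_apply (μ : Cocycle H) (l l' : Lam H) :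
    μ.tilde l l' = ∏ᶠ k, μ (l.1 k) (l'.1 k) := rfl

theorem Cocycle.tilde_act (μ : Cocycle H) (g : AffineGroup) (l l' : Lam H) :
    μ.tilde (Lam.act g l) (Lam.act g l') = μ.tilde l l' := by
  rw [Cocycle.tilde_apply, Cocycle.tilde_apply]
  exact finprod_eq_of_bijective _ (affineAct g).symm.bijective fun k => rfl

/-- The scalar `∏ₘ χ((γ · λ)(m)) ^ det(k, m)` by which `u(γ · λ) ↦ u((k, γ) · λ)` is twisted,
for `g = (k, γ)`. -/
def phase (χ : AddChar H Circle) (g : AffineGroup) (l : Lam H) : Circle :=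
  ∏ᶠ m, χ ((Lam.act (SemidirectProduct.inr g.right) l).1 m) ^ det g.left.toAdd m

theorem phase_eq (χ : AddChar H Circle) (g : AffineGroup) (l : Lam H) :
    phase χ g l = ∏ᶠ m, χ (l.1 m) ^ det g.left.toAdd (g.right.1.mulVec m) := by
  refine (finprod_eq_of_bijective _ (affineAct (SemidirectProduct.inr g.right)).bijective
    fun m => ?_).symm
  have e : affineAct (SemidirectProduct.inr g.right) m = g.right.1.mulVec m := zero_add _
  rw [Lam.act_apply, Equiv.symm_apply_apply, e]

theorem finite_mulSupport_zpow (χ : AddChar H Circle) (l : Lam H) (n : Z2 → ℤ) :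
    (Function.mulSupport fun m => χ (l.1 m) ^ n m).Finite :=
  l.1.hasFiniteSupport.subset fun m hm h0 => hm (by simp [h0])

theorem finprod_char (χ : AddChar H Circle) (l : Lam H) : ∏ᶠ m, χ (l.1 m) = 1 := by
  classical
  rw [finprod_eq_prod_of_mulSupport_subset (s := l.1.support) _ fun m hm => by
    simp only [Finset.mem_coe, Finsupp.mem_support_iff]
    exact fun h0 => hm (by simp [h0])]
  have h : l.1.sum (fun _ h => h) = 0 := l.2
  have key : ∀ s : Finset Z2, χ (∑ m ∈ s, l.1 m) = ∏ m ∈ s, χ (l.1 m) := fun s => by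
    induction s using Finset.induction_on with
    | empty => simp
    | insert m s hm ih =>
      rw [Finset.sum_insert hm, Finset.prod_insert hm, AddChar.map_add_eq_mul, ih]
  rw [← key, ← AddChar.map_zero_eq_one χ, ← h, Finsupp.sum]

theorem finprod_char_zpow (χ : AddChar H Circle) (l : Lam H) (n : ℤ) :
    ∏ᶠ m, χ (l.1 m) ^ n = 1 := by
  have h := finprod_char (χ ^ n) l
  simpa [AddChar.zpow_apply] using h

theorem phase_one (χ : AddChar H Circle) (l : Lam H) : phase χ 1 l = 1 := by
  simp [phase, det]

theorem phase_add (χ : AddChar H Circle) (g : AffineGroup) (l l' : Lam H) :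
    phase χ g (l + l') = phase χ g l * phase χ g l' := by
  rw [phase_eq, phase_eq, phase_eq, ← finprod_mul_distrib (finite_mulSupport_zpow χ l _)
    (finite_mulSupport_zpow χ l' _)]
  refine finprod_congr fun m => ?_
  rw [AddSubgroup.coe_add, Finsupp.add_apply, AddChar.map_add_eq_mul, mul_zpow]

theorem phase_mul (χ : AddChar H Circle) (g g' : AffineGroup) (l : Lam H) :
    phase χ (g * g') l = phase χ g (Lam.act g' l) * phase χ g' l := by
  set k := g.left.toAdd with hk
  set k' := g'.left.toAdd with hk'
  have h1 : phase χ g (Lam.act g' l) = ∏ᶠ m, χ (l.1 m) ^ det k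
      (g.right.1.mulVec (k' + g'.right.1.mulVec m)) := by
    rw [phase_eq]
    refine (finprod_eq_of_bijective _ (affineAct g').bijective fun m => ?_).symm
    rw [Lam.act_apply, Equiv.symm_apply_apply, affineAct_apply]
  have h2 : ∏ᶠ m, χ (l.1 m) ^ det k (g.right.1.mulVec k') = 1 := finprod_char_zpow χ l _
  rw [h1, phase_eq, phase_eq]
  simp only [Matrix.mulVec_add, det_add_right, zpow_add]
  rw [finprod_mul_distrib (finite_mulSupport_zpow χ l _) (finite_mulSupport_zpow χ l _), h2,
    one_mul, ← finprod_mul_distrib (finite_mulSupport_zpow χ l _) (finite_mulSupport_zpow χ l _)]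
  refine finprod_congr fun m => ?_
  have e1 : (g * g').left.toAdd = k + g.right.1.mulVec k' := rfl
  have e2 : (g * g').right.1.mulVec m = g.right.1.mulVec (g'.right.1.mulVec m) := by
    rw [Matrix.mulVec_mulVec]
    rfl
  rw [e1, e2, det_add_left, det_mulVec, zpow_add]

/-- The unitary representation `δ_λ ↦ ∏ₘ χ((γ · λ)(m)) ^ det(k, m) δ_{(k, γ) · λ}` of
`ℤ² ⋊ SL(2, ℤ)` on `ℓ²(Λ(H))`. -/
def shiftUnitary (χ : AddChar H Circle) : AffineGroup →* (L2 (Lam H) ≃ₗᵢ[ℂ] L2 (Lam H)) where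
  toFun g := monomial (Lam.act g).toEquiv (phase χ g)
  map_one' := by
    apply LinearIsometryEquiv.ext
    intro f
    ext l
    rw [monomial_apply, phase_one, Circle.coe_one, one_mul]
    change f ((Lam.act 1).symm l) = f l
    rw [show (Lam.act 1).symm l = l from (AddEquiv.symm_apply_eq _).2 (Lam.act_one l).symm]
  map_mul' g g' := by
    apply LinearIsometryEquiv.ext
    intro f
    ext l
    change monomial _ _ f l = monomial _ _ (monomial _ _ f) l
    obtain ⟨l, rfl⟩ := (Lam.act (g * g')).surjective l
    have e : (Lam.act g).toEquiv.symm (Lam.act (g * g') l) = Lam.act g' l := by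
      rw [Lam.act_mul]
      exact (Lam.act g).symm_apply_apply _
    have e1 : (Lam.act (g * g')).toEquiv.symm (Lam.act (g * g') l) = l :=
      (Lam.act (g * g')).symm_apply_apply _
    have e2 : (Lam.act g').toEquiv.symm (Lam.act g' l) = l := (Lam.act g').symm_apply_apply _
    rw [monomial_apply, monomial_apply, monomial_apply, e, e1, e2, phase_mul, Circle.coe_mul,
      mul_assoc]

theorem conj_shiftUnitary (μ : Cocycle H) (χ : AddChar H Circle) (g : AffineGroup) (l : Lam H) :
    (shiftUnitary χ g).conjStarAlgEquiv (twistedOp μ.tilde l) =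
      (phase χ g l : ℂ) • twistedOp μ.tilde (Lam.act g l) := by
  ext f x
  obtain ⟨x, rfl⟩ := (Lam.act g).surjective x
  have key : ∀ f : L2 (Lam H), (shiftUnitary χ g (twistedUnitary μ.tilde l f)) (Lam.act g x) =
      ((phase χ g l : ℂ) • twistedUnitary μ.tilde (Lam.act g l) (shiftUnitary χ g f))
        (Lam.act g x) := by
    intro f
    change monomial _ _ (monomial _ _ f) _ = (phase χ g l : ℂ) * monomial _ _ (monomial _ _ f) _
    have e1 : (Lam.act g).toEquiv.symm (Lam.act g x) = x := (Lam.act g).symm_apply_apply _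
    have e2 : (Equiv.addLeft (Lam.act g l)).symm (Lam.act g x) = Lam.act g (x - l) := by
      rw [map_sub]
      exact neg_add_eq_sub _ _
    have e3 : (Lam.act g).toEquiv.symm (Lam.act g (x - l)) = x - l :=
      (Lam.act g).symm_apply_apply _
    have e4 : (Equiv.addLeft l).symm x = x - l := neg_add_eq_sub _ _
    have e5 : phase χ g x = phase χ g l * phase χ g (x - l) := by
      rw [← phase_add, add_sub_cancel]
    rw [monomial_apply, monomial_apply, monomial_apply, monomial_apply, e1, e2, e3, e4,
      Cocycle.tilde_act, e5, Circle.coe_mul]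
    ring
  have := key ((shiftUnitary χ g).symm f)
  rw [LinearIsometryEquiv.apply_symm_apply] at this
  exact this

/-- The twisted Bernoulli shift action `β(H, μ, χ)` of `ℤ² ⋊ SL(2, ℤ)` on the von Neumann algebra
`N(H, μ) = L_μ̃(Λ(H))` with its canonical trace `x ↦ ⟪δ₀, x δ₀⟫`, determined by
`β(k, γ)(u(λ)) = ∏ₘ χ((γ · λ)(m)) ^ det(k, m) u((k, γ) · λ)`. -/
def twistedBernoulliShift (μ : Cocycle H) (χ : AddChar H Circle) :
    VNSystem AffineGroup (L2 (Lam H)) where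
  alg := twistedGroupVN μ.tilde
  Ω := delta 0
  norm_Ω := norm_delta 0
  U := shiftUnitary χ
  U_Ω g := by
    refine (monomial_delta _ _ _).trans ?_
    have h : phase χ g 0 = 1 := by simp [phase]
    have h' : (Lam.act g).toEquiv (0 : Lam H) = 0 := map_zero (Lam.act g)
    rw [h, h', Circle.coe_one, one_smul]
  conj_mem g x hx := by
    refine conj_mem_vonNeumannClosure _ ?_ hx
    rintro _ ⟨l, rfl⟩
    rw [conj_shiftUnitary]
    exact SMulMemClass.smul_mem (s := (vonNeumannClosure (Set.range (twistedOp μ.tilde))).toStarSubalgebra) _ (subset_vonNeumannClosure _ ⟨_, rfl⟩)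

end TwistedBernoulliShift


section OddPrimes

/-- The odd prime numbers. -/
abbrev OddPrime : Type := {q : ℕ // q.Prime ∧ Odd q}

instance (q : OddPrime) : NeZero q.1 := ⟨q.2.1.ne_zero⟩

/-- The group `H_q = (ℤ/qℤ)²`. -/
abbrev HGroup (q : ℕ) : Type := ZMod q × ZMod q

/-- The cocycle `μ_q((s₁, t₁), (s₂, t₂)) = exp(2πi s₁ t₂ / q)` on `(ℤ/qℤ)²`. -/
def muCocycle (q : ℕ) [NeZero q] : Cocycle (HGroup q) where
  toFun x y := ZMod.toCircle (x.1 * y.2)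
  assoc' a b c := by
    rw [← AddChar.map_add_eq_mul, ← AddChar.map_add_eq_mul, Prod.fst_add, Prod.snd_add]
    congr 1
    ring
  zero_left' a := by simp
  zero_right' a := by simp

/-- The character `χ_q(s, t) = exp(2πi s / q)` of `(ℤ/qℤ)²`. -/
def chiChar (q : ℕ) [NeZero q] : AddChar (HGroup q) Circle :=
  ZMod.toCircle.compAddMonoidHom (AddMonoidHom.fst (ZMod q) (ZMod q))

theorem muCocycle_apply (q : ℕ) [NeZero q] (s₁ t₁ s₂ t₂ : ℤ) :
    (muCocycle q ((s₁ : ZMod q), (t₁ : ZMod q)) ((s₂ : ZMod q), (t₂ : ZMod q)) : ℂ) =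
      Complex.exp (2 * Real.pi * Complex.I * (s₁ * t₂) / q) := by
  change ((ZMod.toCircle ((s₁ : ZMod q) * (t₂ : ZMod q)) : Circle) : ℂ) = _
  rw [← Int.cast_mul, ZMod.toCircle_intCast]
  push_cast
  rfl

theorem chiChar_apply (q : ℕ) [NeZero q] (s t : ℤ) :
    (chiChar q ((s : ZMod q), (t : ZMod q)) : ℂ) =
      Complex.exp (2 * Real.pi * Complex.I * s / q) := ZMod.toCircle_intCast s

/-- The twisted Bernoulli shift action `β_q = β(H_q, μ_q, χ_q)` on `N(H_q, μ_q)`. -/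
def betaPrime (q : OddPrime) : VNSystem AffineGroup (L2 (Lam (HGroup q.1))) :=
  twistedBernoulliShift (muCocycle q.1) (chiChar q.1)

variable (Q : Set OddPrime)

/-- The tensor product action `β_Q = ⨂_{q ∈ Q} β_q` on `⨂_{q ∈ Q} N(H_q, μ_q)`. -/
def betaTensor : VNSystem AffineGroup (HilbertTensor fun q : Q => (betaPrime q.1).norm_Ω) :=
  VNSystem.tensor fun q : Q => betaPrime q.1

/-- The group `H_Q = ⨁_{q ∈ Q} (ℤ/qℤ)²`. -/
abbrev HSum : Type := Π₀ q : Q, HGroup q.1.1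

/-- The component homomorphism `H_Q → H_q`. -/
def HSum.component (q : Q) : HSum Q →+ HGroup q.1.1 :=
  DFinsupp.evalAddMonoidHom q

variable {Q} in
theorem HSum.finite_component (s : HSum Q) : {q | HSum.component Q q s ≠ 0}.Finite :=
  s.finite_support

/-- The cocycle `μ_Q((s_q), (t_q)) = ∏_{q ∈ Q} μ_q(s_q, t_q)` on `H_Q`. -/
def muSum : Cocycle (HSum Q) :=
  Cocycle.prod (HSum.component Q) HSum.finite_component fun q => muCocycle q.1.1

/-- The character `χ_Q((s_q)) = ∏_{q ∈ Q} χ_q(s_q)` of `H_Q`. -/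
def chiSum : AddChar (HSum Q) Circle :=
  prodChar (HSum.component Q) HSum.finite_component fun q => chiChar q.1.1

end OddPrimes

end TwistedBernoulli
end

open TwistedBernoulli

noncomputable section
open scoped ComplexOrder InnerProductSpace
open Filter
namespace TwistedBernoulli

/-! ### Operator order, monotone strong limits, and fixed points of automorphisms. -/

section NormalityOfIsomorphisms
open Topology
variable {E : Type*} [NormedAddCommGroup E] [InnerProductSpace ℂ E] [CompleteSpace E]

/-! The group Λ(H_Q) is the direct sum of the groups Λ(H_q), and its cocycle and phases are the
products of those of the components. Hence ⊗ δ_{λ_q} ↦ δ_λ is a unitary from ⨂ ℓ²(Λ(H_q)) onto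
ℓ²(Λ(H_Q)) which carries the algebra, the vacuum and the unitary representation of `betaTensor Q` to
those of the single shift β(H_Q, μ_Q, χ_Q) (`nonempty_spatialIso_betaTensor`). This is the second
claim, and it reduces the other three to the single shift.

The first claim is read off the Fourier coefficients x ↦ x δ₀. The commutator of μ_Q is
nondegenerate, so a central element has no coefficient away from 0; δ₀ is a separating trace vector,
so isometries are unitary; and Λ(H_Q) is countable and torsion, hence an increasing union of finite
subgroups (`isAFDII₁Factor_of_nondegenerate`).

The last two claims rest on the rigidity of an equivariant isomorphism θ from β(H, μ, χ) to β(H',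
μ', χ'). The unitary u(h δ₀ - h δ_{e₁}) is fixed by the matrices [[1, n], [0, 1]], so square
summability confines the coefficients of its image to functions on the line ℤ × 0
(`coeff_eq_zero_of_fixed`). Moreover, two edges of the triangle 0, e₁, e₁ + e₂ multiply to a
multiple of the third, and the lines carrying the images meet so little that the image must be a
multiple of u(f(h) δ₀ - f(h) δ_{e₁}) (`exists_eq_smul_pair`). Here f is an injective homomorphism,
and the two triangles of the unit square give χ'(f h)² = χ(h)² together with a formula for the
scalars (`exists_addMonoidHom_of_iso`).

By torsion, an injective homomorphism H_Q → H_{Q'} forces Q ⊆ Q', which settles conjugacy. When Q =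
Q', odd orders remove the squares and f preserves χ_Q and the commutator of μ_Q, so it is a shear
(s, t) ↦ (s, t + a s) in each component (`exists_eq_shear_of_relations`). Conversely each shear
comes from an automorphism of the shift, since it changes μ_q by the coboundary of exp(2πi a s² /
2q), with 2 inverted modulo q (`shearCoeff_mul`, `shearAut`).

An element of the centralizer is determined by f, but this takes work: the isomorphisms are only
algebraic, with neither continuity nor preservation of the trace assumed. `map_eq_self_of_dense`
shows that an automorphism with 2-norm dense fixed points is trivial, using only that *-isomorphisms
respect the order and therefore limits of decreasing sequences. Finally a ↦ `shearAut a` is a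
continuous bijection from a compact group onto a Hausdorff one, hence a homeomorphism
(`bernoulliCentralizerEquiv`). -/

theorem mem_of_commute_commutant {N : VonNeumannAlgebra E} {x : E →L[ℂ] E}
    (h : ∀ y ∈ N.commutant, y * x = x * y) : x ∈ N := by
  rw [← VonNeumannAlgebra.commutant_commutant N, VonNeumannAlgebra.mem_commutant_iff]
  exact h

theorem sqrt_mem {N : VonNeumannAlgebra E} {x : E →L[ℂ] E} (hx : x ∈ N) : CFC.sqrt x ∈ N := by
  refine mem_of_commute_commutant fun y hy => ?_
  have h : Commute x y := VonNeumannAlgebra.mem_commutant_iff.1 hy x hx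
  exact (h.cfcₙ_nnreal _).symm

/-- The order of ℂ also demands that the difference be real, so self-adjointness of `y - x` is
included on the right. -/
theorem loewner_iff {x y : E →L[ℂ] E} : x ≤ y ↔ ∀ v, ⟪v, x v⟫_ℂ ≤ ⟪v, y v⟫_ℂ := by
  rw [ContinuousLinearMap.le_def, ContinuousLinearMap.isPositive_iff_complex]
  have key : ∀ v, ⟪(y - x) v, v⟫_ℂ = star (⟪v, y v⟫_ℂ - ⟪v, x v⟫_ℂ) := fun v => by
    rw [← inner_sub_right, ← sub_apply]
    exact (inner_conj_symm _ _).symm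
  refine forall_congr' fun v => ?_
  have h : ⟪v, x v⟫_ℂ ≤ ⟪v, y v⟫_ℂ ↔ 0 ≤ ⟪(y - x) v, v⟫_ℂ := by
    rw [key, star_nonneg_iff, sub_nonneg]
  rw [h, Complex.nonneg_iff, RCLike.re_eq_complex_re]
  constructor
  · rintro ⟨h1, h2⟩
    refine ⟨h2, ?_⟩
    rw [← h1]
    exact (Complex.ofReal_im _).symm
  · rintro ⟨h1, h2⟩
    exact ⟨Complex.ext rfl h2, h1⟩

/-- The difference is `star s * s` with `s` its square root, which lies in `N`. This replaces every
continuity assumption on isomorphisms. -/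
theorem map_le_map {E' : Type*} [NormedAddCommGroup E'] [InnerProductSpace ℂ E'] [CompleteSpace E']
    {N : VonNeumannAlgebra E} {M : VonNeumannAlgebra E'}
    (θ : N.toStarSubalgebra →⋆ₐ[ℂ] M.toStarSubalgebra) {x y : N.toStarSubalgebra}
    (h : (x : E →L[ℂ] E) ≤ y) : (θ x : E' →L[ℂ] E') ≤ θ y := by
  have h0 : (0 : E →L[ℂ] E) ≤ y - x := sub_nonneg.2 h
  set s : N.toStarSubalgebra := ⟨CFC.sqrt ((y : E →L[ℂ] E) - x), sqrt_mem (sub_mem y.2 x.2)⟩ with hs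
  have e : y - x = star s * s := by
    apply Subtype.ext
    have hsa : star (CFC.sqrt ((y : E →L[ℂ] E) - x)) = CFC.sqrt ((y : E →L[ℂ] E) - x) :=
      (CFC.sqrt_nonneg _).isSelfAdjoint
    change (y : E →L[ℂ] E) - x = star (CFC.sqrt ((y : E →L[ℂ] E) - x)) * CFC.sqrt _
    rw [hsa, CFC.sqrt_mul_sqrt_self _ h0]
  have e2 : (θ y : E' →L[ℂ] E') - θ x = star (θ s : E' →L[ℂ] E') * (θ s : E' →L[ℂ] E') := by
    have := congrArg (fun z => (θ z : E' →L[ℂ] E')) e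
    simpa [map_sub, map_mul, map_star] using this
  rw [← sub_nonneg, e2]
  exact star_mul_self_nonneg _

/-- With `s` the square root of `T`, this is `‖s (s v)‖ ≤ ‖s‖ ‖s v‖` squared. It upgrades
convergence of quadratic forms to strong convergence. -/
theorem norm_sq_apply_le {T : E →L[ℂ] E} (hT : 0 ≤ T) (v : E) :
    ‖T v‖ ^ 2 ≤ ‖T‖ * ‖⟪v, T v⟫_ℂ‖ := by
  set s := CFC.sqrt T with hs
  have hsa : star s = s := (CFC.sqrt_nonneg T).isSelfAdjoint
  have e : s * s = T := CFC.sqrt_mul_sqrt_self T hT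
  have e1 : T v = s (s v) := by rw [← e]; rfl
  have e2 : ‖⟪v, T v⟫_ℂ‖ = ‖s v‖ ^ 2 := by
    rw [e1, ← hsa, ContinuousLinearMap.star_eq_adjoint, ContinuousLinearMap.adjoint_inner_right,
      ← ContinuousLinearMap.star_eq_adjoint, hsa, inner_self_eq_norm_sq_to_K]
    simp
  have e3 : ‖T‖ = ‖s‖ ^ 2 := by
    rw [← e]
    nth_rewrite 1 [← hsa]
    rw [CStarRing.norm_star_mul_self, sq]
  rw [e2, e1, e3, ← mul_pow]
  exact pow_le_pow_left₀ (norm_nonneg _) (s.le_opNorm _) 2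

/-- A decreasing sequence of positive operators converges strongly. -/
theorem exists_tendsto_of_antitone {c : ℕ → E →L[ℂ] E} (hc : Antitone c) (h0 : ∀ m, 0 ≤ c m) :
    ∃ a : E →L[ℂ] E, ∀ v, Tendsto (fun m => c m v) atTop (𝓝 (a v)) := by
  have hlim : ∀ v, ∃ w, Tendsto (fun m => c m v) atTop (𝓝 w) := by
    intro v
    set q : ℕ → ℝ := fun m => (⟪v, c m v⟫_ℂ).re with hq
    have hqa : Antitone q := fun m n h => (Complex.le_def.1 (loewner_iff.1 (hc h) v)).1
    have hq0 : ∀ m, 0 ≤ q m := fun m => by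
      have := (Complex.le_def.1 (loewner_iff.1 (h0 m) v)).1
      simpa using this
    have hqc : CauchySeq q := (tendsto_atTop_ciInf hqa ⟨0, by rintro _ ⟨m, rfl⟩; exact hq0 m⟩).cauchySeq
    -- The differences are positive with norm at most `‖c 0‖`, so the vectors are Cauchy because the
    -- monotone bounded sequence `q` is.
    have key : ∀ m n, m ≤ n → ‖c m v - c n v‖ ^ 2 ≤ ‖c 0‖ * (q m - q n) := by
      intro m n h
      have hp : 0 ≤ c m - c n := sub_nonneg.2 (hc h)
      have h1 := norm_sq_apply_le hp v
      have h2 : ‖c m - c n‖ ≤ ‖c 0‖ :=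
        CStarAlgebra.norm_le_norm_of_nonneg_of_le hp
          ((sub_le_self _ (h0 n)).trans (hc (Nat.zero_le m)))
      have h3 : ‖⟪v, (c m - c n) v⟫_ℂ‖ = q m - q n := by
        have h4 := loewner_iff.1 hp v
        rw [zero_apply, inner_zero_right] at h4
        have h6 : (‖⟪v, (c m - c n) v⟫_ℂ‖ : ℝ) = (⟪v, (c m - c n) v⟫_ℂ).re := by
          rw [← Complex.ofReal_re ‖_‖, Complex.norm_of_nonneg' h4]
        rw [h6, sub_apply, inner_sub_right, Complex.sub_re]
      rw [h3] at h1
      refine h1.trans (mul_le_mul_of_nonneg_right h2 (sub_nonneg.2 (hqa h)))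
    refine cauchySeq_tendsto_of_complete (Metric.cauchySeq_iff'.2 fun ε hε => ?_)
    obtain ⟨M, hM⟩ := Metric.cauchySeq_iff'.1 hqc (ε ^ 2 / (‖c 0‖ + 1)) (by positivity)
    refine ⟨M, fun n hn => ?_⟩
    rw [dist_comm, dist_eq_norm]
    refine lt_of_pow_lt_pow_left₀ 2 hε.le ((key M n hn).trans_lt ?_)
    have h5 := hM n hn
    rw [dist_comm, Real.dist_eq, abs_of_nonneg (sub_nonneg.2 (hqa hn)),
      lt_div_iff₀ (by positivity)] at h5
    nlinarith [sub_nonneg.2 (hqa hn)]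
  choose f hf using hlim
  exact ⟨continuousLinearMapOfTendsto c (tendsto_pi_nhds.2 hf), hf⟩

/-- The subalgebra of elements of `N` fixed by an automorphism. -/
def fixedSubalgebra {N : VonNeumannAlgebra E} (β : N.toStarSubalgebra ≃⋆ₐ[ℂ] N.toStarSubalgebra) :
    StarSubalgebra ℂ (E →L[ℂ] E) where
  carrier := {x | ∃ h : x ∈ N.toStarSubalgebra, β ⟨x, h⟩ = ⟨x, h⟩}
  mul_mem' := by
    rintro x y ⟨hx, hx'⟩ ⟨hy, hy'⟩
    refine ⟨mul_mem hx hy, ?_⟩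
    have := map_mul β ⟨x, hx⟩ ⟨y, hy⟩
    rw [hx', hy'] at this
    exact this
  add_mem' := by
    rintro x y ⟨hx, hx'⟩ ⟨hy, hy'⟩
    refine ⟨add_mem hx hy, ?_⟩
    have := map_add β ⟨x, hx⟩ ⟨y, hy⟩
    rw [hx', hy'] at this
    exact this
  algebraMap_mem' r := by
    refine ⟨algebraMap_mem N.toStarSubalgebra r, ?_⟩
    have := map_smul β r 1
    rw [map_one] at this
    have e : (⟨algebraMap ℂ (E →L[ℂ] E) r, algebraMap_mem N.toStarSubalgebra r⟩ :
      N.toStarSubalgebra) = r • 1 := Subtype.ext (Algebra.algebraMap_eq_smul_one r)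
    rw [e]
    exact this
  star_mem' := by
    rintro x ⟨hx, hx'⟩
    refine ⟨star_mem hx, ?_⟩
    have := map_star β ⟨x, hx⟩
    rw [hx'] at this
    exact this

variable {N : VonNeumannAlgebra E} (β : N.toStarSubalgebra ≃⋆ₐ[ℂ] N.toStarSubalgebra)

theorem inverse_mem_fixedSubalgebra {b c : E →L[ℂ] E} (hb : b ∈ fixedSubalgebra β)
    (hbc : b * c = 1) (hcb : c * b = 1) : c ∈ fixedSubalgebra β := by
  obtain ⟨hb, hb'⟩ := hb
  have hc : c ∈ N.toStarSubalgebra := by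
    refine mem_of_commute_commutant fun y hy => ?_
    have h : b * y = y * b := VonNeumannAlgebra.mem_commutant_iff.1 hy b hb
    calc y * c = c * (b * y) * c := by rw [← mul_assoc, hcb, one_mul]
      _ = c * y * (b * c) := by rw [h]; simp only [mul_assoc]
      _ = c * y := by rw [hbc, mul_one]
  refine ⟨hc, ?_⟩
  have h1 : β ⟨c, hc⟩ * ⟨b, hb⟩ = 1 := by
    conv_lhs => rw [← hb']
    rw [← map_mul]
    have : (⟨c, hc⟩ * ⟨b, hb⟩ : N.toStarSubalgebra) = 1 := Subtype.ext hcb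
    rw [this, map_one]
  have h2 : (⟨b, hb⟩ * ⟨c, hc⟩ : N.toStarSubalgebra) = 1 := Subtype.ext hbc
  calc β ⟨c, hc⟩ = β ⟨c, hc⟩ * (⟨b, hb⟩ * ⟨c, hc⟩) := by rw [h2, mul_one]
    _ = ⟨c, hc⟩ := by rw [← mul_assoc, h1, one_mul]

theorem le_of_tendsto_apply {c : ℕ → E →L[ℂ] E} {a x : E →L[ℂ] E}
    (hc : ∀ v, Tendsto (fun m => c m v) atTop (𝓝 (a v))) (h : ∀ᶠ m in atTop, x ≤ c m) : x ≤ a :=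
  loewner_iff.2 fun v => ge_of_tendsto (tendsto_const_nhds.inner (hc v))
    (h.mono fun _ hm => loewner_iff.1 hm v)

theorem le_of_antitone_tendsto {c : ℕ → E →L[ℂ] E} {a : E →L[ℂ] E} (hm : Antitone c)
    (hc : ∀ v, Tendsto (fun m => c m v) atTop (𝓝 (a v))) (m : ℕ) : a ≤ c m :=
  loewner_iff.2 fun v => le_of_tendsto (tendsto_const_nhds.inner (hc v))
    ((eventually_ge_atTop m).mono fun _ h => loewner_iff.1 (hm h) v)

/-- An automorphism of a von Neumann algebra which fixes all members of a decreasing sequence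
fixes its limit. -/
theorem limit_mem_fixedSubalgebra {c : ℕ → E →L[ℂ] E} {a : E →L[ℂ] E} (hm : Antitone c)
    (hc : ∀ v, Tendsto (fun m => c m v) atTop (𝓝 (a v))) (hf : ∀ m, c m ∈ fixedSubalgebra β) :
    a ∈ fixedSubalgebra β := by
  have ha : a ∈ N.toStarSubalgebra := by
    refine mem_of_commute_commutant fun y hy => ContinuousLinearMap.ext fun v => ?_
    have h1 : Tendsto (fun m => y (c m v)) atTop (𝓝 (y (a v))) :=
      (y.continuous.tendsto _).comp (hc v)
    have h2 : ∀ m, y (c m v) = c m (y v) := fun m =>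
      (DFunLike.congr_fun (VonNeumannAlgebra.mem_commutant_iff.1 hy _ (hf m).1) v).symm
    simp only [h2] at h1
    exact tendsto_nhds_unique h1 (hc (y v))
  refine ⟨ha, Subtype.ext ?_⟩
  -- An order isomorphism preserves greatest lower bounds: `β` gives one inequality, and `β.symm`
  -- followed by `β` gives the other.
  have key : ∀ γ : N.toStarSubalgebra ≃⋆ₐ[ℂ] N.toStarSubalgebra,
      (∀ m, γ ⟨c m, (hf m).1⟩ = ⟨c m, (hf m).1⟩) → ((γ ⟨a, ha⟩ : N.toStarSubalgebra) : E →L[ℂ] E) ≤ a := by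
    intro γ hγ
    refine le_of_tendsto_apply hc (Eventually.of_forall fun m => ?_)
    have := map_le_map (γ : N.toStarSubalgebra →⋆ₐ[ℂ] N.toStarSubalgebra)
      (x := ⟨a, ha⟩) (y := ⟨c m, (hf m).1⟩) (le_of_antitone_tendsto hm hc m)
    have h2 := congrArg (Subtype.val) (hγ m)
    exact this.trans_eq h2
  refine le_antisymm (key β fun m => (hf m).2) ?_
  have h1 := key β.symm fun m => by
    rw [← StarAlgEquiv.eq_symm_apply]
    exact (hf m).2.symm
  have := map_le_map (β : N.toStarSubalgebra →⋆ₐ[ℂ] N.toStarSubalgebra)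
      (x := β.symm ⟨a, ha⟩) (y := ⟨a, ha⟩) h1
  have e : (β : N.toStarSubalgebra →⋆ₐ[ℂ] N.toStarSubalgebra) (β.symm ⟨a, ha⟩) = ⟨a, ha⟩ :=
    β.apply_symm_apply _
  rw [e] at this
  exact this

/-- Conjugating `a ≤ c = b⁻¹` by √b gives √b a √b ≤ 1, that is ‖√a √b‖ ≤ 1; hence √a b √a ≤ 1, and
conjugation by √a finishes. Invertibility of `a` is not needed. -/
theorem conj_inverse_le {a b c : E →L[ℂ] E} (ha : 0 ≤ a) (hb : 0 ≤ b) (hac : a ≤ c)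
    (hbc : b * c = 1) (hcb : c * b = 1) : a * b * a ≤ a := by
  set s := CFC.sqrt a
  set t := CFC.sqrt b
  have hs : star s = s := (CFC.sqrt_nonneg a).isSelfAdjoint
  have ht : star t = t := (CFC.sqrt_nonneg b).isSelfAdjoint
  have es : s * s = a := CFC.sqrt_mul_sqrt_self a ha
  have et : t * t = b := CFC.sqrt_mul_sqrt_self b hb
  have h1 : t * a * t ≤ 1 := by
    have h := star_left_conjugate_le_conjugate hac t
    rw [ht] at h
    refine h.trans_eq ?_
    have hct : Commute c t := by
      have : Commute b c := hbc.trans hcb.symm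
      exact (this.cfcₙ_nnreal _).symm
    rw [← hct.eq, mul_assoc, et, hcb]
  have h2 : s * b * s ≤ 1 := by
    have e1 : star (s * t) * (s * t) = t * a * t := by
      rw [star_mul, hs, ht, ← es]; simp only [mul_assoc]
    have e2 : star (t * s) * (t * s) = s * b * s := by
      rw [star_mul, hs, ht, ← et]; simp only [mul_assoc]
    have n1 : ‖s * t‖ ^ 2 ≤ 1 := by
      rw [sq, ← CStarRing.norm_star_mul_self, e1]
      exact (CStarAlgebra.norm_le_one_iff_of_nonneg _ (e1 ▸ star_mul_self_nonneg _)).2 h1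
    rw [← e2]
    refine (CStarAlgebra.norm_le_one_iff_of_nonneg _ (star_mul_self_nonneg _)).1 ?_
    have e3 : star (t * s) = s * t := by rw [star_mul, hs, ht]
    rw [CStarRing.norm_star_mul_self, ← sq, ← norm_star (t * s), e3]
    exact n1
  have h3 := star_left_conjugate_le_conjugate h2 s
  rw [hs, mul_one, es] at h3
  refine le_of_eq_of_le ?_ h3
  rw [← es]; simp only [mul_assoc]

end NormalityOfIsomorphisms

/-! ### Compressing a 2-norm limit between fixed operators. -/

section NormalityOfIsomorphisms
open Topology
variable {E : Type*} [NormedAddCommGroup E] [InnerProductSpace ℂ E] [CompleteSpace E]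
variable {N : VonNeumannAlgebra E}

/-- The trace property turns (y_k - x) a Ω into a (y_k - x) Ω in norm, and `w` commutes past
elements of `N`. Only vectors `w Ω` are reached, because the `y k` need not be bounded in norm. -/
theorem tendsto_mul_apply_of_commutant {Ω : E} (htr : ∀ x ∈ N, ‖star x Ω‖ = ‖x Ω‖)
    {x : E →L[ℂ] E} (hx : x ∈ N) (hxs : star x = x) {y : ℕ → E →L[ℂ] E} (hy : ∀ k, y k ∈ N)
    (hys : ∀ k, star (y k) = y k) (hlim : Tendsto (fun k => y k Ω) atTop (𝓝 (x Ω)))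
    {a : E →L[ℂ] E} (ha : a ∈ N) (has : star a = a) {w : E →L[ℂ] E} (hw : w ∈ N.commutant) :
    Tendsto (fun k => (a * y k * a) (w Ω)) atTop (𝓝 ((a * x * a) (w Ω))) := by
  have h1 : Tendsto (fun k => (y k - x) Ω) atTop (𝓝 0) := by
    have := hlim.sub_const (x Ω)
    rwa [sub_self] at this
  have h2 : Tendsto (fun k => ((y k - x) * a) Ω) atTop (𝓝 0) := by
    have h3 : Tendsto (fun k => a ((y k - x) Ω)) atTop (𝓝 0) := by
      have := (a.continuous.tendsto 0).comp h1
      rwa [map_zero] at this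
    rw [tendsto_zero_iff_norm_tendsto_zero] at h3 ⊢
    refine h3.congr fun k => ?_
    rw [← htr _ (mul_mem (sub_mem (hy k) hx) ha), star_mul, star_sub, has, hys, hxs]
    rfl
  have h4 : Tendsto (fun k => w (((y k - x) * a) Ω)) atTop (𝓝 0) := by
    have := (w.continuous.tendsto 0).comp h2
    rwa [map_zero] at this
  have h5 : Tendsto (fun k => a (w (((y k - x) * a) Ω))) atTop (𝓝 0) := by
    have := (a.continuous.tendsto 0).comp h4
    rwa [map_zero] at this
  rw [← tendsto_sub_nhds_zero_iff]
  refine h5.congr fun k => ?_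
  have hc : (y k - x) * a * w = w * ((y k - x) * a) :=
    VonNeumannAlgebra.mem_commutant_iff.1 hw _ (mul_mem (sub_mem (hy k) hx) ha)
  have h6 := DFunLike.congr_fun hc Ω
  change _ = w (((y k - x) * a) Ω) at h6
  rw [← h6]
  simp [sub_mul, mul_assoc]

theorem dense_loewner {D : Set E} (hD : Dense D) {x y : E →L[ℂ] E}
    (h : ∀ v ∈ D, ⟪v, x v⟫_ℂ ≤ ⟪v, y v⟫_ℂ) : x ≤ y := by
  rw [loewner_iff]
  intro v
  have hcl : IsClosed {v : E | ⟪v, x v⟫_ℂ ≤ ⟪v, y v⟫_ℂ} :=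
    isClosed_le (continuous_id.inner x.continuous) (continuous_id.inner y.continuous)
  exact closure_minimal h hcl (hD v)

/-- Bounds on the compressed differences survive the 2-norm limit, since quadratic forms can be
tested on the dense set of vectors `w Ω` with `w` in the commutant. -/
theorem compressed_le {Ω : E} (htr : ∀ x ∈ N, ‖star x Ω‖ = ‖x Ω‖)
    (hcyc : Dense {ξ | ∃ v ∈ N.commutant, v Ω = ξ})
    {x : E →L[ℂ] E} (hx : x ∈ N) (hxs : star x = x) {y : ℕ → E →L[ℂ] E} (hy : ∀ k, y k ∈ N)
    (hys : ∀ k, star (y k) = y k) (hlim : Tendsto (fun k => y k Ω) atTop (𝓝 (x Ω)))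
    {a : E →L[ℂ] E} (ha : a ∈ N) (has : star a = a) {T : E →L[ℂ] E} {j : ℕ}
    (h : ∀ m, j ≤ m → a * (y m - y j) * a ≤ T) : a * (x - y j) * a ≤ T := by
  refine dense_loewner hcyc ?_
  rintro _ ⟨w, hw, rfl⟩
  have h1 := tendsto_mul_apply_of_commutant htr hx hxs hy hys hlim ha has hw
  have h2 : Tendsto (fun k => (a * (y k - y j) * a) (w Ω)) atTop (𝓝 ((a * (x - y j) * a) (w Ω))) := by
    have := h1.sub_const ((a * y j * a) (w Ω))
    simp only [mul_sub, sub_mul, sub_apply]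
    exact this
  exact le_of_tendsto (tendsto_const_nhds.inner h2)
    ((eventually_ge_atTop j).mono fun m hm => loewner_iff.1 (h m hm) _)

theorem fixed_mem {β : N.toStarSubalgebra ≃⋆ₐ[ℂ] N.toStarSubalgebra} {x : E →L[ℂ] E}
    (h : x ∈ fixedSubalgebra β) : x ∈ N := h.1

/-- Everything in the inequality except `x` is fixed by `β`, so applying `β` yields the same bound
for its image. -/
theorem map_compressed_le (β : N.toStarSubalgebra ≃⋆ₐ[ℂ] N.toStarSubalgebra)
    {x a y T : E →L[ℂ] E} (hx : x ∈ N.toStarSubalgebra) (ha : a ∈ fixedSubalgebra β)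
    (hy : y ∈ fixedSubalgebra β) (hT : T ∈ fixedSubalgebra β) (h : a * (x - y) * a ≤ T) :
    a * ((β ⟨x, hx⟩ : N.toStarSubalgebra) - y) * a ≤ T := by
  obtain ⟨ha, ha'⟩ := ha
  obtain ⟨hy, hy'⟩ := hy
  obtain ⟨hT, hT'⟩ := hT
  have hm : a * (x - y) * a ∈ N.toStarSubalgebra := mul_mem (mul_mem ha (sub_mem hx hy)) ha
  have e : (⟨a * (x - y) * a, hm⟩ : N.toStarSubalgebra) =
    ⟨a, ha⟩ * (⟨x, hx⟩ - ⟨y, hy⟩) * ⟨a, ha⟩ := rfl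
  have h1 := map_le_map β.toStarAlgHom (x := ⟨a * (x - y) * a, hm⟩) (y := ⟨T, hT⟩) h
  have e1 : β.toStarAlgHom ⟨a * (x - y) * a, hm⟩ = ⟨a, ha⟩ * (β ⟨x, hx⟩ - ⟨y, hy⟩) * ⟨a, ha⟩ := by
    rw [e]
    change β _ = _
    rw [map_mul, map_mul, map_sub, ha', hy']
  have e2 : β.toStarAlgHom ⟨T, hT⟩ = ⟨T, hT⟩ := hT'
  rw [e1, e2] at h1
  exact h1

/-- The fixed operators `d k` dominate the increments of the approximants `y k`. Their partial sums
may be unbounded, but compression by the fixed operator `a`, the limit of their inverses shifted by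
1, makes them bounded. The tails then tend strongly to zero and control both `x` and its image,
while the small traces keep `a Ω` close to `Ω`. -/
theorem exists_compression (β : N.toStarSubalgebra ≃⋆ₐ[ℂ] N.toStarSubalgebra) {Ω : E}
    (htr : ∀ x ∈ N, ‖star x Ω‖ = ‖x Ω‖)
    (hcyc : Dense {ξ | ∃ v ∈ N.commutant, v Ω = ξ})
    {x : E →L[ℂ] E} (hx : x ∈ N.toStarSubalgebra) (hxs : star x = x)
    {y d : ℕ → E →L[ℂ] E} (hy : ∀ k, y k ∈ fixedSubalgebra β) (hys : ∀ k, star (y k) = y k)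
    (hlim : Tendsto (fun k => y k Ω) atTop (𝓝 (x Ω)))
    (hd : ∀ k, d k ∈ fixedSubalgebra β) (hd0 : ∀ k, 0 ≤ d k)
    (hd1 : ∀ k, y (k + 1) - y k ≤ d k) (hd2 : ∀ k, -(y (k + 1) - y k) ≤ d k)
    {ε : ℝ} (hε : ∀ m, (⟪Ω, (∑ k ∈ Finset.range m, d k) Ω⟫_ℂ).re ≤ ε) :
    ∃ a ∈ N, star a = a ∧ ‖Ω - a Ω‖ ^ 2 ≤ ε ∧
      a * ((β ⟨x, hx⟩ : N.toStarSubalgebra) - x) * a = 0 := by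
  set S : ℕ → E →L[ℂ] E := fun m => ∑ k ∈ Finset.range m, d k with hS
  have hSm : Monotone S := monotone_nat_of_le_succ fun m => by
    rw [hS]
    simp only [Finset.sum_range_succ]
    exact le_add_of_nonneg_right (hd0 m)
  have hS0 : ∀ m, 0 ≤ S m := fun m => Finset.sum_nonneg fun k _ => hd0 k
  have hSf : ∀ m, S m ∈ fixedSubalgebra β := fun m => sum_mem fun k _ => hd k
  have hbu : ∀ m, IsUnit (1 + S m) := fun m =>
    CStarAlgebra.isUnit_of_le 1 (le_add_of_nonneg_right (hS0 m))
  choose u hu using hbu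
  have hu0 : ∀ m, 0 ≤ (u m : E →L[ℂ] E) := fun m => by
    rw [hu]
    exact add_nonneg zero_le_one (hS0 m)
  -- Since `S` increases, the inverses `(1 + S m)⁻¹` decrease, so they have a strong limit `a`,
  -- which is again fixed by `β`.
  set c : ℕ → E →L[ℂ] E := fun m => ((u m)⁻¹ : (E →L[ℂ] E)ˣ) with hc
  have hbc : ∀ m, (1 + S m) * c m = 1 := fun m => by rw [← hu]; exact (u m).mul_inv
  have hcb : ∀ m, c m * (1 + S m) = 1 := fun m => by rw [← hu]; exact (u m).inv_mul
  have hca : Antitone c := fun m n h => CStarAlgebra.inv_le_inv (hu0 m) (by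
    rw [hu, hu]
    exact add_le_add_right (hSm h) 1)
  have hc0 : ∀ m, 0 ≤ c m := fun m => CFC.inv_nonneg_of_nonneg (u m) (hu0 m)
  have hcf : ∀ m, c m ∈ fixedSubalgebra β := fun m =>
    inverse_mem_fixedSubalgebra β (add_mem (one_mem _) (hSf m)) (hbc m) (hcb m)
  obtain ⟨a, hac⟩ := exists_tendsto_of_antitone hca hc0
  have haf : a ∈ fixedSubalgebra β := limit_mem_fixedSubalgebra β hca hac hcf
  have ha0 : 0 ≤ a := le_of_tendsto_apply hac (Eventually.of_forall hc0)
  have hale : ∀ m, a ≤ c m := le_of_antitone_tendsto hca hac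
  have ha1 : a ≤ 1 := (hale 0).trans_eq (by
    have := hcb 0
    have e0 : S 0 = 0 := Finset.sum_range_zero _
    rwa [e0, add_zero, mul_one] at this)
  have has : star a = a := ha0.isSelfAdjoint
  have hconj : ∀ {s t : E →L[ℂ] E}, s ≤ t → a * s * a ≤ a * t * a := fun {s t} h => by
    have := star_left_conjugate_le_conjugate h a
    rwa [has] at this
  -- This uniform bound comes from a S a ≤ a (1 + S) a ≤ a ≤ 1.
  have haSa : ∀ m, a * S m * a ≤ 1 := fun m => by
    have h1 := conj_inverse_le ha0 (add_nonneg zero_le_one (hS0 m)) (hale m) (hbc m) (hcb m)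
    have h2 : a * S m * a ≤ a * (1 + S m) * a :=
      hconj (le_add_of_nonneg_left zero_le_one)
    exact h2.trans (h1.trans ha1)
  -- The decreasing operators `e j` converge strongly to `W`; thus `e j - W` is a fixed bound for
  -- all compressed tails beyond `j`, and it tends strongly to zero.
  set e : ℕ → E →L[ℂ] E := fun m => 1 - a * S m * a with he
  have hea : Antitone e := fun m n h => sub_le_sub_left (hconj (hSm h)) 1
  have he0 : ∀ m, 0 ≤ e m := fun m => sub_nonneg.2 (haSa m)
  have hef : ∀ m, e m ∈ fixedSubalgebra β := fun m =>
    sub_mem (one_mem _) (mul_mem (mul_mem haf (hSf m)) haf)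
  obtain ⟨W, hW⟩ := exists_tendsto_of_antitone hea he0
  have hWf : W ∈ fixedSubalgebra β := limit_mem_fixedSubalgebra β hea hW hef
  have hWle : ∀ m, W ≤ e m := le_of_antitone_tendsto hea hW
  have hTf : ∀ j, e j - W ∈ fixedSubalgebra β := fun j => sub_mem (hef j) hWf
  have hSdiff : ∀ j m, j ≤ m → a * (S m - S j) * a ≤ e j - W := fun j m _ => by
    have : a * (S m - S j) * a = e j - e m := by
      simp only [he, mul_sub, sub_mul]
      abel
    rw [this]
    exact sub_le_sub_left (hWle m) _
  have hdiff1 : ∀ j m, j ≤ m → y m - y j ≤ S m - S j := fun j m h => by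
    induction m, h using Nat.le_induction with
    | base => simp
    | succ m hm ih =>
      have h1 := add_le_add ih (hd1 m)
      have e1 : S (m + 1) = S m + d m := Finset.sum_range_succ _ _
      rw [e1]
      convert h1 using 1 <;> abel
  have hdiff2 : ∀ j m, j ≤ m → (-y m) - (-y j) ≤ S m - S j := fun j m h => by
    induction m, h using Nat.le_induction with
    | base => simp
    | succ m hm ih =>
      have h1 := add_le_add ih (hd2 m)
      have e1 : S (m + 1) = S m + d m := Finset.sum_range_succ _ _
      rw [e1]
      convert h1 using 1 <;> abel
  have hp : ∀ j, a * (x - y j) * a ≤ e j - W := fun j =>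
    compressed_le htr hcyc hx hxs (fun k => fixed_mem (hy k)) hys hlim (fixed_mem haf) has
      fun m hm => (hconj (hdiff1 j m hm)).trans (hSdiff j m hm)
  have hn : ∀ j, a * ((-x) - (-y j)) * a ≤ e j - W := fun j => by
    refine compressed_le (y := fun k => - y k) htr hcyc (neg_mem hx) (by rw [star_neg, hxs])
      (fun k => neg_mem (fixed_mem (hy k)))
      (fun k => by rw [star_neg, hys]) ?_ (fixed_mem haf) has
      fun m hm => (hconj (hdiff2 j m hm)).trans (hSdiff j m hm)
    exact hlim.neg
  have hp' := fun j => map_compressed_le β hx haf (hy j) (hTf j) (hp j)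
  have hn' := fun j => map_compressed_le β (neg_mem hx) haf (neg_mem (hy j)) (hTf j) (hn j)
  have hneg : ((β ⟨-x, neg_mem hx⟩ : N.toStarSubalgebra) : E →L[ℂ] E) =
      -(β ⟨x, hx⟩ : N.toStarSubalgebra) := congrArg Subtype.val (map_neg β ⟨x, hx⟩)
  have hTlim : ∀ v, Tendsto (fun j => ((e j - W) + (e j - W)) v) atTop
      (𝓝 ((0 : E →L[ℂ] E) v)) := fun v => by
    have h1 := (hW v).sub_const (W v)
    have h2 := h1.add h1
    rwa [sub_self, add_zero] at h2
  refine ⟨a, fixed_mem haf, has, ?_, le_antisymm ?_ ?_⟩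
  · have h1 : 0 ≤ 1 - a := sub_nonneg.2 ha1
    have h2 := norm_sq_apply_le h1 Ω
    have h3 : ‖1 - a‖ ≤ 1 :=
      (CStarAlgebra.norm_le_one_iff_of_nonneg _ h1).2 (sub_le_self _ ha0)
    have h4 := loewner_iff.1 h1 Ω
    rw [zero_apply, inner_zero_right] at h4
    have h5 : ‖⟪Ω, (1 - a) Ω⟫_ℂ‖ = (⟪Ω, (1 - a) Ω⟫_ℂ).re := by
      rw [← Complex.ofReal_re ‖_‖, Complex.norm_of_nonneg' h4]
    have h6 : (⟪Ω, (1 - a) Ω⟫_ℂ).re ≤ ε := by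
      have h7 : Tendsto (fun m => (⟪Ω, (1 - c m) Ω⟫_ℂ).re) atTop (𝓝 (⟪Ω, (1 - a) Ω⟫_ℂ).re) :=
        (Complex.continuous_re.tendsto _).comp
          (tendsto_const_nhds.inner ((hac Ω).const_sub Ω))
      refine le_of_tendsto h7 (Eventually.of_forall fun m => le_trans ?_ (hε m))
      refine (Complex.le_def.1 (loewner_iff.1 ?_ Ω)).1
      -- As 1 - c = S (1 + S)⁻¹, the right side is S - S c = S - (1 - c). Its positivity bounds the
      -- defect 1 - c by the partial sum S.
      have h8 : S m - (1 - c m) = star (1 - c m) * (1 + S m) * (1 - c m) := by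
        have hcs : star (1 - c m) = 1 - c m := by
          rw [star_sub, star_one, (hc0 m).isSelfAdjoint.star_eq]
        rw [hcs, sub_mul, hcb, one_mul, mul_sub, mul_one, sub_mul, hbc, one_mul]
        abel
      rw [← sub_nonneg, h8]
      exact star_left_conjugate_nonneg (add_nonneg zero_le_one (hS0 m)) _
    calc ‖Ω - a Ω‖ ^ 2 = ‖(1 - a) Ω‖ ^ 2 := rfl
      _ ≤ ‖1 - a‖ * ‖⟪Ω, (1 - a) Ω⟫_ℂ‖ := h2
      _ ≤ 1 * (⟪Ω, (1 - a) Ω⟫_ℂ).re := by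
        rw [h5]
        exact mul_le_mul_of_nonneg_right h3 (Complex.le_def.1 h4).1
      _ ≤ ε := by rwa [one_mul]
  -- Adding the upper bound for the image of `x` and the one for `-x` cancels `y j`; the reverse
  -- inequality exchanges the roles.
  · refine le_of_tendsto_apply hTlim (Eventually.of_forall fun j => ?_)
    have := add_le_add (hp' j) (hn j)
    convert this using 1
    rw [← add_mul, ← mul_add]
    congr 2
    abel
  · rw [← neg_nonpos]
    refine le_of_tendsto_apply hTlim (Eventually.of_forall fun j => ?_)
    have := add_le_add (hn' j) (hp j)
    rw [hneg] at this
    convert this using 1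
    rw [← add_mul, ← mul_add, ← neg_mul, ← mul_neg]
    congr 2
    abel

end NormalityOfIsomorphisms

/-! ### Automorphisms whose fixed points are dense in the 2-norm. -/

section NormalityOfIsomorphisms
open Topology
variable {E : Type*} [NormedAddCommGroup E] [InnerProductSpace ℂ E] [CompleteSpace E]
variable {N : VonNeumannAlgebra E}

/-- The expression is the square of p - q z. With 2pq = ±1 it bounds ±z by p² + q² z², which plays
the role of |z| but is a polynomial in z, and so stays in the fixed subalgebra. -/
theorem sq_bound_identity {z : E →L[ℂ] E} (hz : star z = z) {p q : ℝ} :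
    0 ≤ ((p : ℂ) ^ 2) • (1 : E →L[ℂ] E) + ((q : ℂ) ^ 2) • (z * z) - ((2 * p * q : ℝ) : ℂ) • z := by
  have hw : star ((p : ℂ) • (1 : E →L[ℂ] E) - (q : ℂ) • z) = (p : ℂ) • 1 - (q : ℂ) • z := by
    rw [star_sub, star_smul, star_smul, star_one, hz]
    simp
  have e : ((p : ℂ) ^ 2) • (1 : E →L[ℂ] E) + ((q : ℂ) ^ 2) • (z * z) - ((2 * p * q : ℝ) : ℂ) • z =
      star ((p : ℂ) • (1 : E →L[ℂ] E) - (q : ℂ) • z) * ((p : ℂ) • 1 - (q : ℂ) • z) := by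
    rw [hw, sub_mul, mul_sub, mul_sub, smul_mul_smul_comm, smul_mul_smul_comm, smul_mul_smul_comm,
      smul_mul_smul_comm, one_mul, one_mul, mul_one]
    push_cast
    module
  rw [e]
  exact star_mul_self_nonneg _

theorem geom_sum_bound {f : ℕ → ℝ} {n : ℕ} (hf : ∀ k, f k ≤ 2 * (1 / 4) ^ (n + k)) (m : ℕ) :
    ∑ k ∈ Finset.range m, f k ≤ 4 * (1 / 4) ^ n := by
  -- The subtracted remainder makes the induction close: each new term 2r is at most 4r - r.
  have : ∑ k ∈ Finset.range m, f k ≤ 4 * (1 / 4) ^ n - 4 * (1 / 4) ^ (n + m) := by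
    induction m with
    | zero => simp
    | succ m ih =>
      rw [Finset.sum_range_succ]
      have h1 := hf m
      have h2 : (0 : ℝ) < (1 / 4) ^ (n + m) := by positivity
      have h3 : (1 / 4 : ℝ) ^ (n + (m + 1)) = (1 / 4) ^ (n + m) * (1 / 4) := by
        rw [← add_assoc, pow_succ]
      rw [h3]
      linarith
  have h2 : (0 : ℝ) < (1 / 4) ^ (n + m) := by positivity
  linarith

/-- By the trace property `star y` approximates the self-adjoint `x` as well as `y` does, so their
average serves. -/
theorem exists_selfAdjoint_approx (A : StarSubalgebra ℂ (E →L[ℂ] E)) (hAN : ∀ y ∈ A, y ∈ N) {Ω : E}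
    (htr : ∀ x ∈ N, ‖star x Ω‖ = ‖x Ω‖)
    {x : E →L[ℂ] E} (hx : x ∈ N) (hxs : star x = x) {ε : ℝ}
    (hd : ∃ y ∈ A, ‖y Ω - x Ω‖ < ε) :
    ∃ y ∈ A, star y = y ∧ ‖y Ω - x Ω‖ < ε := by
  obtain ⟨y, hy, h⟩ := hd
  refine ⟨(1 / 2 : ℂ) • (y + star y), SMulMemClass.smul_mem _ (add_mem hy (star_mem hy)), ?_, ?_⟩
  · rw [star_smul, star_add, star_star, add_comm (star y)]
    simp
  · have h1 : ‖star y Ω - x Ω‖ < ε := by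
      have h2 := htr (y - x) (sub_mem (hAN y hy) hx)
      rw [star_sub, hxs] at h2
      exact h2.trans_lt h
    have e : ((1 / 2 : ℂ) • (y + star y)) Ω - x Ω =
        (1 / 2 : ℂ) • ((y Ω - x Ω) + (star y Ω - x Ω)) := by
      simp only [smul_apply, add_apply]
      module
    rw [e, norm_smul]
    have h3 := norm_add_le (y Ω - x Ω) (star y Ω - x Ω)
    have h4 : ‖(1 / 2 : ℂ)‖ = 1 / 2 := by norm_num
    rw [h4]
    linarith

/-- An automorphism of a von Neumann algebra with a faithful trace vector is the identity, if
its fixed points are dense in the 2-norm. -/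
theorem map_eq_self_of_dense (β : N.toStarSubalgebra ≃⋆ₐ[ℂ] N.toStarSubalgebra) {Ω : E}
    (hΩ : ‖Ω‖ = 1) (htr : ∀ x ∈ N, ‖star x Ω‖ = ‖x Ω‖)
    (hcyc : Dense {ξ | ∃ v ∈ N.commutant, v Ω = ξ})
    (hd : ∀ x ∈ N, ∀ ε > 0, ∃ y ∈ fixedSubalgebra β, ‖y Ω - x Ω‖ < ε)
    (x : N.toStarSubalgebra) : β x = x := by
  have main : ∀ x : E →L[ℂ] E, ∀ hx : x ∈ N.toStarSubalgebra, star x = x →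
      ((β ⟨x, hx⟩ : N.toStarSubalgebra) : E →L[ℂ] E) = x := by
    intro x hx hxs
    -- The exponent `k + 1` leaves room for two errors to add up to at most `(1 / 4) ^ k` in the
    -- increments.
    have hap : ∀ k : ℕ, ∃ y ∈ fixedSubalgebra β, star y = y ∧ ‖y Ω - x Ω‖ < (1 / 4) ^ (k + 1) :=
      fun k => exists_selfAdjoint_approx (fixedSubalgebra β) (fun _ => fixed_mem) htr hx hxs
        (hd x hx _ (by positivity))
    choose y hyf hys hyx using hap
    set z : ℕ → E →L[ℂ] E := fun k => y (k + 1) - y k with hz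
    have hzs : ∀ k, star (z k) = z k := fun k => by rw [hz]; simp only [star_sub, hys]
    have hzf : ∀ k, z k ∈ fixedSubalgebra β := fun k => sub_mem (hyf _) (hyf _)
    have hzn : ∀ k, ‖z k Ω‖ ≤ (1 / 4) ^ k := fun k => by
      have e : z k Ω = (y (k + 1) Ω - x Ω) - (y k Ω - x Ω) := by simp [hz]
      rw [e]
      refine (norm_sub_le _ _).trans ((add_le_add (hyx _).le (hyx _).le).trans ?_)
      have h2 : (0 : ℝ) < (1 / 4) ^ k := by positivity
      rw [pow_succ, pow_succ]
      linarith
    -- The weights satisfy 2pq = 1, while p² = 4⁻ᵏ and q² ‖z Ω‖² ≤ (4ᵏ/4) · 16⁻ᵏ are both summable.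
    set p : ℕ → ℝ := fun k => (1 / 2) ^ k with hp
    set q : ℕ → ℝ := fun k => 2 ^ k / 2 with hq
    have hpq : ∀ k, 2 * p k * q k = 1 := fun k => by
      rw [hp, hq]
      simp only [one_div, inv_pow]
      field_simp
    set d : ℕ → E →L[ℂ] E := fun k =>
      ((p k : ℂ) ^ 2) • (1 : E →L[ℂ] E) + ((q k : ℂ) ^ 2) • (z k * z k) with hd'
    have hdf : ∀ k, d k ∈ fixedSubalgebra β := fun k =>
      add_mem (SMulMemClass.smul_mem _ (one_mem _))
        (SMulMemClass.smul_mem _ (mul_mem (hzf k) (hzf k)))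
    have hd1 : ∀ k, z k ≤ d k := fun k => by
      have := sq_bound_identity (hzs k) (p := p k) (q := q k)
      rw [hpq, Complex.ofReal_one, one_smul] at this
      exact sub_nonneg.1 this
    have hd2 : ∀ k, -z k ≤ d k := fun k => by
      have := sq_bound_identity (hzs k) (p := p k) (q := - q k)
      have e : ((-1 : ℝ) : ℂ) = -1 := by simp
      rw [mul_neg, hpq, e, neg_smul, one_smul] at this
      have h2 := sub_nonneg.1 this
      rwa [Complex.ofReal_neg, neg_sq] at h2
    have hd0 : ∀ k, 0 ≤ d k := fun k => by
      have e : d k = star ((p k : ℂ) • (1 : E →L[ℂ] E)) * ((p k : ℂ) • 1) +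
          star ((q k : ℂ) • z k) * ((q k : ℂ) • z k) := by
        rw [star_smul, star_smul, star_one, hzs]
        simp only [hd', Complex.star_def, Complex.conj_ofReal, smul_mul_smul_comm, one_mul, sq]
      rw [e]
      exact add_nonneg (star_mul_self_nonneg _) (star_mul_self_nonneg _)
    have hdτ : ∀ k, (⟪Ω, d k Ω⟫_ℂ).re ≤ 2 * (1 / 4) ^ k := fun k => by
      have e : ⟪Ω, d k Ω⟫_ℂ = (((p k) ^ 2 + (q k) ^ 2 * ‖z k Ω‖ ^ 2 : ℝ) : ℂ) := by
        have e1 : ⟪Ω, z k (z k Ω)⟫_ℂ = (‖z k Ω‖ : ℂ) ^ 2 := by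
          nth_rewrite 1 [← hzs k]
          rw [ContinuousLinearMap.star_eq_adjoint, ContinuousLinearMap.adjoint_inner_right,
            inner_self_eq_norm_sq_to_K]
          rfl
        have e2 : d k Ω = ((p k : ℂ) ^ 2) • Ω + ((q k : ℂ) ^ 2) • z k (z k Ω) := rfl
        rw [e2, inner_add_right, inner_smul_right, inner_smul_right, e1,
          inner_self_eq_norm_sq_to_K, hΩ]
        simp
      rw [e, Complex.ofReal_re]
      have h1 : (p k) ^ 2 = (1 / 4) ^ k := by
        rw [hp]; simp only; rw [← pow_mul, mul_comm, pow_mul]; norm_num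
      have h2 : (q k) ^ 2 = 4 ^ k / 4 := by
        rw [hq]; simp only; rw [div_pow, ← pow_mul, mul_comm, pow_mul]; norm_num
      have h3 : ‖z k Ω‖ ^ 2 ≤ ((1 / 4) ^ k) ^ 2 := pow_le_pow_left₀ (norm_nonneg _) (hzn k) 2
      have h4 : (4 : ℝ) ^ k * (1 / 4) ^ k = 1 := by rw [← mul_pow]; norm_num
      have h5 : (0 : ℝ) < 4 ^ k / 4 := by positivity
      have h6 : (0 : ℝ) < (1 / 4) ^ k := by positivity
      rw [h1, h2]
      have h7 := mul_le_mul_of_nonneg_left h3 h5.le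
      have h8 : (4 : ℝ) ^ k / 4 * ((1 / 4) ^ k) ^ 2 = (1 / 4) ^ k / 4 := by
        rw [sq]; linear_combination ((1 / 4 : ℝ) ^ k / 4) * h4
      linarith
    have hlim : Tendsto (fun k => y k Ω) atTop (𝓝 (x Ω)) := by
      rw [tendsto_iff_norm_sub_tendsto_zero]
      refine squeeze_zero (fun _ => norm_nonneg _) (fun k => (hyx k).le) ?_
      exact (tendsto_pow_atTop_nhds_zero_of_lt_one (by norm_num) (by norm_num)).comp
        (tendsto_add_atTop_nat 1)
    -- Starting the approximation at index `n` makes the total trace small, so the compressions `a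
    -- n` tend to 1 on `Ω`.
    have hcomp : ∀ n : ℕ, ∃ a ∈ N, star a = a ∧ ‖Ω - a Ω‖ ^ 2 ≤ 4 * (1 / 4) ^ n ∧
        a * ((β ⟨x, hx⟩ : N.toStarSubalgebra) - x) * a = 0 := fun n =>
      exists_compression β htr hcyc hx hxs (y := fun k => y (n + k)) (d := fun k => d (n + k))
        (fun k => hyf _) (fun k => hys _)
        (hlim.comp (tendsto_atTop_mono (fun k => Nat.le_add_left k n) tendsto_id))
        (fun k => hdf _) (fun k => hd0 _) (fun k => hd1 _) (fun k => hd2 _) fun m => by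
          rw [sum_apply, inner_sum, Complex.re_sum]
          exact geom_sum_bound (fun k => hdτ (n + k)) m
    choose a haN has haΩ ha using hcomp
    have halim : Tendsto (fun n => a n Ω) atTop (𝓝 Ω) := by
      have h1 : Tendsto (fun n => ‖Ω - a n Ω‖ ^ 2) atTop (𝓝 0) := by
        refine squeeze_zero (fun _ => by positivity) haΩ ?_
        have := (tendsto_pow_atTop_nhds_zero_of_lt_one (r := (1 / 4 : ℝ)) (by norm_num)
          (by norm_num)).const_mul 4
        rwa [mul_zero] at this
      have h2 := (Real.continuous_sqrt.tendsto 0).comp h1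
      rw [Real.sqrt_zero] at h2
      rw [tendsto_iff_norm_sub_tendsto_zero]
      refine h2.congr fun n => ?_
      rw [Function.comp_apply, Real.sqrt_sq (norm_nonneg _), norm_sub_rev]
    set t : E →L[ℂ] E := (β ⟨x, hx⟩ : N.toStarSubalgebra) - x with ht
    -- On v = w Ω with w in the commutant, a_n v = w a_n Ω → v, so ⟪v, t v⟫ is the limit of ⟪v, a_n
    -- t a_n v⟫ = 0.
    have hzero : ∀ v ∈ {ξ | ∃ v ∈ N.commutant, v Ω = ξ}, ⟪v, t v⟫_ℂ = 0 := by
      rintro _ ⟨w, hw, rfl⟩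
      have h1 : Tendsto (fun n => a n (w Ω)) atTop (𝓝 (w Ω)) := by
        refine ((w.continuous.tendsto _).comp halim).congr fun n => ?_
        exact (DFunLike.congr_fun (VonNeumannAlgebra.mem_commutant_iff.1 hw _ (haN n)) Ω).symm
      have h2 := h1.inner (𝕜 := ℂ) ((t.continuous.tendsto _).comp h1)
      refine tendsto_nhds_unique h2 (tendsto_const_nhds.congr fun n => ?_)
      have h3 : a n (t (a n (w Ω))) = 0 := DFunLike.congr_fun (ha n) (w Ω)
      rw [Function.comp_apply]
      nth_rewrite 1 [← has n]
      rw [ContinuousLinearMap.star_eq_adjoint, ContinuousLinearMap.adjoint_inner_left, h3,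
        inner_zero_right]
    have ht0 : t = 0 := by
      refine le_antisymm (dense_loewner hcyc fun v hv => ?_) (dense_loewner hcyc fun v hv => ?_)
      · rw [hzero v hv]; simp
      · rw [hzero v hv]; simp
    exact sub_eq_zero.1 ht0
  have hdecomp : ∃ x₁ x₂ : N.toStarSubalgebra, star x₁ = x₁ ∧ star x₂ = x₂ ∧
      x = x₁ + Complex.I • x₂ := by
    refine ⟨(1 / 2 : ℂ) • (x + star x), (1 / 2 : ℂ) • (-(Complex.I • (x - star x))), ?_, ?_, ?_⟩
    · rw [star_smul, star_add, star_star, add_comm (star x)]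
      simp
    · rw [star_smul, star_neg, star_smul, star_sub, star_star]
      simp only [Complex.star_def, Complex.conj_I, map_div₀, map_one, map_ofNat]
      module
    · have : Complex.I * Complex.I = -1 := Complex.I_mul_I
      rw [smul_comm, smul_neg, smul_smul, this]
      module
  obtain ⟨x₁, x₂, h1, h2, rfl⟩ := hdecomp
  have e1 : β x₁ = x₁ := Subtype.ext (main x₁.1 x₁.2 (congrArg Subtype.val h1))
  have e2 : β x₂ = x₂ := Subtype.ext (main x₂.1 x₂.2 (congrArg Subtype.val h2))
  rw [map_add, map_smul, e1, e2]

end NormalityOfIsomorphisms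

/-! ### Twisted group algebras: Fourier coefficients, trace vector, right regular representation. -/

section GroupAlgebra
open Topology
variable {Γ : Type*}

theorem inner_delta (γ : Γ) (f : L2 Γ) : ⟪delta γ, f⟫_ℂ = f γ := by
  classical
  rw [delta, lp.inner_single_left]
  simp

theorem delta_apply_self (γ : Γ) : (delta γ : L2 Γ) γ = 1 := by
  classical
  simp [delta]

theorem delta_apply_ne {γ ρ : Γ} (h : ρ ≠ γ) : (delta γ : L2 Γ) ρ = 0 := by
  classical
  simp [delta, lp.single_apply, h]

theorem hasSum_delta (f : L2 Γ) : HasSum (fun γ => f γ • delta γ) f := by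
  classical
  have h := lp.hasSum_single (E := fun _ : Γ => ℂ) (p := 2) (by norm_num) f
  refine h.congr_fun fun γ => ?_
  rw [delta, ← lp.single_smul]
  simp

theorem dense_span_delta : Dense (Submodule.span ℂ (Set.range (delta : Γ → L2 Γ)) : Set (L2 Γ)) := by
  intro f
  refine mem_closure_of_tendsto (hasSum_delta f) (Eventually.of_forall fun s => ?_)
  exact Submodule.sum_mem _ fun γ _ =>
    Submodule.smul_mem _ _ (Submodule.subset_span (Set.mem_range_self γ))

theorem clm_ext_delta {F : Type*} [NormedAddCommGroup F] [NormedSpace ℂ F] {S T : L2 Γ →L[ℂ] F}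
    (h : ∀ γ, S (delta γ) = T (delta γ)) : S = T :=
  ContinuousLinearMap.ext_on dense_span_delta (by rintro _ ⟨γ, rfl⟩; exact h γ)

theorem norm_sq_L2 (f : L2 Γ) : ‖f‖ = (∑' γ, ‖f γ‖ ^ (2 : ENNReal).toReal) ^ (1 / (2 : ENNReal).toReal) :=
  lp.norm_eq_tsum_rpow (by norm_num) f

/-- Square summability; later it excludes infinite orbits along which the coefficients have constant
modulus. -/
theorem finite_large_coeff (f : L2 Γ) {ε : ℝ} (hε : 0 < ε) : {γ | ε ≤ ‖f γ‖}.Finite := by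
  have h1 : Summable fun γ => ‖f γ‖ ^ (2 : ENNReal).toReal :=
    (memℓp_gen_iff (by norm_num)).1 (lp.memℓp f)
  have h2 := h1.tendsto_cofinite_zero.eventually (gt_mem_nhds (show 0 < ε ^ 2 by positivity))
  rw [eventually_cofinite] at h2
  refine h2.subset fun γ hγ => ?_
  rw [Set.mem_ofPred_eq, not_lt]
  have e : (2 : ENNReal).toReal = (2 : ℕ) := by norm_num
  rw [e, Real.rpow_natCast]
  exact pow_le_pow_left₀ hε.le hγ 2

variable [AddCommGroup Γ] (μ : Cocycle Γ)

theorem twistedOp_delta (γ ρ : Γ) :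
    twistedOp μ γ (delta ρ) = (μ γ ρ : ℂ) • delta (γ + ρ) := monomial_delta _ _ _

theorem twistedOp_mul (γ γ' : Γ) :
    twistedOp μ γ * twistedOp μ γ' = (μ γ γ' : ℂ) • twistedOp μ (γ + γ') := by
  refine clm_ext_delta fun ρ => ?_
  change twistedOp μ γ (twistedOp μ γ' (delta ρ)) = (μ γ γ' : ℂ) • twistedOp μ (γ + γ') (delta ρ)
  rw [twistedOp_delta, map_smul, twistedOp_delta, twistedOp_delta, smul_smul, smul_smul,
    ← Circle.coe_mul, ← Circle.coe_mul, μ.assoc γ γ' ρ, add_assoc]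

theorem twistedOp_zero : twistedOp μ 0 = 1 := by
  refine clm_ext_delta fun ρ => ?_
  rw [twistedOp_delta, μ.zero_left, zero_add, Circle.coe_one, one_smul]
  rfl

theorem star_twistedOp_mul_self (γ : Γ) : star (twistedOp μ γ) * twistedOp μ γ = 1 := by
  refine ContinuousLinearMap.ext fun f => ext_inner_left ℂ fun g => ?_
  rw [ContinuousLinearMap.star_eq_adjoint, mul_apply_eq_comp,
    ContinuousLinearMap.adjoint_inner_right]
  exact (twistedUnitary μ γ).inner_map_map g f

theorem star_twistedOp (γ : Γ) :
    star (twistedOp μ γ) = ((μ γ (-γ))⁻¹ : Circle) • twistedOp μ (-γ) := by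
  have h : twistedOp μ γ * (((μ γ (-γ))⁻¹ : Circle) • twistedOp μ (-γ)) = 1 := by
    rw [mul_smul_comm, twistedOp_mul, add_neg_cancel, twistedOp_zero]
    rw [← Circle.smul_def, smul_smul, inv_mul_cancel, one_smul]
  calc star (twistedOp μ γ) = star (twistedOp μ γ) *
        (twistedOp μ γ * (((μ γ (-γ))⁻¹ : Circle) • twistedOp μ (-γ))) := by rw [h, mul_one]
    _ = _ := by rw [← mul_assoc, star_twistedOp_mul_self, one_mul]

/-- The adjoint of u_γ is a multiple of u_{-γ}, so commutation with the adjoints comes for free. -/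
theorem commute_of_mem_twistedGroupVN {x y : L2 Γ →L[ℂ] L2 Γ} (hx : x ∈ twistedGroupVN μ)
    (h : ∀ γ, twistedOp μ γ * y = y * twistedOp μ γ) : y * x = x * y := by
  refine mem_vonNeumannClosure.1 hx y ?_
  rintro _ ⟨γ, rfl⟩
  refine ⟨h γ, ?_⟩
  rw [star_twistedOp, smul_mul_assoc, mul_smul_comm, h]

theorem twistedOp_mem (γ : Γ) : twistedOp μ γ ∈ twistedGroupVN μ :=
  subset_vonNeumannClosure _ ⟨γ, rfl⟩

/-- The operators `v_γ δ_g = μ(g, γ) δ_{g + γ}` of the right regular representation. -/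
def rightOp (γ : Γ) : L2 Γ →L[ℂ] L2 Γ := (monomial (Equiv.addRight γ) fun g => μ g γ : L2 Γ ≃ₗᵢ[ℂ] L2 Γ)

theorem rightOp_delta (γ ρ : Γ) :
    rightOp μ γ (delta ρ) = (μ ρ γ : ℂ) • delta (ρ + γ) :=
  monomial_delta (Equiv.addRight γ) (fun g => μ g γ) ρ

theorem rightOp_apply (γ ρ : Γ) (f : L2 Γ) :
    rightOp μ γ f ρ = (μ (ρ - γ) γ : ℂ) * f (ρ - γ) := by
  rw [sub_eq_add_neg]
  rfl

/-- On basis vectors this is exactly the cocycle identity. -/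
theorem twistedOp_mul_rightOp (γ γ' : Γ) :
    twistedOp μ γ * rightOp μ γ' = rightOp μ γ' * twistedOp μ γ := by
  refine clm_ext_delta fun ρ => ?_
  change twistedOp μ γ (rightOp μ γ' (delta ρ)) = rightOp μ γ' (twistedOp μ γ (delta ρ))
  rw [twistedOp_delta, rightOp_delta, map_smul, map_smul, twistedOp_delta, rightOp_delta, smul_smul,
    smul_smul, ← Circle.coe_mul, ← Circle.coe_mul, ← μ.assoc γ ρ γ', add_assoc]

theorem rightOp_mem_commutant (γ : Γ) : rightOp μ γ ∈ (twistedGroupVN μ).commutant :=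
  VonNeumannAlgebra.mem_commutant_iff.2 fun _ hx =>
    (commute_of_mem_twistedGroupVN μ hx fun γ' => twistedOp_mul_rightOp μ γ' γ).symm

variable {μ}

/-- The element commutes with v_γ, and v_γ δ₀ = δ_γ; hence `x` is determined by its coefficients `x
(delta 0)`. -/
theorem apply_delta {x : L2 Γ →L[ℂ] L2 Γ} (hx : x ∈ twistedGroupVN μ) (γ ρ : Γ) :
    x (delta γ) ρ = (μ (ρ - γ) γ : ℂ) * x (delta 0) (ρ - γ) := by
  have h1 := DFunLike.congr_fun
    (VonNeumannAlgebra.mem_commutant_iff.1 (rightOp_mem_commutant μ γ) x hx) (delta 0)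
  have h2 : rightOp μ γ (delta 0) = delta γ := by
    rw [rightOp_delta, μ.zero_left, zero_add, Circle.coe_one, one_smul]
  change x (rightOp μ γ (delta 0)) = rightOp μ γ (x (delta 0)) at h1
  rw [h2] at h1
  rw [h1, rightOp_apply]

theorem eq_of_apply_delta_zero {x y : L2 Γ →L[ℂ] L2 Γ} (hx : x ∈ twistedGroupVN μ)
    (hy : y ∈ twistedGroupVN μ) (h : x (delta 0) = y (delta 0)) : x = y := by
  refine clm_ext_delta fun γ => ?_
  ext ρ
  rw [apply_delta hx, apply_delta hy, h]

/-- The coefficient of `star x` at γ has the modulus of the coefficient of `x` at -γ. This is the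
only form in which the trace property is used. -/
theorem norm_star_apply_delta_zero {x : L2 Γ →L[ℂ] L2 Γ} (hx : x ∈ twistedGroupVN μ) :
    ‖star x (delta 0)‖ = ‖x (delta 0)‖ := by
  rw [norm_sq_L2, norm_sq_L2]
  congr 1
  rw [← (Equiv.neg Γ).tsum_eq fun γ => ‖x (delta 0) γ‖ ^ (2 : ENNReal).toReal]
  refine tsum_congr fun γ => ?_
  congr 1
  rw [← inner_delta γ, ContinuousLinearMap.star_eq_adjoint,
    ContinuousLinearMap.adjoint_inner_right, norm_inner_symm, inner_delta, apply_delta hx,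
    norm_circle_mul, zero_sub, Equiv.neg_apply]

theorem dense_commutant_apply_delta_zero :
    Dense {ξ : L2 Γ | ∃ v ∈ (twistedGroupVN μ).commutant, v (delta 0) = ξ} := by
  have h : (Submodule.span ℂ (Set.range (delta : Γ → L2 Γ)) : Set (L2 Γ)) ⊆
      {ξ : L2 Γ | ∃ v ∈ (twistedGroupVN μ).commutant, v (delta 0) = ξ} := by
    intro ξ hξ
    induction hξ using Submodule.span_induction with
    | mem x hx =>
      obtain ⟨γ, rfl⟩ := hx
      refine ⟨rightOp μ γ, rightOp_mem_commutant μ γ, ?_⟩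
      rw [rightOp_delta, μ.zero_left, zero_add, Circle.coe_one, one_smul]
    | zero => exact ⟨0, zero_mem _, rfl⟩
    | add x y _ _ hx hy =>
      obtain ⟨v, hv, rfl⟩ := hx
      obtain ⟨w, hw, rfl⟩ := hy
      exact ⟨v + w, add_mem hv hw, rfl⟩
    | smul c x _ hx =>
      obtain ⟨v, hv, rfl⟩ := hx
      exact ⟨c • v, SMulMemClass.smul_mem
        (s := (twistedGroupVN μ).commutant.toStarSubalgebra) c hv, rfl⟩
  exact dense_span_delta.mono h

theorem dense_apply_delta_zero {A : StarSubalgebra ℂ (L2 Γ →L[ℂ] L2 Γ)}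
    (hA : ∀ γ, twistedOp μ γ ∈ A) : Dense {ξ : L2 Γ | ∃ y ∈ A, y (delta 0) = ξ} := by
  have h : (Submodule.span ℂ (Set.range (delta : Γ → L2 Γ)) : Set (L2 Γ)) ⊆
      {ξ : L2 Γ | ∃ y ∈ A, y (delta 0) = ξ} := by
    intro ξ hξ
    induction hξ using Submodule.span_induction with
    | mem x hx =>
      obtain ⟨γ, rfl⟩ := hx
      refine ⟨twistedOp μ γ, hA γ, ?_⟩
      rw [twistedOp_delta, μ.zero_right, add_zero, Circle.coe_one, one_smul]
    | zero => exact ⟨0, zero_mem _, rfl⟩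
    | add x y _ _ hx hy =>
      obtain ⟨v, hv, rfl⟩ := hx
      obtain ⟨w, hw, rfl⟩ := hy
      exact ⟨v + w, add_mem hv hw, rfl⟩
    | smul c x _ hx =>
      obtain ⟨v, hv, rfl⟩ := hx
      exact ⟨c • v, SMulMemClass.smul_mem c hv, rfl⟩
  exact dense_span_delta.mono h

variable (μ) in
/-- The unitary `u_γ` as an element of the twisted group von Neumann algebra. -/
def twistedElem (γ : Γ) : (twistedGroupVN μ).toStarSubalgebra := ⟨twistedOp μ γ, twistedOp_mem μ γ⟩

/-- An automorphism of `L_μ(Γ)` which fixes the canonical unitaries is the identity. -/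
theorem map_eq_self_of_twistedElem
    (β : (twistedGroupVN μ).toStarSubalgebra ≃⋆ₐ[ℂ] (twistedGroupVN μ).toStarSubalgebra)
    (h : ∀ γ, β (twistedElem μ γ) = twistedElem μ γ) (x : (twistedGroupVN μ).toStarSubalgebra) :
    β x = x := by
  refine map_eq_self_of_dense β (norm_delta 0) (fun x hx => norm_star_apply_delta_zero hx)
    dense_commutant_apply_delta_zero (fun x _ ε hε => ?_) x
  obtain ⟨_, ⟨y, hy, rfl⟩, h'⟩ := (dense_apply_delta_zero (A := fixedSubalgebra β)
    fun γ => ⟨twistedOp_mem μ γ, h γ⟩).exists_dist_lt (x (delta 0)) hε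
  refine ⟨y, hy, ?_⟩
  rwa [dist_comm, dist_eq_norm] at h'

end GroupAlgebra

/-! ### Isomorphisms implemented by unitaries and what they transport. -/

section SpatialIsomorphisms
open Topology
variable {E : Type*} [NormedAddCommGroup E] [InnerProductSpace ℂ E] [CompleteSpace E]
variable {E' : Type*} [NormedAddCommGroup E'] [InnerProductSpace ℂ E'] [CompleteSpace E']

theorem conj_mem_vonNeumannClosure_iff (V : E ≃ₗᵢ[ℂ] E') {S : Set (E' →L[ℂ] E')} {x : E →L[ℂ] E} :
    V.conjStarAlgEquiv x ∈ vonNeumannClosure S ↔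
      x ∈ vonNeumannClosure (V.conjStarAlgEquiv ⁻¹' S) := by
  rw [mem_vonNeumannClosure, mem_vonNeumannClosure]
  constructor
  · intro h y hy
    refine EquivLike.injective V.conjStarAlgEquiv ?_
    rw [map_mul, map_mul]
    refine h _ fun s hs => ?_
    obtain ⟨s, rfl⟩ := EquivLike.surjective V.conjStarAlgEquiv s
    rw [← map_star, ← map_mul, ← map_mul, ← map_mul, ← map_mul, (hy s hs).1, (hy s hs).2]
    exact ⟨rfl, rfl⟩
  · intro h y hy
    obtain ⟨y, rfl⟩ := EquivLike.surjective V.conjStarAlgEquiv y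
    rw [← map_mul, ← map_mul, h y]
    intro s hs
    have := hy _ hs
    rw [← map_star, ← map_mul, ← map_mul, ← map_mul, ← map_mul] at this
    exact ⟨EquivLike.injective V.conjStarAlgEquiv this.1,
      EquivLike.injective V.conjStarAlgEquiv this.2⟩

/-- The `*`-isomorphism of von Neumann algebras implemented by a unitary. -/
def spatialEquiv {N : VonNeumannAlgebra E} {M : VonNeumannAlgebra E'} (V : E ≃ₗᵢ[ℂ] E')
    (h : ∀ x, V.conjStarAlgEquiv x ∈ M ↔ x ∈ N) : N.toStarSubalgebra ≃⋆ₐ[ℂ] M.toStarSubalgebra where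
  toFun x := ⟨V.conjStarAlgEquiv x.1, (h x.1).2 x.2⟩
  invFun y := ⟨V.conjStarAlgEquiv.symm y.1, (h _).1 (by
    rw [StarAlgEquiv.apply_symm_apply]
    exact y.2)⟩
  left_inv x := Subtype.ext (V.conjStarAlgEquiv.symm_apply_apply x.1)
  right_inv y := Subtype.ext (V.conjStarAlgEquiv.apply_symm_apply y.1)
  map_mul' x y := Subtype.ext (map_mul _ _ _)
  map_add' x y := Subtype.ext (map_add _ _ _)
  map_smul' c x := Subtype.ext (map_smul _ _ _)
  map_star' x := Subtype.ext (map_star _ _)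

theorem IsAFDII₁Factor.of_spatial {N : VonNeumannAlgebra E} {M : VonNeumannAlgebra E'}
    (V : E ≃ₗᵢ[ℂ] E') (h : ∀ x, V.conjStarAlgEquiv x ∈ M ↔ x ∈ N) (hM : IsAFDII₁Factor M) :
    IsAFDII₁Factor N where
  isFactor x hx hc := by
    obtain ⟨c, hc⟩ := hM.isFactor _ ((h x).2 hx) fun y hy => by
      obtain ⟨y, rfl⟩ := EquivLike.surjective V.conjStarAlgEquiv y
      rw [← map_mul, ← map_mul, hc y ((h y).1 hy)]
    refine ⟨c, EquivLike.injective V.conjStarAlgEquiv ?_⟩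
    rw [hc, map_smul, map_one]
  isFiniteVN v hv h1 := by
    have := hM.isFiniteVN _ ((h v).2 hv) (by rw [← map_star, ← map_mul, h1, map_one])
    rw [← map_star, ← map_mul] at this
    exact EquivLike.injective V.conjStarAlgEquiv (this.trans (map_one _).symm)
  infinite_dimensional hN := hM.infinite_dimensional
    (LinearEquiv.finiteDimensional (spatialEquiv V h : N.toStarSubalgebra ≃⋆ₐ[ℂ] _).toAlgEquiv.toLinearEquiv)
  isAFD := by
    obtain ⟨A, hA, hfd, hMA⟩ := hM.isAFD
    refine ⟨fun n => (A n).comap V.conjStarAlgEquiv.toStarAlgHom,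
      fun m n hmn x hx => hA hmn hx, fun n => ?_, ?_⟩
    · have := hfd n
      refine FiniteDimensional.of_injective
        (V := (A n).comap V.conjStarAlgEquiv.toStarAlgHom)
        (V₂ := A n) { toFun := fun x => ⟨V.conjStarAlgEquiv x.1, x.2⟩
                      map_add' := fun x y => Subtype.ext (map_add _ _ _)
                      map_smul' := fun c x => Subtype.ext (map_smul _ _ _) } ?_
      intro x y hxy
      exact Subtype.ext (EquivLike.injective V.conjStarAlgEquiv (congrArg Subtype.val hxy))
    · ext x
      rw [← h x, hMA, conj_mem_vonNeumannClosure_iff, Set.preimage_iUnion]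
      rfl

namespace VNSystem
variable {G : Type*} [Group G]

theorem continuous_centralizer_apply (S : VNSystem G E) (x : S.Alg) :
    Continuous fun α : S.centralizer => ((α.1 x : S.Alg) : E →L[ℂ] E) S.Ω :=
  continuous_pi_iff.1 (continuous_induced_dom
    (f := fun (α : S.centralizer) (x : S.Alg) => ((α.1 x : S.Alg) : E →L[ℂ] E) S.Ω)) x

/-- A unitary which maps the von Neumann algebra, the vector state and the unitary representation
of one system to those of another. -/
structure SpatialIso (S : VNSystem G E) (T : VNSystem G E') where
  V : E ≃ₗᵢ[ℂ] E'
  conj_mem_iff : ∀ x, V.conjStarAlgEquiv x ∈ T.alg ↔ x ∈ S.alg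
  map_Ω : V S.Ω = T.Ω
  map_U : ∀ g v, V (S.U g v) = T.U g (V v)

namespace SpatialIso
variable {S : VNSystem G E} {T : VNSystem G E'}

/-- The isomorphism of algebras given by a spatial isomorphism. -/
def equiv (I : SpatialIso S T) : S.Alg ≃⋆ₐ[ℂ] T.Alg := spatialEquiv I.V I.conj_mem_iff

theorem equiv_apply_apply (I : SpatialIso S T) (x : S.Alg) (v : E) :
    (I.equiv x : E' →L[ℂ] E') (I.V v) = I.V ((x : E →L[ℂ] E) v) := by
  change I.V.conjStarAlgEquiv x.1 (I.V v) = _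
  rw [LinearIsometryEquiv.conjStarAlgEquiv_apply_apply, LinearIsometryEquiv.symm_apply_apply]

theorem equiv_action (I : SpatialIso S T) (g : G) (x : S.Alg) :
    I.equiv (S.action g x) = T.action g (I.equiv x) := by
  refine Subtype.ext (ContinuousLinearMap.ext fun v => ?_)
  obtain ⟨v, rfl⟩ := I.V.surjective v
  obtain ⟨v, rfl⟩ := (S.U g).surjective v
  rw [equiv_apply_apply, coe_action, coe_action, I.map_U,
    LinearIsometryEquiv.conjStarAlgEquiv_apply_apply,
    LinearIsometryEquiv.conjStarAlgEquiv_apply_apply, LinearIsometryEquiv.symm_apply_apply,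
    LinearIsometryEquiv.symm_apply_apply, equiv_apply_apply, I.map_U]

theorem conjugate (I : SpatialIso S T) : S.Conjugate T := ⟨I.equiv, I.equiv_action⟩

theorem equiv_symm_action (I : SpatialIso S T) (g : G) (y : T.Alg) :
    I.equiv.symm (T.action g y) = S.action g (I.equiv.symm y) := by
  obtain ⟨y, rfl⟩ := EquivLike.surjective I.equiv y
  rw [← equiv_action, StarAlgEquiv.symm_apply_apply, StarAlgEquiv.symm_apply_apply]

/-- Transport of the centralizer along a spatial isomorphism. -/
def centralizerEquiv (I : SpatialIso S T) : S.centralizer ≃ₜ* T.centralizer where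
  toFun α := ⟨(I.equiv.symm.trans α.1).trans I.equiv, mem_centralizer.2 fun g x => by
    change T.action g (I.equiv (α.1 (I.equiv.symm x))) =
      I.equiv (α.1 (I.equiv.symm (T.action g x)))
    rw [← equiv_action, mem_centralizer.1 α.2, equiv_symm_action]⟩
  invFun α := ⟨(I.equiv.trans α.1).trans I.equiv.symm, mem_centralizer.2 fun g x => by
    change S.action g (I.equiv.symm (α.1 (I.equiv x))) =
      I.equiv.symm (α.1 (I.equiv (S.action g x)))
    rw [← equiv_symm_action, mem_centralizer.1 α.2, equiv_action]⟩
  left_inv α := Subtype.ext (StarAlgEquiv.ext fun x => by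
    change I.equiv.symm (I.equiv (α.1 (I.equiv.symm (I.equiv x)))) = α.1 x
    rw [StarAlgEquiv.symm_apply_apply, StarAlgEquiv.symm_apply_apply])
  right_inv α := Subtype.ext (StarAlgEquiv.ext fun x => by
    change I.equiv (I.equiv.symm (α.1 (I.equiv (I.equiv.symm x)))) = α.1 x
    rw [StarAlgEquiv.apply_symm_apply, StarAlgEquiv.apply_symm_apply])
  map_mul' α α' := Subtype.ext (StarAlgEquiv.ext fun x => by
    change I.equiv (α.1 (α'.1 (I.equiv.symm x))) =
      I.equiv (α.1 (I.equiv.symm (I.equiv (α'.1 (I.equiv.symm x)))))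
    rw [StarAlgEquiv.symm_apply_apply])
  continuous_toFun := by
    refine continuous_induced_rng.2 (continuous_pi fun x => ?_)
    have h : Continuous fun α : S.centralizer =>
        ((α.1 (I.equiv.symm x) : S.Alg) : E →L[ℂ] E) S.Ω :=
      continuous_centralizer_apply S _
    refine (I.V.continuous.comp h).congr fun α => ?_
    change _ = (I.equiv (α.1 (I.equiv.symm x)) : E' →L[ℂ] E') T.Ω
    rw [← I.map_Ω, equiv_apply_apply]
    rfl
  continuous_invFun := by
    refine continuous_induced_rng.2 (continuous_pi fun x => ?_)
    have h : Continuous fun α : T.centralizer =>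
        ((α.1 (I.equiv x) : T.Alg) : E' →L[ℂ] E') T.Ω :=
      continuous_centralizer_apply T _
    refine (I.V.symm.continuous.comp h).congr fun α => ?_
    change I.V.symm ((α.1 (I.equiv x) : T.Alg).1 T.Ω) =
      ((I.equiv.symm (α.1 (I.equiv x)) : S.Alg) : E →L[ℂ] E) S.Ω
    rw [LinearIsometryEquiv.symm_apply_eq, ← equiv_apply_apply, StarAlgEquiv.apply_symm_apply,
      I.map_Ω]

end SpatialIso

theorem Conjugate.symm {S : VNSystem G E} {T : VNSystem G E'} (h : S.Conjugate T) :
    T.Conjugate S := by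
  obtain ⟨θ, hθ⟩ := h
  refine ⟨θ.symm, fun g y => ?_⟩
  obtain ⟨y, rfl⟩ := EquivLike.surjective θ y
  rw [← hθ, StarAlgEquiv.symm_apply_apply, StarAlgEquiv.symm_apply_apply]

theorem Conjugate.trans {E'' : Type*} [NormedAddCommGroup E''] [InnerProductSpace ℂ E'']
    [CompleteSpace E''] {S : VNSystem G E} {T : VNSystem G E'} {R : VNSystem G E''}
    (h : S.Conjugate T) (h' : T.Conjugate R) : S.Conjugate R := by
  obtain ⟨θ, hθ⟩ := h
  obtain ⟨θ', hθ'⟩ := h'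
  refine ⟨θ.trans θ', fun g x => ?_⟩
  change θ' (θ _) = R.action g (θ' (θ x))
  rw [hθ, hθ']

end VNSystem
end SpatialIsomorphisms

/-! ### Commutation passed through a pair of intertwiners. -/

section Compression
variable {E : Type*} [NormedAddCommGroup E] [InnerProductSpace ℂ E] [CompleteSpace E]
variable {F : Type*} [NormedAddCommGroup F] [InnerProductSpace ℂ F] [CompleteSpace F]

/-- The compression J* y K commutes with `S` and with the adjoints of its elements, hence with `x`;
moving `x` back through the intertwiners gives the claim. With the slots of a tensor product as `J`
and `K`, this shows that amplification respects generated von Neumann algebras. -/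
theorem inner_compression (π : (E →L[ℂ] E) → (F →L[ℂ] F)) (hπ : ∀ T, star (π T) = π (star T))
    {J K : E →L[ℂ] F} (hJ : ∀ T a, π T (J a) = J (T a)) (hK : ∀ T a, π T (K a) = K (T a))
    {S : Set (E →L[ℂ] E)} {x : E →L[ℂ] E} (hx : x ∈ vonNeumannClosure S) {y : F →L[ℂ] F}
    (hy : ∀ s ∈ S, π s * y = y * π s ∧ star (π s) * y = y * star (π s)) (a b : E) :
    ⟪J a, (y * π x) (K b)⟫_ℂ = ⟪J a, (π x * y) (K b)⟫_ℂ := by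
  set z : E →L[ℂ] E := J.adjoint ∘L (y ∘L K)
  have hzin : ∀ a b, ⟪a, z b⟫_ℂ = ⟪J a, y (K b)⟫_ℂ := fun a b => by
    change ⟪a, J.adjoint (y (K b))⟫_ℂ = _
    rw [ContinuousLinearMap.adjoint_inner_right]
  have hadj : ∀ T : E →L[ℂ] E, ∀ a v, ⟪J a, π T v⟫_ℂ = ⟪J (star T a), v⟫_ℂ := fun T a v => by
    rw [← hJ, ← hπ, ContinuousLinearMap.star_eq_adjoint, ContinuousLinearMap.adjoint_inner_left]
  have hadj' : ∀ T : E →L[ℂ] E, ∀ a v, ⟪a, T v⟫_ℂ = ⟪star T a, v⟫_ℂ := fun T a v => by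
    rw [ContinuousLinearMap.star_eq_adjoint, ContinuousLinearMap.adjoint_inner_left]
  have key : ∀ T : E →L[ℂ] E, π T * y = y * π T → T * z = z * T := by
    intro T hT
    refine ContinuousLinearMap.ext fun b => ext_inner_left ℂ fun a => ?_
    have h1 := DFunLike.congr_fun hT (K b)
    change π T (y (K b)) = y (π T (K b)) at h1
    change ⟪a, T (z b)⟫_ℂ = ⟪a, z (T b)⟫_ℂ
    rw [hzin, ← hK, ← h1, hadj, hadj', hzin]
  have hzx : z * x = x * z := mem_vonNeumannClosure.1 hx z fun T hT =>
    ⟨key T (hy T hT).1, key (star T) (by rw [← hπ]; exact (hy T hT).2)⟩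
  have h2 := congrArg (fun v => ⟪a, v⟫_ℂ) (DFunLike.congr_fun hzx b)
  change ⟪a, z (x b)⟫_ℂ = ⟪a, x (z b)⟫_ℂ at h2
  change ⟪J a, y (π x (K b))⟫_ℂ = ⟪J a, π x (y (K b))⟫_ℂ
  rw [hK, hadj, ← hzin, ← hzin, h2, hadj']

end Compression

/-! ### Slots of the Hilbert space tensor product. -/

section TensorProduct
open Topology
variable {ι : Type*} {E : ι → Type*} [∀ i, NormedAddCommGroup (E i)]
  [∀ i, InnerProductSpace ℂ (E i)]

namespace ElemTensor
variable {ξ : ∀ i, E i}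

open Classical in
/-- Replace the `i`-th factor of an elementary tensor. -/
def replaceAt (i : ι) (a : E i) (x : ElemTensor ξ) : ElemTensor ξ :=
  ⟨Function.update x.1 i a, (x.2.union (Set.finite_singleton i)).subset fun j hj => by
    by_cases hji : j = i
    · exact Or.inr hji
    · left
      simpa [Function.update_of_ne hji] using hj⟩

theorem replaceAt_val_self (i : ι) (a : E i) (x : ElemTensor ξ) : (replaceAt i a x).1 i = a := by
  simp [replaceAt]

theorem replaceAt_val_ne {i j : ι} (hj : j ≠ i) (a : E i) (x : ElemTensor ξ) :
    (replaceAt i a x).1 j = x.1 j := by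
  simp [replaceAt, hj]

theorem replaceAt_self (i : ι) (x : ElemTensor ξ) : replaceAt i (x.1 i) x = x :=
  Subtype.ext (by classical exact Function.update_eq_self i x.1)

theorem applyAt_replaceAt (i : ι) (T : E i →L[ℂ] E i) (a : E i) (x : ElemTensor ξ) :
    applyAt i T (replaceAt i a x) = replaceAt i (T a) x := by
  apply Subtype.ext
  funext j
  by_cases hj : j = i
  · subst hj
    rw [applyAt_val_self, replaceAt_val_self, replaceAt_val_self]
  · rw [applyAt_val_ne hj, replaceAt_val_ne hj, replaceAt_val_ne hj]

/-- All factors but the i-th agree on both sides; the unit vector `ξ i` is a placeholder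
contributing the factor 1. -/
theorem kernel_replaceAt (h : ∀ i, ‖ξ i‖ = 1) (i : ι) (a b : E i) (x y : ElemTensor ξ) :
    kernel ξ (replaceAt i a x) (replaceAt i b y) =
      ⟪a, b⟫_ℂ * kernel ξ (replaceAt i (ξ i) x) (replaceAt i (ξ i) y) := by
  classical
  obtain ⟨F, h1, h2, hF⟩ := ((eventually_prod_eq_kernel h (replaceAt i a x) (replaceAt i b y)).and
    ((eventually_prod_eq_kernel h (replaceAt i (ξ i) x) (replaceAt i (ξ i) y)).and
      (eventually_ge_atTop {i}))).exists
  have hi : i ∈ F := hF (by simp)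
  rw [← h1, ← h2, ← Finset.mul_prod_erase F _ hi, ← Finset.mul_prod_erase F _ hi]
  simp only [replaceAt_val_self]
  have h3 : ⟪ξ i, ξ i⟫_ℂ = 1 := by rw [inner_self_eq_norm_sq_to_K, h i]; simp
  rw [h3, one_mul]
  congr 1
  refine Finset.prod_congr rfl fun j hj => ?_
  simp only [replaceAt_val_ne (Finset.ne_of_mem_erase hj)]

end ElemTensor

namespace HilbertTensor
open ElemTensor
variable {ξ : ∀ i, E i} (h : ∀ i, ‖ξ i‖ = 1)

theorem eq_of_inner_tmul {v w : HilbertTensor h} (hvw : ∀ x, ⟪tmul h x, v⟫_ℂ = ⟪tmul h x, w⟫_ℂ) :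
    v = w := by
  have : innerSL ℂ v = innerSL ℂ w := clm_ext h fun x => by
    rw [innerSL_apply_apply, innerSL_apply_apply, ← inner_conj_symm, hvw, inner_conj_symm]
  refine ext_inner_right ℂ fun u => ?_
  have := DFunLike.congr_fun this u
  rwa [innerSL_apply_apply, innerSL_apply_apply] at this

theorem inner_tmul_eq_kernel (x y : ElemTensor ξ) : ⟪tmul h x, tmul h y⟫_ℂ = kernel ξ x y :=
  inner_tmul h x y

theorem inner_replaceAt_replaceAt (i : ι) (a b : E i) (x y : ElemTensor ξ) :
    ⟪tmul h (replaceAt i a x), tmul h (replaceAt i b y)⟫_ℂ =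
      ⟪a, b⟫_ℂ * ⟪tmul h (replaceAt i (ξ i) x), tmul h (replaceAt i (ξ i) y)⟫_ℂ := by
  rw [inner_tmul_eq_kernel, inner_tmul_eq_kernel]
  exact kernel_replaceAt h i a b x y

theorem inner_tmul_replaceAt (i : ι) (a : E i) (x y : ElemTensor ξ) :
    ⟪tmul h y, tmul h (replaceAt i a x)⟫_ℂ =
      ⟪y.1 i, a⟫_ℂ * ⟪tmul h (replaceAt i (ξ i) y), tmul h (replaceAt i (ξ i) x)⟫_ℂ := by
  nth_rewrite 1 [← replaceAt_self i y]
  exact inner_replaceAt_replaceAt h i _ _ y x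

/-- The bounded operator `a ↦ ⊗ⱼ yⱼ`, where `yᵢ = a` and `yⱼ = xⱼ` for `j ≠ i`. -/
def slot (i : ι) (x : ElemTensor ξ) : E i →L[ℂ] HilbertTensor h :=
  LinearMap.mkContinuous
    { toFun := fun a => tmul h (replaceAt i a x)
      map_add' := fun a b => eq_of_inner_tmul h fun y => by
        rw [inner_add_right, inner_tmul_replaceAt h i (a + b) x y,
          inner_tmul_replaceAt h i a x y, inner_tmul_replaceAt h i b x y,
          inner_add_right, add_mul]
      map_smul' := fun c a => eq_of_inner_tmul h fun y => by
        rw [RingHom.id_apply, inner_smul_right, inner_tmul_replaceAt h i (c • a) x y,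
          inner_tmul_replaceAt h i a x y,
          inner_smul_right, mul_assoc] }
    ‖tmul h (replaceAt i (ξ i) x)‖ fun a => by
      refine le_of_eq ((sq_eq_sq₀ (norm_nonneg _) (by positivity)).1 ?_)
      have h1 : ⟪tmul h (replaceAt i a x), tmul h (replaceAt i a x)⟫_ℂ =
          ⟪a, a⟫_ℂ * ⟪tmul h (replaceAt i (ξ i) x), tmul h (replaceAt i (ξ i) x)⟫_ℂ :=
        inner_replaceAt_replaceAt h i a a x x
      rw [inner_self_eq_norm_sq_to_K, inner_self_eq_norm_sq_to_K, inner_self_eq_norm_sq_to_K] at h1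
      change ‖tmul h (replaceAt i a x)‖ ^ 2 = _
      rw [mul_pow, mul_comm]
      exact_mod_cast h1

theorem slot_apply (i : ι) (x : ElemTensor ξ) (a : E i) : slot h i x a = tmul h (replaceAt i a x) :=
  rfl

theorem slot_self (i : ι) (x : ElemTensor ξ) : slot h i x (x.1 i) = tmul h x := by
  rw [slot_apply, replaceAt_self]

theorem ampl_slot (i : ι) (T : E i →L[ℂ] E i) (x : ElemTensor ξ) (a : E i) :
    ampl h i T (slot h i x a) = slot h i x (T a) := by
  rw [slot_apply, slot_apply, ampl_tmul, applyAt_replaceAt]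

theorem tmul_smul {x y : ElemTensor ξ} {c : ι → Circle} (hc : (Function.mulSupport c).Finite)
    (hxy : ∀ i, y.1 i = (c i : ℂ) • x.1 i) : tmul h y = ((∏ᶠ i, c i : Circle) : ℂ) • tmul h x := by
  classical
  refine eq_of_inner_tmul h fun z => ?_
  obtain ⟨F, h1, h2, hF⟩ := ((eventually_prod_eq_kernel h z y).and
    ((eventually_prod_eq_kernel h z x).and (eventually_ge_atTop hc.toFinset))).exists
  rw [inner_smul_right]
  rw [inner_tmul_eq_kernel, inner_tmul_eq_kernel, ← h1, ← h2, finprod_eq_prod_of_mulSupport_subset c (s := F) fun i hi => hF (by simpa using hi)]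
  have : ((∏ i ∈ F, c i : Circle) : ℂ) = ∏ i ∈ F, (c i : ℂ) := map_prod Circle.coeHom _ _
  rw [this, ← Finset.prod_mul_distrib]
  refine Finset.prod_congr rfl fun i _ => ?_
  rw [hxy, inner_smul_right]

variable [∀ i, CompleteSpace (E i)]

theorem star_ampl (i : ι) (T : E i →L[ℂ] E i) : star (ampl h i T) = ampl h i (star T) := by
  refine clm_ext h fun x => eq_of_inner_tmul h fun y => ?_
  rw [ContinuousLinearMap.star_eq_adjoint, ContinuousLinearMap.adjoint_inner_right]
  rw [← slot_self h i x, ampl_slot, slot_apply, slot_apply, inner_tmul_replaceAt h i (star T (x.1 i)) x y,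
    ContinuousLinearMap.star_eq_adjoint, ContinuousLinearMap.adjoint_inner_right]
  nth_rewrite 1 [← slot_self h i y]
  rw [ampl_slot, slot_apply]
  exact inner_replaceAt_replaceAt h i _ _ y x

/-- An operator which commutes with `s ⊗ 1` for `s` in a self-adjoint set `S` commutes with
`x ⊗ 1` for all `x` in the von Neumann algebra generated by `S`. -/
theorem ampl_commute {i : ι} {S : Set (E i →L[ℂ] E i)} {x : E i →L[ℂ] E i}
    (hx : x ∈ vonNeumannClosure S) {y : HilbertTensor h →L[ℂ] HilbertTensor h}
    (hy : ∀ s ∈ S, ampl h i s * y = y * ampl h i s ∧ star (ampl h i s) * y = y * star (ampl h i s)) :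
    y * ampl h i x = ampl h i x * y := by
  refine clm_ext h fun t => eq_of_inner_tmul h fun s => ?_
  have := inner_compression (ampl h i) (star_ampl h i) (J := slot h i s) (K := slot h i t)
    (fun T a => ampl_slot h i T s a) (fun T a => ampl_slot h i T t a) hx hy (s.1 i) (t.1 i)
  rwa [slot_self, slot_self] at this

end HilbertTensor

theorem vonNeumannClosure_le {F : Type*} [NormedAddCommGroup F] [InnerProductSpace ℂ F]
    [CompleteSpace F] {S : Set (F →L[ℂ] F)} {M : VonNeumannAlgebra F} (h : ∀ s ∈ S, s ∈ M)
    {x : F →L[ℂ] F} (hx : x ∈ vonNeumannClosure S) : x ∈ M :=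
  mem_of_commute_commutant fun y hy => mem_vonNeumannClosure.1 hx y fun s hs =>
    ⟨VonNeumannAlgebra.mem_commutant_iff.1 hy s (h s hs),
      VonNeumannAlgebra.mem_commutant_iff.1 hy _ (star_mem (h s hs))⟩

end TensorProduct

/-! ### Direct sums of groups and tensor products of their twisted group algebras. -/

section GroupDecomposition
open Topology

/-- The homomorphisms `e i` and `s i` are the projections and inclusions of a direct sum
decomposition `Γ ≅ ⨁ᵢ Δ i`. -/
structure IsDirectSumDecomposition {ι Γ : Type*} [AddCommGroup Γ] {Δ : ι → Type*}
    [∀ i, AddCommGroup (Δ i)] (e : ∀ i, Γ →+ Δ i) (s : ∀ i, Δ i →+ Γ) : Prop where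
  finite : ∀ γ, {i | e i γ ≠ 0}.Finite
  eq_zero : ∀ γ, (∀ i, e i γ = 0) → γ = 0
  e_s : ∀ i x, e i (s i x) = x
  e_s_ne : ∀ i j x, j ≠ i → e j (s i x) = 0

variable {ι Γ : Type*} [AddCommGroup Γ] {Δ : ι → Type*} [∀ i, AddCommGroup (Δ i)]
  {e : ∀ i, Γ →+ Δ i} {s : ∀ i, Δ i →+ Γ}

namespace IsDirectSumDecomposition

theorem e_sum (D : IsDirectSumDecomposition e s) (F : Finset ι) (x : ∀ i, Δ i) (j : ι)
    (hx : j ∉ F → x j = 0) : e j (∑ i ∈ F, s i (x i)) = x j := by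
  classical
  rw [map_sum]
  by_cases hj : j ∈ F
  · rw [Finset.sum_eq_single_of_mem j hj fun i _ hij => D.e_s_ne i j _ hij.symm, D.e_s]
  · rw [hx hj]
    exact Finset.sum_eq_zero fun i hi => D.e_s_ne i j _ fun h => hj (h ▸ hi)

theorem injective (D : IsDirectSumDecomposition e s) {γ γ' : Γ} (h : ∀ i, e i γ = e i γ') :
    γ = γ' :=
  sub_eq_zero.1 (D.eq_zero _ fun i => by rw [map_sub, h, sub_self])

theorem sum_s_e (D : IsDirectSumDecomposition e s) (γ : Γ) :
    ∑ i ∈ (D.finite γ).toFinset, s i (e i γ) = γ :=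
  D.injective fun j => D.e_sum _ (fun i => e i γ) j fun hj => by simpa using hj

theorem exists_of_finite (D : IsDirectSumDecomposition e s) {x : ∀ i, Δ i}
    (hx : {i | x i ≠ 0}.Finite) : ∃ γ, ∀ i, e i γ = x i :=
  ⟨∑ i ∈ hx.toFinset, s i (x i), fun j => D.e_sum _ x j fun hj => by simpa using hj⟩

theorem induction (D : IsDirectSumDecomposition e s) {P : Γ → Prop} (h0 : P 0)
    (hadd : ∀ γ γ', P γ → P γ' → P (γ + γ')) (hs : ∀ i x, P (s i x)) (γ : Γ) : P γ := by
  rw [← D.sum_s_e γ]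
  exact Finset.sum_induction _ P (fun a b => hadd a b) h0 fun i _ => hs i _

variable {ξ : ∀ i, L2 (Δ i)}

/-- The elementary tensor `⊗ᵢ δ_{γ(i)}`. -/
def elemTensor (D : IsDirectSumDecomposition e s) (hξ : ∀ i, ξ i = delta 0) (γ : Γ) : ElemTensor ξ :=
  ⟨fun i => delta (e i γ), (D.finite γ).subset fun i hi h0 => hi (by
    change delta (e i γ) = ξ i
    rw [h0, hξ])⟩

theorem elemTensor_val (D : IsDirectSumDecomposition e s) (hξ : ∀ i, ξ i = delta 0) (γ : Γ) (i : ι) :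
    (D.elemTensor hξ γ).1 i = delta (e i γ) := rfl

variable (h : ∀ i, ‖ξ i‖ = 1)

theorem orthonormal (D : IsDirectSumDecomposition e s) (hξ : ∀ i, ξ i = delta 0) :
    Orthonormal ℂ fun γ => HilbertTensor.tmul h (D.elemTensor hξ γ) := by
  classical
  rw [orthonormal_iff_ite]
  intro γ γ'
  rw [HilbertTensor.inner_tmul]
  have hv : ∀ i, ⟪(D.elemTensor hξ γ).1 i, (D.elemTensor hξ γ').1 i⟫_ℂ =
      if e i γ = e i γ' then 1 else 0 := fun i => by
    rw [elemTensor_val, elemTensor_val, inner_delta]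
    split_ifs with hi
    · rw [hi, delta_apply_self]
    · exact delta_apply_ne hi
  simp only [hv]
  split_ifs with hγ
  · simp [hγ]
  · obtain ⟨i, hi⟩ : ∃ i, e i γ ≠ e i γ' := by
      by_contra! hc
      exact hγ (D.injective hc)
    refine finprod_eq_zero _ i (if_neg hi) ?_
    refine ((D.finite γ).union (D.finite γ')).subset fun j hj => ?_
    by_contra hc
    rw [Set.mem_union, not_or] at hc
    have h1 : e j γ = 0 := not_not.1 hc.1
    have h2 : e j γ' = 0 := not_not.1 hc.2
    exact hj (if_pos (h1.trans h2.symm))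

/-- Completeness of the system of basis tensors, by induction on a finite set of slots outside which
all factors are basis vectors: a functional of one slot that vanishes on basis vectors vanishes. -/
theorem eq_zero_of_inner (D : IsDirectSumDecomposition e s) (hξ : ∀ i, ξ i = delta 0)
    {w : HilbertTensor h} (hw : ∀ γ, ⟪w, HilbertTensor.tmul h (D.elemTensor hξ γ)⟫_ℂ = 0) : w = 0 := by
  classical
  have key : ∀ F : Finset ι, ∀ x : ElemTensor ξ, (∀ i ∉ F, ∃ γ, x.1 i = delta γ) →
      ⟪w, HilbertTensor.tmul h x⟫_ℂ = 0 := by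
    intro F
    induction F using Finset.induction_on with
    | empty =>
      intro x hx
      choose y hy using fun i => hx i (Finset.notMem_empty i)
      -- Since each ξ_i is δ₀, a nonzero label occurs only where the tensor differs from the vacuum,
      -- so the labels assemble to an element of Γ.
      have hinj : ∀ i, y i ≠ 0 → x.1 i ≠ ξ i := fun i hi hxi => by
        have h1 := delta_apply_self (y i)
        rw [← hy, hxi, hξ, delta_apply_ne hi] at h1
        exact zero_ne_one h1
      obtain ⟨γ, hγ⟩ := D.exists_of_finite (x := y) (x.2.subset fun i hi => hinj i hi)
      have : x = D.elemTensor hξ γ := Subtype.ext (funext fun i => by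
        rw [elemTensor_val, hy, hγ])
      rw [this, hw]
    | insert i F hi ih =>
      intro x hx
      have hz : (innerSL ℂ w).comp (HilbertTensor.slot h i x) = 0 := clm_ext_delta fun γ => by
        rw [ContinuousLinearMap.comp_apply, innerSL_apply_apply, HilbertTensor.slot_apply, zero_apply]
        refine ih _ fun j hj => ?_
        by_cases hji : j = i
        · subst hji
          exact ⟨γ, ElemTensor.replaceAt_val_self _ _ _⟩
        · rw [ElemTensor.replaceAt_val_ne hji]
          exact hx j fun hj' => (Finset.mem_insert.1 hj').elim hji hj
      have := DFunLike.congr_fun hz (x.1 i)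
      rwa [ContinuousLinearMap.comp_apply, innerSL_apply_apply, HilbertTensor.slot_self] at this
  refine HilbertTensor.eq_of_inner_tmul h fun x => ?_
  rw [inner_zero_right, ← inner_conj_symm]
  rw [key (x.2.toFinset) x fun i hi => ?_, map_zero]
  have : x.1 i = ξ i := by simpa using hi
  exact ⟨0, by rw [this, hξ]⟩

/-- The unitary `⊗ᵢ δ_{γ(i)} ↦ δ_γ` from the tensor product of the `ℓ²(Δ i)` to `ℓ²(Γ)`. -/
def tensorUnitary (D : IsDirectSumDecomposition e s) (hξ : ∀ i, ξ i = delta 0) :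
    HilbertTensor h ≃ₗᵢ[ℂ] L2 Γ :=
  (HilbertBasis.mkOfOrthogonalEqBot (D.orthonormal h hξ) (by
    rw [Submodule.eq_bot_iff]
    intro w hw
    refine D.eq_zero_of_inner h hξ fun γ => ?_
    rw [← inner_conj_symm, (Submodule.mem_orthogonal _ _).1 hw _
      (Submodule.subset_span (Set.mem_range_self γ)), map_zero])).repr

theorem tensorUnitary_tmul (D : IsDirectSumDecomposition e s) (hξ : ∀ i, ξ i = delta 0) (γ : Γ) :
    D.tensorUnitary h hξ (HilbertTensor.tmul h (D.elemTensor hξ γ)) = delta γ := by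
  classical
  have h1 := (HilbertBasis.mkOfOrthogonalEqBot (D.orthonormal h hξ) (by
    rw [Submodule.eq_bot_iff]
    intro w hw
    refine D.eq_zero_of_inner h hξ fun γ => ?_
    rw [← inner_conj_symm, (Submodule.mem_orthogonal _ _).1 hw _
      (Submodule.subset_span (Set.mem_range_self γ)), map_zero])).repr_self γ
  rw [HilbertBasis.coe_mkOfOrthogonalEqBot] at h1
  refine h1.trans ?_
  unfold delta
  congr

/-- For an element of the i-th summand only the i-th factor of the cocycle ν survives, so u_{s_i x}
acts in the i-th slot alone. -/
theorem conj_ampl_twistedOp (D : IsDirectSumDecomposition e s) (hξ : ∀ i, ξ i = delta 0)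
    {μ : ∀ i, Cocycle (Δ i)} {ν : Cocycle Γ}
    (hν : ∀ γ γ', ν γ γ' = ∏ᶠ i, μ i (e i γ) (e i γ')) (i : ι) (x : Δ i) :
    (D.tensorUnitary h hξ).conjStarAlgEquiv (HilbertTensor.ampl h i (twistedOp (μ i) x)) =
      twistedOp ν (s i x) := by
  refine clm_ext_delta fun γ => ?_
  have h1 : (D.tensorUnitary h hξ).symm (delta γ) = HilbertTensor.tmul h (D.elemTensor hξ γ) := by
    rw [LinearIsometryEquiv.symm_apply_eq, tensorUnitary_tmul]
  have h2 : ν (s i x) γ = μ i x (e i γ) := by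
    rw [hν, finprod_eq_single _ i fun j hj => ?_, D.e_s]
    rw [D.e_s_ne i j x hj, (μ j).zero_left]
  rw [LinearIsometryEquiv.conjStarAlgEquiv_apply_apply, h1, twistedOp_delta, h2,
    ← HilbertTensor.slot_self h i, HilbertTensor.ampl_slot, elemTensor_val, twistedOp_delta, map_smul,
    map_smul, ← tensorUnitary_tmul h D hξ, HilbertTensor.slot_apply]
  congr 3
  apply Subtype.ext
  funext j
  by_cases hj : j = i
  · subst hj
    rw [ElemTensor.replaceAt_val_self, elemTensor_val, map_add, D.e_s]
  · rw [ElemTensor.replaceAt_val_ne hj, elemTensor_val, elemTensor_val, map_add, D.e_s_ne i j x hj,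
      zero_add]

/-- One inclusion holds because the u_γ with γ in a summand generate all u_γ up to scalars. The
other needs `hcomm`, which stands in for normality of the representations `π i`. -/
theorem conj_mem_twistedGroupVN_iff_of_generators {F : Type*} [NormedAddCommGroup F]
    [InnerProductSpace ℂ F] [CompleteSpace F] (D : IsDirectSumDecomposition e s)
    {μ : ∀ i, Cocycle (Δ i)} {ν : Cocycle Γ} (V : F ≃ₗᵢ[ℂ] L2 Γ)
    (π : ∀ i, (L2 (Δ i) →L[ℂ] L2 (Δ i)) → (F →L[ℂ] F))
    (hπ : ∀ i x, V.conjStarAlgEquiv (π i (twistedOp (μ i) x)) = twistedOp ν (s i x))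
    (hcomm : ∀ i, ∀ x ∈ twistedGroupVN (μ i), ∀ y : F →L[ℂ] F,
      (∀ γ, π i (twistedOp (μ i) γ) * y = y * π i (twistedOp (μ i) γ) ∧
        star (π i (twistedOp (μ i) γ)) * y = y * star (π i (twistedOp (μ i) γ))) →
      y * π i x = π i x * y) (x : F →L[ℂ] F) :
    V.conjStarAlgEquiv x ∈ twistedGroupVN ν ↔
      x ∈ vonNeumannClosure (⋃ i, π i '' (twistedGroupVN (μ i) : Set _)) := by
  rw [twistedGroupVN, conj_mem_vonNeumannClosure_iff]
  constructor
  · refine vonNeumannClosure_le ?_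
    rintro t ⟨γ, hγ⟩
    have ht : t = V.conjStarAlgEquiv.symm (twistedOp ν γ) := by
      rw [hγ, StarAlgEquiv.symm_apply_apply]
    rw [ht]
    clear ht hγ t
    set M := vonNeumannClosure (⋃ i, π i '' (twistedGroupVN (μ i) : Set _)) with hM
    refine D.induction (P := fun γ => V.conjStarAlgEquiv.symm (twistedOp ν γ) ∈ M) ?_ ?_ ?_ γ
    · rw [twistedOp_zero, map_one]
      exact one_mem _
    · intro γ γ' hγ hγ'
      have h1 : twistedOp ν (γ + γ') =
          (((ν γ γ')⁻¹ : Circle) : ℂ) • (twistedOp ν γ * twistedOp ν γ') := by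
        rw [twistedOp_mul, smul_smul, ← Circle.coe_mul, inv_mul_cancel, Circle.coe_one, one_smul]
      rw [h1, map_smul, map_mul]
      exact SMulMemClass.smul_mem (s := M.toStarSubalgebra) _ (mul_mem hγ hγ')
    · intro i x
      rw [← hπ i x, StarAlgEquiv.symm_apply_apply]
      exact subset_vonNeumannClosure _ (Set.mem_iUnion.2 ⟨i, _, twistedOp_mem _ _, rfl⟩)
  · refine vonNeumannClosure_le ?_
    intro t ht
    obtain ⟨i, x, hx, rfl⟩ := Set.mem_iUnion.1 ht
    exact mem_vonNeumannClosure.2 fun y hy => hcomm i x hx y fun γ => hy _ ⟨s i γ, (hπ i γ).symm⟩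

theorem conj_mem_twistedGroupVN_iff (D : IsDirectSumDecomposition e s) (hξ : ∀ i, ξ i = delta 0)
    {μ : ∀ i, Cocycle (Δ i)} {ν : Cocycle Γ}
    (hν : ∀ γ γ', ν γ γ' = ∏ᶠ i, μ i (e i γ) (e i γ')) (x : HilbertTensor h →L[ℂ] HilbertTensor h) :
    (D.tensorUnitary h hξ).conjStarAlgEquiv x ∈ twistedGroupVN ν ↔
      x ∈ vonNeumannClosure (⋃ i, HilbertTensor.ampl h i '' (twistedGroupVN (μ i) : Set _)) :=
  D.conj_mem_twistedGroupVN_iff_of_generators (D.tensorUnitary h hξ) (HilbertTensor.ampl h)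
    (D.conj_ampl_twistedOp h hξ hν)
    (fun i x hx y hy => HilbertTensor.ampl_commute h hx (by rintro _ ⟨γ, rfl⟩; exact hy γ)) x

theorem tensorUnitary_vacuum (D : IsDirectSumDecomposition e s) (hξ : ∀ i, ξ i = delta 0) :
    D.tensorUnitary h hξ (HilbertTensor.vacuum h) = delta 0 := by
  rw [← D.tensorUnitary_tmul h hξ]
  have : ElemTensor.vacuum ξ = D.elemTensor hξ 0 := Subtype.ext (funext fun i => by
    rw [elemTensor_val, map_zero]
    exact hξ i)
  rw [HilbertTensor.vacuum, this]

/-- Both sides are compared on basis vectors. The condition that `c i 0 = 1` makes all but finitely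
many phases trivial, so they can be pulled out as a finite product. -/
theorem tensorUnitary_mapIso (D : IsDirectSumDecomposition e s) (hξ : ∀ i, ξ i = delta 0)
    {U : ∀ i, L2 (Δ i) ≃ₗᵢ[ℂ] L2 (Δ i)} (hU : ∀ i, U i (ξ i) = ξ i) {W : L2 Γ ≃ₗᵢ[ℂ] L2 Γ}
    {a : ∀ i, Δ i → Δ i} {c : ∀ i, Δ i → Circle} {A : Γ → Γ} {C : Γ → Circle}
    (hU' : ∀ i x, U i (delta x) = (c i x : ℂ) • delta (a i x))
    (hW : ∀ x, W (delta x) = (C x : ℂ) • delta (A x))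
    (hA : ∀ i x, e i (A x) = a i (e i x)) (hC : ∀ x, C x = ∏ᶠ i, c i (e i x))
    (hc0 : ∀ i, c i 0 = 1) (v : HilbertTensor h) :
    D.tensorUnitary h hξ (HilbertTensor.mapIso h U hU v) = W (D.tensorUnitary h hξ v) := by
  obtain ⟨v, rfl⟩ := (D.tensorUnitary h hξ).symm.surjective v
  rw [LinearIsometryEquiv.apply_symm_apply]
  have : ((D.tensorUnitary h hξ).symm.trans ((HilbertTensor.mapIso h U hU).trans
      (D.tensorUnitary h hξ)) : L2 Γ →L[ℂ] L2 Γ) = (W : L2 Γ →L[ℂ] L2 Γ) := by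
    refine clm_ext_delta fun γ => ?_
    change D.tensorUnitary h hξ (HilbertTensor.mapIso h U hU ((D.tensorUnitary h hξ).symm (delta γ)))
      = W (delta γ)
    have h1 : (D.tensorUnitary h hξ).symm (delta γ) = HilbertTensor.tmul h (D.elemTensor hξ γ) := by
      rw [LinearIsometryEquiv.symm_apply_eq, tensorUnitary_tmul]
    have hfin : (Function.mulSupport fun i => c i (e i γ)).Finite :=
      (D.finite γ).subset fun i hi h0 => hi (by
        change c i (e i γ) = 1
        rw [h0, hc0])
    rw [h1, hW, hC, HilbertTensor.mapIso_tmul, HilbertTensor.tmul_smul h (x := D.elemTensor hξ (A γ))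
      hfin, map_smul, tensorUnitary_tmul]
    intro i
    rw [ElemTensor.mapIso_val, elemTensor_val, elemTensor_val, hU', hA]
  exact DFunLike.congr_fun this v

end IsDirectSumDecomposition

/-- A tensor product of systems on group von Neumann algebras is spatially isomorphic to a system
on the group von Neumann algebra of the direct sum. -/
theorem nonempty_spatialIso_tensor {G : Type*} [Group G] (D : IsDirectSumDecomposition e s)
    {μ : ∀ i, Cocycle (Δ i)} {ν : Cocycle Γ}
    (hν : ∀ γ γ', ν γ γ' = ∏ᶠ i, μ i (e i γ) (e i γ'))
    (S : ∀ i, VNSystem G (L2 (Δ i))) (T : VNSystem G (L2 Γ))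
    (hSalg : ∀ i, (S i).alg = twistedGroupVN (μ i)) (hSΩ : ∀ i, (S i).Ω = delta 0)
    (hTalg : T.alg = twistedGroupVN ν) (hTΩ : T.Ω = delta 0)
    {a : ∀ i, G → Δ i → Δ i} {c : ∀ i, G → Δ i → Circle} {A : G → Γ → Γ} {C : G → Γ → Circle}
    (hSU : ∀ i g x, (S i).U g (delta x) = (c i g x : ℂ) • delta (a i g x))
    (hTU : ∀ g x, T.U g (delta x) = (C g x : ℂ) • delta (A g x))
    (hA : ∀ i g x, e i (A g x) = a i g (e i x))
    (hC : ∀ g x, C g x = ∏ᶠ i, c i g (e i x)) (hc0 : ∀ i g, c i g 0 = 1) :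
    Nonempty ((VNSystem.tensor S).SpatialIso T) := by
  refine ⟨⟨D.tensorUnitary (fun i => (S i).norm_Ω) hSΩ, fun x => ?_, ?_, fun g => ?_⟩⟩
  · rw [hTalg, D.conj_mem_twistedGroupVN_iff _ hSΩ hν]
    change _ ↔ x ∈ vonNeumannClosure _
    simp only [hSalg]
  · rw [hTΩ]
    exact D.tensorUnitary_vacuum _ hSΩ
  · exact D.tensorUnitary_mapIso _ hSΩ (fun i => (S i).U_Ω g) (fun i => hSU i g) (hTU g)
      (fun i => hA i g) (hC g) fun i => hc0 i g

end GroupDecomposition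

/-! ### Functoriality of Λ(H). -/

section LamMap
variable {H H' : Type*} [AddCommGroup H] [AddCommGroup H']

theorem finprod_comm_of_finite {α β M : Type*} [CommMonoid M] {f : α → β → M}
    (h : {p : α × β | f p.1 p.2 ≠ 1}.Finite) : ∏ᶠ a, ∏ᶠ b, f a b = ∏ᶠ b, ∏ᶠ a, f a b := by
  have h1 := finprod_curry (fun p : α × β => f p.1 p.2) h
  have h' : (Function.mulSupport fun p : β × α => f p.2 p.1).Finite :=
    (h.image (Equiv.prodComm α β)).subset fun p hp => ⟨(p.2, p.1), hp, rfl⟩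
  have h2 := finprod_curry (fun p : β × α => f p.2 p.1) h'
  rw [← h1, ← h2]
  exact (finprod_comp_equiv (Equiv.prodComm α β) (f := fun p : β × α => f p.2 p.1))

/-- The homomorphism `Λ(H) → Λ(H')` induced by a homomorphism `H → H'`. -/
def Lam.map (f : H →+ H') : Lam H →+ Lam H' where
  toFun l := ⟨Finsupp.mapRange f f.map_zero l.1, by
    change (Finsupp.mapRange f f.map_zero l.1).sum (fun _ h => h) = 0
    rw [Finsupp.sum_mapRange_index fun _ => rfl]
    have : f (l.1.sum fun _ h => h) = 0 := by
      rw [show (l.1.sum fun _ h => h) = 0 from l.2, map_zero]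
    rwa [map_finsuppSum] at this⟩
  map_zero' := Lam.ext fun k => f.map_zero
  map_add' l l' := Lam.ext fun k => f.map_add _ _

theorem Lam.map_val (f : H →+ H') (l : Lam H) (k : Z2) : (Lam.map f l).1 k = f (l.1 k) := rfl

theorem Lam.map_act (f : H →+ H') (g : AffineGroup) (l : Lam H) :
    Lam.map f (Lam.act g l) = Lam.act g (Lam.map f l) := Lam.ext fun _ => rfl

theorem shiftUnitary_delta (χ : AddChar H Circle) (g : AffineGroup) (l : Lam H) :
    shiftUnitary χ g (delta l) = (phase χ g l : ℂ) • delta (Lam.act g l) := monomial_delta _ _ _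

theorem phase_zero (χ : AddChar H Circle) (g : AffineGroup) : phase χ g 0 = 1 := by
  simp [phase]

end LamMap

/-! ### Identification of the tensor product action with a single shift. -/

section OddPrimes
variable (Q : Set OddPrime)

theorem component_single (q : Q) (x : HGroup q.1.1) :
    HSum.component Q q (DFinsupp.singleAddHom (fun q : Q => HGroup q.1.1) q x) = x :=
  DFinsupp.single_eq_same

theorem component_single_ne {q q' : Q} (h : q' ≠ q) (x : HGroup q.1.1) :
    HSum.component Q q' (DFinsupp.singleAddHom (fun q : Q => HGroup q.1.1) q x) = 0 :=
  DFinsupp.single_eq_of_ne h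

variable {Q} in
theorem finite_component_lam (l : Lam (HSum Q)) :
    {p : Z2 × Q | HSum.component Q p.2 (l.1 p.1) ≠ 0}.Finite := by
  have h : (⋃ k ∈ l.1.support, (Prod.mk k) '' {q | HSum.component Q q (l.1 k) ≠ 0}).Finite :=
    Set.Finite.biUnion (Finset.finite_toSet _) fun k _ => (HSum.finite_component _).image _
  refine h.subset ?_
  rintro ⟨k, q⟩ hp
  have hp' : HSum.component Q q (l.1 k) ≠ 0 := hp
  refine Set.mem_iUnion₂.2 ⟨k, ?_, q, hp', rfl⟩
  rw [Finsupp.mem_support_iff]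
  intro h0
  rw [h0, map_zero] at hp'
  exact hp' rfl

theorem lam_decomposition :
    IsDirectSumDecomposition (fun q : Q => Lam.map (HSum.component Q q))
      fun q : Q => Lam.map (DFinsupp.singleAddHom (fun q : Q => HGroup q.1.1) q) where
  finite l := by
    refine ((finite_component_lam l).image Prod.snd).subset fun q hq => ?_
    by_contra hc
    refine hq (Lam.ext fun k => ?_)
    by_contra hk
    exact hc ⟨(k, q), hk, rfl⟩
  eq_zero l hl := Lam.ext fun k => DFinsupp.ext fun q =>
    DFunLike.congr_fun (congrArg Subtype.val (hl q)) k
  e_s q l := Lam.ext fun k => component_single Q q _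
  e_s_ne q q' l h := Lam.ext fun k => component_single_ne Q h _

/-- Only finitely many pairs (k, q) have λ(k)_q ≠ 0, so the products over ℤ² and over Q may be
interchanged. -/
theorem muSum_tilde_apply (l l' : Lam (HSum Q)) :
    (muSum Q).tilde l l' = ∏ᶠ q : Q, (muCocycle q.1.1).tilde (Lam.map (HSum.component Q q) l)
      (Lam.map (HSum.component Q q) l') := by
  rw [Cocycle.tilde_apply]
  refine (finprod_comm_of_finite (f := fun (k : Z2) (q : Q) => muCocycle q.1.1
    (HSum.component Q q (l.1 k)) (HSum.component Q q (l'.1 k))) ?_)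
  refine (finite_component_lam l).subset fun p hp h0 => hp ?_
  simp [h0]

theorem phase_chiSum (g : AffineGroup) (l : Lam (HSum Q)) :
    phase (chiSum Q) g l = ∏ᶠ q : Q, phase (chiChar q.1.1) g (Lam.map (HSum.component Q q) l) := by
  simp only [phase_eq]
  refine Eq.trans (finprod_congr fun m => ?_) (finprod_comm_of_finite
    (f := fun (m : Z2) (q : Q) => chiChar q.1.1 (HSum.component Q q (l.1 m)) ^
      det g.left.toAdd (g.right.1.mulVec m)) ?_)
  · refine (zpowGroupHom (det g.left.toAdd (g.right.1.mulVec m))).map_finprod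
      (f := fun q : Q => chiChar q.1.1 (HSum.component Q q (l.1 m))) ?_
    refine (HSum.finite_component (l.1 m)).subset fun q hq h0 => hq ?_
    simp [h0]
  · refine (finite_component_lam l).subset fun p hp h0 => hp ?_
    simp [h0]

theorem nonempty_spatialIso_betaTensor :
    Nonempty ((betaTensor Q).SpatialIso (twistedBernoulliShift (muSum Q) (chiSum Q))) :=
  nonempty_spatialIso_tensor (lam_decomposition Q) (μ := fun q => (muCocycle q.1.1).tilde)
    (muSum_tilde_apply Q) (fun q : Q => betaPrime q.1) _ (fun _ => rfl) (fun _ => rfl) rfl rfl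
    (fun q => shiftUnitary_delta (chiChar q.1.1)) (shiftUnitary_delta (chiSum Q))
    (fun _ g l => Lam.map_act _ g l) (phase_chiSum Q) fun _ g => phase_zero _ g

end OddPrimes

/-! ### Factoriality, finiteness and approximate finite dimensionality. -/

section FactorCriteria
open Topology
variable {Γ : Type*} [AddCommGroup Γ] {ν : Cocycle Γ}

theorem eq_smul_one_of_coeff {x : L2 Γ →L[ℂ] L2 Γ} (hx : x ∈ twistedGroupVN ν)
    (h : ∀ γ ≠ 0, x (delta 0) γ = 0) : x = x (delta 0) 0 • 1 := by
  refine eq_of_apply_delta_zero hx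
    (SMulMemClass.smul_mem (s := (twistedGroupVN ν).toStarSubalgebra) _ (one_mem _)) ?_
  ext γ
  by_cases hγ : γ = 0
  · subst hγ
    change _ = x (delta 0) 0 * (delta 0 : L2 Γ) 0
    rw [delta_apply_self, mul_one]
  · rw [h γ hγ]
    change _ = x (delta 0) 0 * (delta 0 : L2 Γ) γ
    rw [delta_apply_ne hγ, mul_zero]

theorem twistedOp_apply (γ ρ : Γ) (f : L2 Γ) :
    twistedOp ν γ f (γ + ρ) = (ν γ ρ : ℂ) * f ρ := by
  change (ν γ (-γ + (γ + ρ)) : ℂ) * f (-γ + (γ + ρ)) = _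
  rw [neg_add_cancel_left]

/-- Comparing the coefficients of x u_{γ'} and u_{γ'} x at γ' + γ gives ν(γ, γ') x_γ = ν(γ', γ) x_γ,
which kills x_γ for γ ≠ 0. -/
theorem isFactor_twistedGroupVN (h : ∀ γ : Γ, γ ≠ 0 → ∃ γ', ν γ γ' ≠ ν γ' γ) :
    IsFactor (twistedGroupVN ν) := by
  intro x hx hc
  refine ⟨_, eq_smul_one_of_coeff hx fun γ hγ => ?_⟩
  obtain ⟨γ', hγ'⟩ := h γ hγ
  have h1 := DFunLike.congr_fun (hc _ (twistedOp_mem ν γ')) (delta 0)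
  have h2 : x (delta γ') = twistedOp ν γ' (x (delta 0)) := by
    have h3 : twistedOp ν γ' (delta 0) = delta γ' := by
      rw [twistedOp_delta, ν.zero_right, add_zero, Circle.coe_one, one_smul]
    rw [← h3]
    exact h1
  have h4 := congrArg (fun f : L2 Γ => f (γ' + γ)) h2
  simp only at h4
  rw [apply_delta hx, twistedOp_apply, add_sub_cancel_left] at h4
  by_contra h0
  exact hγ' (Circle.ext (mul_right_cancel₀ h0 h4))

/-- The trace property gives ‖v* δ₀‖ = ‖v δ₀‖ = 1, so the projection 1 - v v* annihilates δ₀, which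
is separating. -/
theorem isFiniteVN_twistedGroupVN : IsFiniteVN (twistedGroupVN ν) := by
  intro v hv h
  have h1 : ‖star v (delta 0)‖ = 1 := by
    have e : ⟪v (delta 0), v (delta 0)⟫_ℂ = ⟪(delta 0 : L2 Γ), delta 0⟫_ℂ := by
      rw [← ContinuousLinearMap.adjoint_inner_right, ← ContinuousLinearMap.star_eq_adjoint]
      change ⟪_, (star v * v) (delta 0)⟫_ℂ = _
      rw [h]
      rfl
    rw [inner_self_eq_norm_sq_to_K, inner_self_eq_norm_sq_to_K, norm_delta] at e
    have e2 : ‖v (delta 0)‖ ^ 2 = 1 := by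
      have : ((‖v (delta 0)‖ : ℂ)) ^ 2 = 1 := by simpa using e
      exact_mod_cast this
    rw [norm_star_apply_delta_zero hv]
    exact (pow_eq_one_iff_of_nonneg (norm_nonneg _) two_ne_zero).1 e2
  have hw : 1 - v * star v ∈ twistedGroupVN ν := sub_mem (one_mem _) (mul_mem hv (star_mem hv))
  have hs : star (1 - v * star v) * (1 - v * star v) = 1 - v * star v := by
    have : v * star v * (v * star v) = v * star v := by
      rw [mul_assoc, ← mul_assoc (star v), h, one_mul]
    rw [star_sub, star_mul, star_star, star_one, sub_mul, mul_sub, mul_sub, one_mul, mul_one,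
      one_mul, this]
    abel
  have h2 : (1 - v * star v) (delta 0) = 0 := by
    rw [← inner_self_eq_zero (𝕜 := ℂ), ← ContinuousLinearMap.adjoint_inner_right,
      ← ContinuousLinearMap.star_eq_adjoint]
    change ⟪_, (star (1 - v * star v) * (1 - v * star v)) (delta 0)⟫_ℂ = 0
    rw [hs]
    change ⟪(delta 0 : L2 Γ), delta 0 - v (star v (delta 0))⟫_ℂ = 0
    rw [inner_sub_right, inner_self_eq_norm_sq_to_K, norm_delta,
      ← ContinuousLinearMap.adjoint_inner_left, ← ContinuousLinearMap.star_eq_adjoint,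
      inner_self_eq_norm_sq_to_K, h1, sub_self]
  have h3 := eq_of_apply_delta_zero hw (zero_mem _) h2
  exact (sub_eq_zero.1 h3).symm

theorem infinite_dimensional_twistedGroupVN [Infinite Γ] :
    ¬ FiniteDimensional ℂ (twistedGroupVN ν).toStarSubalgebra := by
  intro hfd
  let ev : (twistedGroupVN ν).toStarSubalgebra →ₗ[ℂ] L2 Γ :=
    { toFun := fun x => x.1 (delta 0)
      map_add' := fun _ _ => rfl
      map_smul' := fun _ _ => rfl }
  have hev : ∀ γ, ev (twistedElem ν γ) = delta γ := fun γ => by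
    change twistedOp ν γ (delta 0) = delta γ
    rw [twistedOp_delta, ν.zero_right, add_zero, Circle.coe_one, one_smul]
  have ho : Orthonormal ℂ (delta : Γ → L2 Γ) := by
    classical
    rw [orthonormal_iff_ite]
    intro γ γ'
    rw [inner_delta]
    split_ifs with h
    · rw [h, delta_apply_self]
    · exact delta_apply_ne h
  have hli : LinearIndependent ℂ (ev ∘ twistedElem ν) := by
    have : ev ∘ twistedElem ν = delta := funext hev
    rw [this]
    exact ho.linearIndependent
  have := (LinearIndependent.of_comp ev hli).finite
  exact not_finite Γ

/-- The span of the unitaries `u_γ`, for `γ` in a subgroup. -/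
def spanTwisted (ν : Cocycle Γ) (K : AddSubgroup Γ) : StarSubalgebra ℂ (L2 Γ →L[ℂ] L2 Γ) where
  toSubalgebra := (Submodule.span ℂ (twistedOp ν '' K)).toSubalgebra
    (by rw [← twistedOp_zero ν]; exact Submodule.subset_span ⟨0, K.zero_mem, rfl⟩) (by
      intro x y hx hy
      induction hx, hy using Submodule.span_induction₂ with
      | mem_mem x y hx hy =>
        obtain ⟨γ, hγ, rfl⟩ := hx
        obtain ⟨γ', hγ', rfl⟩ := hy
        rw [twistedOp_mul]
        exact Submodule.smul_mem _ _ (Submodule.subset_span ⟨_, K.add_mem hγ hγ', rfl⟩)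
      | zero_left y hy => rw [zero_mul]; exact zero_mem _
      | zero_right x hx => rw [mul_zero]; exact zero_mem _
      | add_left x y z _ _ _ h1 h2 => rw [add_mul]; exact add_mem h1 h2
      | add_right x y z _ _ _ h1 h2 => rw [mul_add]; exact add_mem h1 h2
      | smul_left r x y _ _ h => rw [smul_mul_assoc]; exact Submodule.smul_mem _ _ h
      | smul_right r x y _ _ h => rw [mul_smul_comm]; exact Submodule.smul_mem _ _ h)
  star_mem' := by
    intro x (hx : x ∈ Submodule.span ℂ (twistedOp ν '' K))
    change star x ∈ Submodule.span ℂ (twistedOp ν '' K)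
    induction hx using Submodule.span_induction with
    | mem x hx =>
      obtain ⟨γ, hγ, rfl⟩ := hx
      rw [star_twistedOp, Circle.smul_def]
      exact Submodule.smul_mem _ _ (Submodule.subset_span ⟨_, K.neg_mem hγ, rfl⟩)
    | zero => rw [star_zero]; exact zero_mem _
    | add x y hx hy h1 h2 => rw [star_add]; exact add_mem h1 h2
    | smul c x hx h => rw [star_smul]; exact Submodule.smul_mem _ _ h

/-- In an abelian torsion group the first n elements of an enumeration generate a finite subgroup;
the spans of its unitaries are the required finite dimensional algebras. -/
theorem isAFD_twistedGroupVN [Countable Γ] (ht : ∀ γ : Γ, IsOfFinAddOrder γ) :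
    IsAFD (twistedGroupVN ν) := by
  obtain ⟨f, hf⟩ := exists_surjective_nat Γ
  set K : ℕ → AddSubgroup Γ := fun n => AddSubgroup.closure (f '' Set.Iio n) with hK
  have hKm : Monotone K := fun m n h =>
    AddSubgroup.closure_mono (Set.image_mono (Set.Iio_subset_Iio h))
  have hKf : ∀ n, Finite (K n) := fun n => by
    have h1 : AddGroup.FG (K n) := (AddGroup.fg_iff_addSubgroup_fg _).2
      ((AddSubgroup.fg_iff _).2 ⟨_, rfl, (Set.finite_Iio n).image f⟩)
    exact AddCommGroup.finite_of_fg_isAddTorsion _ fun γ => AddSubmonoid.isOfFinAddOrder_coe.1 (ht γ.1)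
  refine ⟨fun n => spanTwisted ν (K n), fun m n h x hx => ?_, fun n => ?_, ?_⟩
  · exact Submodule.span_mono (Set.image_mono (hKm h)) hx
  · have := hKf n
    have hfin : (twistedOp ν '' (K n : Set Γ)).Finite := (Set.toFinite (K n : Set Γ)).image _
    exact FiniteDimensional.span_of_finite ℂ hfin
  · ext x
    constructor
    · refine vonNeumannClosure_le ?_
      rintro _ ⟨γ, rfl⟩
      obtain ⟨n, rfl⟩ := hf γ
      refine subset_vonNeumannClosure _ (Set.mem_iUnion.2 ⟨n + 1, ?_⟩)
      exact Submodule.subset_span ⟨f n, AddSubgroup.subset_closure ⟨n, Nat.lt_succ_self n, rfl⟩, rfl⟩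
    · refine vonNeumannClosure_le fun s hs => ?_
      obtain ⟨n, hs⟩ := Set.mem_iUnion.1 hs
      have hle : Submodule.span ℂ (twistedOp ν '' (K n : Set Γ)) ≤
          Subalgebra.toSubmodule (twistedGroupVN ν).toStarSubalgebra.toSubalgebra := by
        rw [Submodule.span_le]
        rintro _ ⟨γ, _, rfl⟩
        exact twistedOp_mem ν γ
      exact hle hs

end FactorCriteria

/-! ### The elements h δ_k - h δ_l of Λ(H) and the AFD II₁ criterion. -/

section Pairs
variable {H : Type*} [AddCommGroup H]

/-- The element `h δ_k - h δ_l` of `Λ(H)`. -/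
def Lam.pair (k l : Z2) : H →+ Lam H where
  toFun h := ⟨Finsupp.single k h - Finsupp.single l h, by
    change (Finsupp.single k h - Finsupp.single l h).sum (fun _ h => h) = 0
    rw [Finsupp.sum_sub_index (by simp), Finsupp.sum_single_index rfl, Finsupp.sum_single_index rfl,
      sub_self]⟩
  map_zero' := Lam.ext fun m => by simp
  map_add' h h' := Lam.ext fun m => by
    change (Finsupp.single k (h + h') - Finsupp.single l (h + h')) m =
      (Finsupp.single k h - Finsupp.single l h) m + (Finsupp.single k h' - Finsupp.single l h') m
    simp only [Finsupp.single_add, Finsupp.sub_apply, Finsupp.add_apply]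
    abel

theorem Lam.pair_val (k l : Z2) (h : H) :
    (Lam.pair k l h).1 = Finsupp.single k h - Finsupp.single l h := rfl

theorem Lam.pair_left {k l : Z2} (hkl : k ≠ l) (h : H) : (Lam.pair k l h).1 k = h := by
  rw [Lam.pair_val, Finsupp.sub_apply, Finsupp.single_eq_same, Finsupp.single_eq_of_ne hkl, sub_zero]

theorem Lam.pair_right {k l : Z2} (hkl : k ≠ l) (h : H) : (Lam.pair k l h).1 l = -h := by
  rw [Lam.pair_val, Finsupp.sub_apply, Finsupp.single_eq_same, Finsupp.single_eq_of_ne hkl.symm,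
    zero_sub]

theorem Lam.pair_of_ne {k l m : Z2} (hk : m ≠ k) (hl : m ≠ l) (h : H) :
    (Lam.pair k l h).1 m = 0 := by
  rw [Lam.pair_val, Finsupp.sub_apply, Finsupp.single_eq_of_ne hk, Finsupp.single_eq_of_ne hl,
    sub_zero]

theorem Lam.pair_self (k : Z2) (h : H) : Lam.pair k k h = 0 := Lam.ext fun m => by
  rw [Lam.pair_val, sub_self]
  rfl

theorem Lam.pair_swap (k l : Z2) (h : H) : Lam.pair l k h = -Lam.pair k l h := Subtype.ext (by
  rw [AddSubgroup.coe_neg, Lam.pair_val, Lam.pair_val, neg_sub])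

theorem Lam.pair_add_pair (i j k : Z2) (h : H) :
    Lam.pair i j h + Lam.pair j k h = Lam.pair i k h := Subtype.ext (by
  rw [AddSubgroup.coe_add, Lam.pair_val, Lam.pair_val, Lam.pair_val, sub_add_sub_cancel])

theorem Lam.map_pair {H' : Type*} [AddCommGroup H'] (f : H →+ H') (k l : Z2) (h : H) :
    Lam.map f (Lam.pair k l h) = Lam.pair k l (f h) := Lam.ext fun m => by
  rw [Lam.map_val, Lam.pair_val, Lam.pair_val, Finsupp.sub_apply, Finsupp.sub_apply, map_sub,
    Finsupp.single_apply, Finsupp.single_apply, Finsupp.single_apply, Finsupp.single_apply]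
  split_ifs <;> simp

theorem Lam.act_pair (g : AffineGroup) (k l : Z2) (h : H) :
    Lam.act g (Lam.pair k l h) = Lam.pair (affineAct g k) (affineAct g l) h := Lam.ext fun m => by
  classical
  obtain ⟨m, rfl⟩ := (affineAct g).surjective m
  rw [Lam.act_apply, Equiv.symm_apply_apply, Lam.pair_val, Lam.pair_val, Finsupp.sub_apply,
    Finsupp.sub_apply, Finsupp.single_apply, Finsupp.single_apply, Finsupp.single_apply,
    Finsupp.single_apply]
  simp only [EmbeddingLike.apply_eq_iff_eq]

/-- The vanishing sum fixes the value at `j`. The case `i = j` is included: a function supported at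
one point is then zero. -/
theorem Lam.eq_pair {l : Lam H} {i j : Z2} (hl : ∀ m, m ≠ i → m ≠ j → l.1 m = 0) :
    l = Lam.pair i j (l.1 i) := by
  by_cases hij : i = j
  · subst hij
    rw [Lam.pair_self]
    have h1 : l.1 = Finsupp.single i (l.1 i) := by
      ext m
      by_cases hm : m = i
      · rw [hm, Finsupp.single_eq_same]
      · rw [hl m hm hm, Finsupp.single_eq_of_ne hm]
    have h2 : (l.1.sum fun _ h => h) = 0 := l.2
    rw [h1, Finsupp.sum_single_index rfl] at h2
    exact Subtype.ext (by rw [h1, h2, Finsupp.single_zero]; rfl)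
  · set l' := l - Lam.pair i j (l.1 i) with hl'
    have h1 : ∀ m, m ≠ j → l'.1 m = 0 := fun m hm => by
      rw [hl', AddSubgroup.coe_sub, Finsupp.sub_apply]
      by_cases hmi : m = i
      · rw [hmi, Lam.pair_left hij, sub_self]
      · rw [hl m hmi hm, Lam.pair_of_ne hmi hm, sub_zero]
    have h2 : l'.1 = Finsupp.single j (l'.1 j) := by
      ext m
      by_cases hm : m = j
      · rw [hm, Finsupp.single_eq_same]
      · rw [h1 m hm, Finsupp.single_eq_of_ne hm]
    have h3 : (l'.1.sum fun _ h => h) = 0 := l'.2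
    rw [h2, Finsupp.sum_single_index rfl] at h3
    have h4 : l' = 0 := Subtype.ext (by rw [h2, h3, Finsupp.single_zero]; rfl)
    exact sub_eq_zero.1 h4

theorem finprod_pair {M : Type*} [CommMonoid M] {k l : Z2} (hkl : k ≠ l) {f : Z2 → M}
    (hf : ∀ m, m ≠ k → m ≠ l → f m = 1) : ∏ᶠ m, f m = f k * f l := by
  classical
  rw [finprod_eq_prod_of_mulSupport_subset (s := {k, l}) f fun m hm => ?_, Finset.prod_pair hkl]
  by_contra hc
  simp only [Finset.coe_insert, Finset.coe_singleton, Set.mem_insert_iff, Set.mem_singleton_iff,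
    not_or] at hc
  exact hm (hf m hc.1 hc.2)

theorem Cocycle.tilde_pair_right (μ : Cocycle H) (x : Lam H) {k l : Z2} (hkl : k ≠ l) (h : H) :
    μ.tilde x (Lam.pair k l h) = μ (x.1 k) h * μ (x.1 l) (-h) := by
  rw [Cocycle.tilde_apply, finprod_pair hkl fun m hk hl => by
    rw [Lam.pair_of_ne hk hl, μ.zero_right], Lam.pair_left hkl, Lam.pair_right hkl]

theorem Cocycle.tilde_pair_left (μ : Cocycle H) (x : Lam H) {k l : Z2} (hkl : k ≠ l) (h : H) :
    μ.tilde (Lam.pair k l h) x = μ h (x.1 k) * μ (-h) (x.1 l) := by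
  rw [Cocycle.tilde_apply, finprod_pair hkl fun m hk hl => by
    rw [Lam.pair_of_ne hk hl, μ.zero_left], Lam.pair_left hkl, Lam.pair_right hkl]

theorem phase_pair (χ : AddChar H Circle) (g : AffineGroup) {k l : Z2} (hkl : k ≠ l) (h : H) :
    phase χ g (Lam.pair k l h) =
      χ h ^ (det g.left.toAdd (g.right.1.mulVec k) - det g.left.toAdd (g.right.1.mulVec l)) := by
  rw [phase_eq, finprod_pair hkl fun m hk hl => by
    rw [Lam.pair_of_ne hk hl, AddChar.map_zero_eq_one, one_zpow], Lam.pair_left hkl,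
    Lam.pair_right hkl, AddChar.map_neg_eq_inv, inv_zpow', ← zpow_add, sub_eq_add_neg]

theorem exists_ne_of_support_finite (f : Z2 →₀ H) (k : Z2) : ∃ l, l ≠ k ∧ f l = 0 := by
  classical
  obtain ⟨l, hl⟩ := Infinite.exists_notMem_finset (insert k f.support)
  rw [Finset.mem_insert, not_or, Finsupp.notMem_support_iff] at hl
  exact ⟨l, hl⟩

theorem isOfFinAddOrder_lam (h : ∀ h : H, IsOfFinAddOrder h) (l : Lam H) : IsOfFinAddOrder l := by
  have key : ∀ f : Z2 →₀ H, IsOfFinAddOrder f := fun f => by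
    induction f using Finsupp.induction_linear with
    | zero => exact IsOfFinAddOrder.zero
    | add f g hf hg => exact hf.add hg
    | single k x => exact (Finsupp.singleAddHom k).isOfFinAddOrder (h x)
  exact AddSubmonoid.isOfFinAddOrder_coe.1 (key l.1)

/-- The von Neumann algebra of a twisted Bernoulli shift with a nondegenerate cocycle on a
countable torsion group is the AFD factor of type II₁. -/
theorem isAFDII₁Factor_of_nondegenerate [Countable H] [Nontrivial H] (μ : Cocycle H)
    (hμ : ∀ h : H, h ≠ 0 → ∃ h', μ h h' ≠ μ h' h) (ht : ∀ h : H, IsOfFinAddOrder h) :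
    IsAFDII₁Factor (twistedGroupVN μ.tilde) := by
  have hinf : Infinite (Lam H) := by
    obtain ⟨h, hh⟩ := exists_ne (0 : H)
    refine Infinite.of_injective (fun n : ℕ => Lam.pair (fun _ => ((n : ℤ) + 1)) 0 h) fun m n hmn => ?_
    by_contra hne
    have h1 := DFunLike.congr_fun (congrArg Subtype.val hmn) (fun _ => ((m : ℤ) + 1))
    have hm0 : ∀ n : ℕ, (fun _ => ((n : ℤ) + 1) : Z2) ≠ 0 := fun n h0 => by
      have : (n : ℤ) + 1 = 0 := congrFun h0 0
      omega
    simp only at h1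
    rw [Lam.pair_left (hm0 m), Lam.pair_of_ne (fun h0 => ?_) (hm0 m)] at h1
    · exact hh h1
    · have : (m : ℤ) + 1 = n + 1 := congrFun h0 0
      omega
  refine ⟨isFactor_twistedGroupVN fun l hl => ?_, isFiniteVN_twistedGroupVN,
    infinite_dimensional_twistedGroupVN, isAFD_twistedGroupVN (isOfFinAddOrder_lam ht)⟩
  obtain ⟨k, hk⟩ : ∃ k, l.1 k ≠ 0 := by
    by_contra! hc
    exact hl (Lam.ext hc)
  -- Placing the compensating value -h outside the support leaves only the factor at `k` in the
  -- commutator.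
  obtain ⟨k', hkk', hk'⟩ := exists_ne_of_support_finite l.1 k
  obtain ⟨h, hh⟩ := hμ _ hk
  refine ⟨Lam.pair k k' h, ?_⟩
  rw [μ.tilde_pair_right _ hkk'.symm, μ.tilde_pair_left _ hkk'.symm, hk', μ.zero_left, μ.zero_right,
    mul_one, mul_one]
  exact hh

end Pairs

/-! ### The cocycle μ_Q: bimultiplicative and nondegenerate on a torsion group. -/

section OddPrimes
variable (Q : Set OddPrime)

theorem hsum_decomposition :
    IsDirectSumDecomposition (fun q : Q => HSum.component Q q)
      fun q : Q => DFinsupp.singleAddHom (fun q : Q => HGroup q.1.1) q where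
  finite := HSum.finite_component
  eq_zero _ hx := DFinsupp.ext hx
  e_s := component_single Q
  e_s_ne _ _ x h := component_single_ne Q h x

variable {Q}

theorem muSum_apply (x y : HSum Q) :
    muSum Q x y = ∏ᶠ q : Q, muCocycle q.1.1 (HSum.component Q q x) (HSum.component Q q y) := rfl

theorem chiSum_apply (x : HSum Q) :
    chiSum Q x = ∏ᶠ q : Q, chiChar q.1.1 (HSum.component Q q x) := rfl

theorem muCocycle_eq (q : ℕ) [NeZero q] (x y : HGroup q) :
    muCocycle q x y = ZMod.toCircle (x.1 * y.2) := rfl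

theorem muSum_add_left (x y z : HSum Q) : muSum Q (x + y) z = muSum Q x z * muSum Q y z := by
  rw [muSum_apply, muSum_apply, muSum_apply, ← finprod_mul_distrib
    (Cocycle.finite_mulSupport_comp _ (HSum.finite_component x))
    (Cocycle.finite_mulSupport_comp _ (HSum.finite_component y))]
  refine finprod_congr fun q => ?_
  rw [map_add, muCocycle_eq, muCocycle_eq, muCocycle_eq, Prod.fst_add, add_mul,
    AddChar.map_add_eq_mul]

theorem muSum_add_right (x y z : HSum Q) : muSum Q x (y + z) = muSum Q x y * muSum Q x z := by
  rw [muSum_apply, muSum_apply, muSum_apply, ← finprod_mul_distrib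
    (Cocycle.finite_mulSupport_comp _ (HSum.finite_component x))
    (Cocycle.finite_mulSupport_comp _ (HSum.finite_component x))]
  refine finprod_congr fun q => ?_
  rw [map_add, muCocycle_eq, muCocycle_eq, muCocycle_eq, Prod.snd_add, mul_add,
    AddChar.map_add_eq_mul]

theorem muSum_single_right (x : HSum Q) (q : Q) (y : HGroup q.1.1) :
    muSum Q x (DFinsupp.singleAddHom (fun q : Q => HGroup q.1.1) q y) =
      muCocycle q.1.1 (HSum.component Q q x) y := by
  rw [muSum_apply, finprod_eq_single _ q fun q' hq' => by
    rw [component_single_ne Q hq', Cocycle.zero_right], component_single]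

theorem muSum_single_left (x : HSum Q) (q : Q) (y : HGroup q.1.1) :
    muSum Q (DFinsupp.singleAddHom (fun q : Q => HGroup q.1.1) q y) x =
      muCocycle q.1.1 y (HSum.component Q q x) := by
  rw [muSum_apply, finprod_eq_single _ q fun q' hq' => by
    rw [component_single_ne Q hq', Cocycle.zero_left], component_single]

theorem chiSum_single (q : Q) (y : HGroup q.1.1) :
    chiSum Q (DFinsupp.singleAddHom (fun q : Q => HGroup q.1.1) q y) = chiChar q.1.1 y := by
  rw [chiSum_apply, finprod_eq_single _ q fun q' hq' => by
    rw [component_single_ne Q hq', AddChar.map_zero_eq_one], component_single]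

/-- Oddness is what later permits passing from an identity of squares of characters to the identity
itself. -/
theorem exists_odd_nsmul_eq_zero (x : HSum Q) : ∃ n : ℕ, Odd n ∧ n • x = 0 := by
  refine (hsum_decomposition Q).induction (P := fun x => ∃ n : ℕ, Odd n ∧ n • x = 0) ?_ ?_ ?_ x
  · exact ⟨1, odd_one, by simp⟩
  · rintro x y ⟨m, hm, hx⟩ ⟨n, hn, hy⟩
    refine ⟨m * n, hm.mul hn, ?_⟩
    rw [nsmul_add, mul_nsmul, hx, nsmul_zero, mul_nsmul', hy, nsmul_zero, add_zero]
  · intro q y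
    refine ⟨q.1.1, q.1.2.2, ?_⟩
    rw [← map_nsmul]
    have : q.1.1 • y = 0 := Prod.ext (by simp) (by simp)
    rw [this, map_zero]

theorem isOfFinAddOrder_hsum (x : HSum Q) : IsOfFinAddOrder x := by
  obtain ⟨n, hn, hx⟩ := exists_odd_nsmul_eq_zero x
  exact isOfFinAddOrder_iff_nsmul_eq_zero.2 ⟨n, hn.pos, hx⟩

/-- In a nonzero component (s, t), the test vector (0, 1) detects s and (1, 0) detects t. -/
theorem muSum_nondegenerate (x : HSum Q) (hx : x ≠ 0) : ∃ y, muSum Q x y ≠ muSum Q y x := by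
  obtain ⟨q, hq⟩ : ∃ q, HSum.component Q q x ≠ 0 := by
    by_contra! hc
    exact hx (DFinsupp.ext hc)
  have hinj := ZMod.injective_toCircle (N := q.1.1)
  by_cases h1 : (HSum.component Q q x).1 = 0
  · have h2 : (HSum.component Q q x).2 ≠ 0 := fun h2 => hq (Prod.ext h1 h2)
    refine ⟨DFinsupp.singleAddHom (fun q : Q => HGroup q.1.1) q (1, 0), ?_⟩
    rw [muSum_single_right, muSum_single_left, muCocycle_eq, muCocycle_eq]
    intro h
    have := hinj h
    simp only [mul_zero, one_mul] at this
    exact h2 this.symm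
  · refine ⟨DFinsupp.singleAddHom (fun q : Q => HGroup q.1.1) q (0, 1), ?_⟩
    rw [muSum_single_right, muSum_single_left, muCocycle_eq, muCocycle_eq]
    intro h
    have := hinj h
    simp only [mul_one, zero_mul] at this
    exact h1 this

theorem isAFDII₁Factor_bernoulli (hQ : Q.Nonempty) :
    IsAFDII₁Factor (twistedBernoulliShift (muSum Q) (chiSum Q)).alg := by
  obtain ⟨q, hq⟩ := hQ
  have : Nontrivial (HSum Q) := by
    have : Fact (1 < q.1) := ⟨q.2.1.one_lt⟩
    refine ⟨DFinsupp.singleAddHom (fun q : Q => HGroup q.1.1) ⟨q, hq⟩ (1, 0), 0, fun h => ?_⟩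
    have h1 := component_single Q ⟨q, hq⟩ (1, 0)
    rw [h, map_zero] at h1
    exact zero_ne_one (congrArg Prod.fst h1)
  have : ∀ q : Q, Countable (HGroup q.1.1) := fun q => by
    have := ZMod.fintype q.1.1
    infer_instance
  exact isAFDII₁Factor_of_nondegenerate (muSum Q) muSum_nondegenerate isOfFinAddOrder_hsum

end OddPrimes

/-! ### Single coefficients of products. -/

section FourierCoefficients
open Topology
variable {Γ : Type*} [AddCommGroup Γ] {ν : Cocycle Γ}

theorem eq_smul_twistedOp_of_coeff {x : L2 Γ →L[ℂ] L2 Γ} (hx : x ∈ twistedGroupVN ν) {γ₀ : Γ}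
    (h : ∀ γ, γ ≠ γ₀ → x (delta 0) γ = 0) : x = x (delta 0) γ₀ • twistedOp ν γ₀ := by
  refine eq_of_apply_delta_zero hx
    (SMulMemClass.smul_mem (s := (twistedGroupVN ν).toStarSubalgebra) _ (twistedOp_mem ν γ₀)) ?_
  have e : twistedOp ν γ₀ (delta 0) = delta γ₀ := by
    rw [twistedOp_delta, ν.zero_right, add_zero, Circle.coe_one, one_smul]
  ext γ
  change _ = x (delta 0) γ₀ * (twistedOp ν γ₀ (delta 0)) γ
  rw [e]
  by_cases hγ : γ = γ₀
  · subst hγ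
    rw [delta_apply_self, mul_one]
  · rw [h γ hγ, delta_apply_ne hγ, mul_zero]

/-- The coefficient of a product is a convolution sum over Γ; the hypothesis leaves only the term at
`γ₂`. -/
theorem mul_coeff {x y : L2 Γ →L[ℂ] L2 Γ} (hx : x ∈ twistedGroupVN ν) {γ₁ γ₂ : Γ}
    (h : ∀ γ, γ ≠ γ₂ → y (delta 0) γ = 0 ∨ x (delta 0) (γ₁ + γ₂ - γ) = 0) :
    (x * y) (delta 0) (γ₁ + γ₂) = (ν γ₁ γ₂ : ℂ) * x (delta 0) γ₁ * y (delta 0) γ₂ := by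
  have h1 := (((innerSL ℂ (delta (γ₁ + γ₂) : L2 Γ)).comp x).hasSum (hasSum_delta (y (delta 0))))
  have h2 : ∀ f, ((innerSL ℂ (delta (γ₁ + γ₂) : L2 Γ)).comp x) f = x f (γ₁ + γ₂) := fun f => by
    rw [ContinuousLinearMap.comp_apply, innerSL_apply_apply, inner_delta]
  simp only [map_smul, h2] at h1
  have h3 := h1.unique (hasSum_single γ₂ fun γ hγ => by
    change y (delta 0) γ * x (delta γ) (γ₁ + γ₂) = 0
    rw [apply_delta hx γ]
    rcases h γ hγ with h0 | h0
    · rw [h0, zero_mul]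
    · rw [h0, mul_zero, mul_zero])
  rw [mul_apply_eq_comp, h3]
  change y (delta 0) γ₂ * x (delta γ₂) (γ₁ + γ₂) = _
  rw [apply_delta hx γ₂, add_sub_cancel_right]
  ring

end FourierCoefficients

/-! ### Fourier supports of elements invariant under shears. -/

section Rigidity
open Topology
variable {H : Type*} [AddCommGroup H]

/-- The unitary `u(λ)` as an element of the algebra of the twisted Bernoulli shift. -/
def bernoulliElem (μ : Cocycle H) (χ : AddChar H Circle) (l : Lam H) :
    (twistedBernoulliShift μ χ).Alg := twistedElem μ.tilde l

variable {μ : Cocycle H} {χ : AddChar H Circle}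

theorem action_bernoulliElem (g : AffineGroup) (l : Lam H) :
    (twistedBernoulliShift μ χ).action g (bernoulliElem μ χ l) =
      (phase χ g l : ℂ) • bernoulliElem μ χ (Lam.act g l) :=
  Subtype.ext (conj_shiftUnitary μ χ g l)

theorem bernoulliElem_mul (l l' : Lam H) :
    bernoulliElem μ χ l * bernoulliElem μ χ l' =
      (μ.tilde l l' : ℂ) • bernoulliElem μ χ (l + l') := Subtype.ext (twistedOp_mul _ _ _)

/-- The Fourier coefficients of an element of `N(H, μ)`. -/
def coeff (x : (twistedBernoulliShift μ χ).Alg) (l : Lam H) : ℂ :=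
  (x : L2 (Lam H) →L[ℂ] L2 (Lam H)) (delta 0) l

theorem coeff_action (g : AffineGroup) (x : (twistedBernoulliShift μ χ).Alg) (l : Lam H) :
    coeff ((twistedBernoulliShift μ χ).action g x) (Lam.act g l) = (phase χ g l : ℂ) * coeff x l := by
  have h0 : (shiftUnitary χ g).symm (delta (0 : Lam H)) = delta 0 := by
    rw [LinearIsometryEquiv.symm_apply_eq]
    exact ((twistedBernoulliShift μ χ).U_Ω g).symm
  have h1 : ((twistedBernoulliShift μ χ).action g x : L2 (Lam H) →L[ℂ] L2 (Lam H)) (delta 0) =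
      shiftUnitary χ g ((x : L2 (Lam H) →L[ℂ] L2 (Lam H)) (delta 0)) := by
    rw [VNSystem.coe_action, LinearIsometryEquiv.conjStarAlgEquiv_apply_apply]
    exact congrArg (fun v => shiftUnitary χ g ((x : L2 (Lam H) →L[ℂ] L2 (Lam H)) v)) h0
  rw [coeff, h1]
  change (phase χ g ((Lam.act g).symm (Lam.act g l)) : ℂ) *
    (x : L2 (Lam H) →L[ℂ] L2 (Lam H)) (delta 0) ((Lam.act g).symm (Lam.act g l)) = _
  rw [AddEquiv.symm_apply_apply]
  rfl

/-- The element of `ℤ² ⋊ SL(2, ℤ)` with matrix `[[a, b], [c, d]]` and translation part `k`. -/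
def affineMk (k : Z2) (a b c d : ℤ) (h : a * d - b * c = 1) : AffineGroup :=
  ⟨Multiplicative.ofAdd k, ⟨!![a, b; c, d], by rw [Matrix.det_fin_two_of, h]⟩⟩

theorem affineAct_affineMk (k : Z2) (a b c d : ℤ) (h : a * d - b * c = 1) (m : Z2) :
    affineAct (affineMk k a b c d h) m = ![k 0 + (a * m 0 + b * m 1), k 1 + (c * m 0 + d * m 1)] := by
  rw [affineAct_apply]
  funext i
  fin_cases i <;> simp [affineMk, dotProduct, Fin.sum_univ_two]

theorem phase_affineMk_zero (a b c d : ℤ) (h : a * d - b * c = 1) (l : Lam H) :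
    phase χ (affineMk 0 a b c d h) l = 1 := by
  rw [phase_eq]
  refine finprod_eq_one_of_forall_eq_one fun m => ?_
  have : det (affineMk 0 a b c d h).left.toAdd ((affineMk 0 a b c d h).right.1.mulVec m) = 0 := by
    simp [det, affineMk]
  rw [this, zpow_zero]

/-- If two shears agree on `l`, then `l` is invariant under translating each horizontal line by a
multiple of its height. At nonzero height this gives infinitely many points in the support. -/
theorem injective_shear {l : Lam H} {m : Z2} (hm : m 1 ≠ 0) (hl : l.1 m ≠ 0) :
    Function.Injective fun n : ℤ => Lam.act (affineMk 0 1 n 0 1 (by ring)) l := by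
  intro n n' hnn
  by_contra hne
  have key : ∀ k : Z2, l.1 ![k 0 + (n - n') * k 1, k 1] = l.1 k := fun k => by
    have h1 := DFunLike.congr_fun (congrArg Subtype.val hnn)
      (affineAct (affineMk 0 1 n 0 1 (by ring)) k)
    simp only [Lam.act_apply, Equiv.symm_apply_apply] at h1
    rw [h1]
    congr 1
    rw [Equiv.eq_symm_apply, affineAct_affineMk, affineAct_affineMk]
    funext i
    fin_cases i
    · simp
      ring
    · simp
  have hj : ∀ j : ℕ, l.1 ![m 0 + j * ((n - n') * m 1), m 1] ≠ 0 := fun j => by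
    induction j with
    | zero =>
      convert hl using 2
      funext i
      fin_cases i <;> simp
    | succ j ih =>
      rw [← key] at ih
      convert ih using 2
      funext i
      fin_cases i <;> simp
      ring
  refine Set.infinite_of_injective_forall_mem (f := fun j : ℕ => ![m 0 + j * ((n - n') * m 1), m 1])
    (s := {k | l.1 k ≠ 0}) (fun i j hij => ?_) hj (l.1.hasFiniteSupport)
  have h1 := congrFun hij 0
  have h2 : (n - n') * m 1 ≠ 0 := mul_ne_zero (sub_ne_zero.2 hne) hm
  simp only [Matrix.cons_val_zero, add_right_inj] at h1
  exact_mod_cast mul_right_cancel₀ h2 h1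

/-- The elements of `N(H, μ)` fixed by the matrices `[[1, n], [0, 1]]` are supported on functions on
the line `ℤ × 0`. -/
theorem coeff_eq_zero_of_fixed {x : (twistedBernoulliShift μ χ).Alg}
    (hx : ∀ n : ℤ, (twistedBernoulliShift μ χ).action (affineMk 0 1 n 0 1 (by ring)) x = x)
    {l : Lam H} (hl : coeff x l ≠ 0) {m : Z2} (hm : l.1 m ≠ 0) : m 1 = 0 := by
  by_contra hm1
  have h1 : ∀ n : ℤ, coeff x (Lam.act (affineMk 0 1 n 0 1 (by ring)) l) = coeff x l := fun n => by
    have h2 := coeff_action (μ := μ) (χ := χ) (affineMk 0 1 n 0 1 (by ring)) x l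
    rw [hx, phase_affineMk_zero, Circle.coe_one] at h2
    exact h2.trans (one_mul _)
  -- The orbit of `l` is infinite and the coefficients along it are all equal to a nonzero number,
  -- contradicting square summability.
  refine Set.infinite_of_injective_forall_mem (injective_shear hm1 hm) (fun n => ?_)
    (finite_large_coeff ((x : L2 (Lam H) →L[ℂ] L2 (Lam H)) (delta 0)) (norm_pos_iff.2 hl))
  exact (congrArg norm (h1 n)).ge

theorem coeff_action_ne_zero {g : AffineGroup} {x : (twistedBernoulliShift μ χ).Alg} {l : Lam H}
    (h : coeff ((twistedBernoulliShift μ χ).action g x) l ≠ 0) {m : Z2} (hm : l.1 m ≠ 0) :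
    ∃ l', coeff x l' ≠ 0 ∧ ∃ m', l'.1 m' ≠ 0 ∧ affineAct g m' = m := by
  obtain ⟨l, rfl⟩ := (Lam.act g).surjective l
  obtain ⟨m, rfl⟩ := (affineAct g).surjective m
  rw [coeff_action] at h
  rw [Lam.act_apply, Equiv.symm_apply_apply] at hm
  exact ⟨l, right_ne_zero_of_mul h, m, hm, rfl⟩

/-- The first standard basis vector of `ℤ²`. -/
def e₁ : Z2 := ![1, 0]
/-- The second standard basis vector of `ℤ²`. -/
def e₂ : Z2 := ![0, 1]

theorem eq_zero_or_apply_eq_zero_of_point {l : Lam H} (i : Z2) (h : ∀ m, m ≠ i → l.1 m = 0) : l = 0 := by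
  rw [Lam.eq_pair (i := i) (j := i) fun m hm _ => h m hm, Lam.pair_self]

/-- An element of `N(H, μ)` supported on the line `ℤ × 0`, whose product with its translate on
the line `1 × ℤ` is supported on the diagonal, is a multiple of a unitary
`u(a δ₀ - a δ_{e₁})`. -/
theorem exists_eq_smul_pair {x y z : (twistedBernoulliShift μ χ).Alg}
    (hx : ∀ l, coeff x l ≠ 0 → ∀ m, l.1 m ≠ 0 → m 1 = 0)
    (hy : ∀ l, coeff y l ≠ 0 → ∀ m, l.1 m ≠ 0 → m 0 = 1)
    (hz : ∀ l, coeff z l ≠ 0 → ∀ m, l.1 m ≠ 0 → m 0 = m 1)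
    {c : ℂ} (hxy : x * y = c • z) (hy0 : y ≠ 0) :
    ∃ a : H, ∃ c : ℂ, x = c • bernoulliElem μ χ (Lam.pair 0 e₁ a) := by
  obtain ⟨l₂, hl₂⟩ : ∃ l₂, coeff y l₂ ≠ 0 := by
    by_contra! hc
    refine hy0 (Subtype.ext (eq_of_apply_delta_zero y.2 (zero_mem _) ?_))
    ext l
    exact hc l
  have key : ∀ l₁, coeff x l₁ ≠ 0 → l₁ = Lam.pair 0 e₁ (l₂.1 e₁) := by
    intro l₁ hl₁
    -- Only the decomposition `l₁ + l₂` contributes: for any other, `l - l₂` is supported both on ℤ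
    -- × 0 and on 1 × ℤ, hence at `e₁` alone, and a zero-sum function at one point vanishes.
    have hprod : coeff (x * y) (l₁ + l₂) =
        (μ.tilde l₁ l₂ : ℂ) * coeff x l₁ * coeff y l₂ := by
      refine mul_coeff x.2 fun l hl => ?_
      by_contra! hc
      refine hl ?_
      refine sub_eq_zero.1 (eq_zero_or_apply_eq_zero_of_point e₁ fun m hm => ?_)
      by_contra hm0
      have hm0' : (l - l₂).1 m ≠ 0 := hm0
      have e : (l - l₂).1 m = l.1 m - l₂.1 m := rfl
      have hA : m 1 = 0 := by
        by_contra hm1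
        have h1 : l₁.1 m = 0 := by
          by_contra h; exact hm1 (hx _ hl₁ m h)
        have h2 : (l₁ + l₂ - l).1 m = 0 := by
          by_contra h; exact hm1 (hx _ hc.2 m h)
        have e2 : (l₁ + l₂ - l).1 m = l₁.1 m + l₂.1 m - l.1 m := rfl
        rw [e2, h1, zero_add] at h2
        rw [e, sub_eq_zero.1 h2, sub_self] at hm0'
        exact hm0' rfl
      have hB : m 0 = 1 := by
        by_contra hm1
        have h1 : l₂.1 m = 0 := by
          by_contra h; exact hm1 (hy _ hl₂ m h)
        have h2 : l.1 m = 0 := by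
          by_contra h; exact hm1 (hy _ hc.1 m h)
        rw [e, h1, h2, sub_self] at hm0'
        exact hm0' rfl
      exact hm (by funext i; fin_cases i; exacts [hB, hA])
    -- Hence `l₁ + l₂` lies in the support of `z`, so it is carried by the diagonal.
    have hz0 : coeff z (l₁ + l₂) ≠ 0 := by
      intro h0
      have h1 : coeff (x * y) (l₁ + l₂) = c * coeff z (l₁ + l₂) := by rw [hxy]; rfl
      rw [h0, mul_zero, hprod] at h1
      exact mul_ne_zero (mul_ne_zero (Circle.coe_ne_zero _) hl₁) hl₂ h1
    have hsum : ∀ m, m 0 ≠ m 1 → l₁.1 m + l₂.1 m = 0 := fun m hm => by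
      by_contra h
      exact hm (hz _ hz0 m h)
    -- Off `e₁` the function `l₂` vanishes on ℤ × 0, so there `l₁` equals `l₁ + l₂`, which is zero
    -- off the diagonal; only the points 0 and `e₁` remain.
    have hl₁' : l₁ = Lam.pair 0 e₁ (l₁.1 0) := Lam.eq_pair fun m hm0 hm1 => by
      by_contra h
      have h1 : m 1 = 0 := hx _ hl₁ m h
      have h2 : l₂.1 m = 0 := by
        by_contra h'
        have h3 := hy _ hl₂ m h'
        exact hm1 (by funext i; fin_cases i; exacts [h3, h1])
      by_cases h4 : m 0 = m 1
      · exact hm0 (by funext i; fin_cases i; exacts [h4.trans h1, h1])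
      · have := hsum m h4
        rw [h2, add_zero] at this
        exact h this
    -- The point `e₁` is off the diagonal, so the value of `l₁` is dictated by the fixed `l₂`. Thus
    -- `x` has at most one nonzero coefficient.
    have h5 := hsum e₁ (by simp [e₁])
    have h6 : l₁.1 e₁ = -l₁.1 0 := by
      conv_lhs => rw [hl₁']
      exact Lam.pair_right (by intro h; have := congrFun h 0; simp [e₁] at this) _
    rw [h6, neg_add_eq_zero] at h5
    rw [hl₁', h5]
  refine ⟨l₂.1 e₁, coeff x (Lam.pair 0 e₁ (l₂.1 e₁)), Subtype.ext ?_⟩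
  refine eq_smul_twistedOp_of_coeff x.2 fun l hl => ?_
  by_contra h
  exact hl (key l h)

end Rigidity

/-! ### Equivariant isomorphisms as maps of algebras. -/

namespace VNSystem
variable {G : Type*} [Group G]
variable {E : Type*} [NormedAddCommGroup E] [InnerProductSpace ℂ E] [CompleteSpace E]
variable {E' : Type*} [NormedAddCommGroup E'] [InnerProductSpace ℂ E'] [CompleteSpace E']
variable {S : VNSystem G E} {T : VNSystem G E'}

theorem action_smul (g : G) (c : ℂ) (x : S.Alg) : S.action g (c • x) = c • S.action g x :=
  map_smul _ _ _

theorem action_ne_zero (g : G) {x : S.Alg} (hx : x ≠ 0) : S.action g x ≠ 0 :=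
  (map_ne_zero_iff (S.action g) (EquivLike.injective _)).2 hx

theorem smul_mul_smul (c d : ℂ) (x y : S.Alg) : (c • x) * (d • y) = (c * d) • (x * y) :=
  smul_mul_smul_comm _ _ _ _

theorem mul_smul (c : ℂ) (x y : S.Alg) : x * (c • y) = c • (x * y) := mul_smul_comm _ _ _

theorem smul_smul (c d : ℂ) (x : S.Alg) : c • (d • x) = (c * d) • x := _root_.smul_smul _ _ _

theorem one_smul (x : S.Alg) : (1 : ℂ) • x = x := _root_.one_smul _ _

/-- The equivariant isomorphisms of von Neumann algebras. -/
structure Iso (S : VNSystem G E) (T : VNSystem G E') where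
  toEquiv : S.Alg ≃⋆ₐ[ℂ] T.Alg
  equivariant : ∀ g x, toEquiv (S.action g x) = T.action g (toEquiv x)

namespace Iso

/-- The map underlying an equivariant isomorphism. -/
def map (θ : Iso S T) (x : S.Alg) : T.Alg := θ.toEquiv x

theorem map_action (θ : Iso S T) (g : G) (x : S.Alg) : θ.map (S.action g x) = T.action g (θ.map x) :=
  θ.equivariant g x

theorem map_mul (θ : Iso S T) (x y : S.Alg) : θ.map (x * y) = θ.map x * θ.map y :=
  _root_.map_mul θ.toEquiv _ _

theorem map_smul (θ : Iso S T) (c : ℂ) (x : S.Alg) : θ.map (c • x) = c • θ.map x :=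
  _root_.map_smul θ.toEquiv _ _

theorem map_one (θ : Iso S T) : θ.map 1 = 1 := _root_.map_one θ.toEquiv

theorem map_ne_zero (θ : Iso S T) {x : S.Alg} (hx : x ≠ 0) : θ.map x ≠ 0 :=
  (map_ne_zero_iff θ.toEquiv (EquivLike.injective _)).2 hx

theorem map_injective (θ : Iso S T) : Function.Injective θ.map := EquivLike.injective θ.toEquiv

theorem ext {α β : Iso S T} (h : ∀ x, α.map x = β.map x) : α = β := by
  cases α
  cases β
  congr
  exact StarAlgEquiv.ext h

theorem map_eq_of_smul {α β : Iso S T} {c : ℂ} (hc : c ≠ 0) {x : S.Alg}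
    (h : α.map (c • x) = β.map (c • x)) : α.map x = β.map x := by
  rw [map_smul, map_smul] at h
  rw [← one_smul (α.map x), ← one_smul (β.map x), ← inv_mul_cancel₀ hc, ← smul_smul, h, smul_smul]

/-- The composition of equivariant isomorphisms of a system with itself. -/
def comp (α β : Iso S S) : Iso S S where
  toEquiv := β.toEquiv.trans α.toEquiv
  equivariant g x := by
    change α.map (β.map _) = S.action g (α.map (β.map x))
    rw [map_action, map_action]

theorem comp_map (α β : Iso S S) (x : S.Alg) : (α.comp β).map x = α.map (β.map x) := rfl

/-- The equivariant automorphisms form the centralizer. -/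
def equivCentralizer : Iso S S ≃ S.centralizer where
  toFun α := ⟨α.toEquiv, mem_centralizer.2 fun g x => (α.equivariant g x).symm⟩
  invFun α := ⟨α.1, fun g x => (mem_centralizer.1 α.2 g x).symm⟩
  left_inv _ := rfl
  right_inv _ := rfl

end Iso

/-- The equivariant isomorphism given by a spatial isomorphism. -/
def SpatialIso.iso (I : SpatialIso S T) : Iso S T := ⟨I.equiv, I.equiv_action⟩

end VNSystem

/-! ### The homomorphism H → H' induced by an equivariant isomorphism. -/

section EquivariantIsomorphisms
variable {H : Type*} [AddCommGroup H] {μ : Cocycle H} {χ : AddChar H Circle}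
variable {H' : Type*} [AddCommGroup H'] {μ' : Cocycle H'} {χ' : AddChar H' Circle}

theorem coeff_smul (c : ℂ) (x : (twistedBernoulliShift μ χ).Alg) (l : Lam H) :
    coeff (c • x) l = c * coeff x l := rfl

theorem coeff_bernoulliElem (l l' : Lam H) :
    coeff (bernoulliElem μ χ l) l' = (delta l : L2 (Lam H)) l' := by
  change twistedOp μ.tilde l (delta 0) l' = _
  rw [twistedOp_delta, Cocycle.zero_right, add_zero, Circle.coe_one, one_smul]

theorem smul_bernoulliElem_inj {c c' : ℂ} (hc : c ≠ 0) {l l' : Lam H}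
    (h : c • bernoulliElem μ χ l = c' • bernoulliElem μ χ l') : l = l' ∧ c = c' := by
  have h1 : c * (delta l : L2 (Lam H)) l = c' * (delta l' : L2 (Lam H)) l := by
    rw [← coeff_bernoulliElem (μ := μ) (χ := χ), ← coeff_bernoulliElem (μ := μ) (χ := χ),
      ← coeff_smul, ← coeff_smul, h]
  rw [delta_apply_self, mul_one] at h1
  by_cases hl : l = l'
  · subst hl
    rw [delta_apply_self, mul_one] at h1
    exact ⟨rfl, h1⟩
  · rw [delta_apply_ne hl, mul_zero] at h1
    exact absurd h1 hc

theorem bernoulliElem_ne_zero (l : Lam H) : bernoulliElem μ χ l ≠ 0 := fun h => by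
  have := (smul_bernoulliElem_inj (μ := μ) (χ := χ) one_ne_zero (c' := 0) (l := l) (l' := l)
    (by rw [h, smul_zero, smul_zero])).2
  exact one_ne_zero this

theorem e₁_ne_zero : (0 : Z2) ≠ e₁ := fun h => by
  have := congrFun h 0
  simp [e₁] at this

theorem Lam.pair_injective {k l : Z2} (hkl : k ≠ l) :
    Function.Injective (Lam.pair (H := H) k l) := fun h h' hh => by
  rw [← Lam.pair_left hkl h, hh, Lam.pair_left hkl]

/-- The generator `u(h δ₀ - h δ_{e₁})`. -/
def bernoulliGen (μ : Cocycle H) (χ : AddChar H Circle) (h : H) :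
    (twistedBernoulliShift μ χ).Alg := bernoulliElem μ χ (Lam.pair 0 e₁ h)

theorem bernoulliGen_mul (h h' : H) :
    bernoulliGen μ χ h * bernoulliGen μ χ h' =
      ((μ h h' * μ (-h) (-h') : Circle) : ℂ) • bernoulliGen μ χ (h + h') := by
  rw [bernoulliGen, bernoulliGen, bernoulliElem_mul, μ.tilde_pair_right _ e₁_ne_zero,
    Lam.pair_left e₁_ne_zero, Lam.pair_right e₁_ne_zero, ← map_add]
  rfl

/-- The image of `e₁` under the matrix is its first column (a, c), so the exponent is det(k, 0) -
det(k, (a, c)). -/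
theorem action_affineMk_bernoulliGen (k : Z2) (a b c d : ℤ) (hd : a * d - b * c = 1) (h : H) :
    (twistedBernoulliShift μ χ).action (affineMk k a b c d hd) (bernoulliGen μ χ h) =
      ((χ h ^ (-(k 0 * c - k 1 * a)) : Circle) : ℂ) •
        bernoulliElem μ χ (Lam.pair k (![k 0 + a, k 1 + c]) h) := by
  rw [bernoulliGen, action_bernoulliElem, phase_pair _ _ e₁_ne_zero, Lam.act_pair,
    affineAct_affineMk, affineAct_affineMk]
  have h1 : det (affineMk k a b c d hd).left.toAdd ((affineMk k a b c d hd).right.1.mulVec 0) = 0 := by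
    simp [det]
  have h2 : det (affineMk k a b c d hd).left.toAdd ((affineMk k a b c d hd).right.1.mulVec e₁) =
      k 0 * c - k 1 * a := by
    simp [det, affineMk, e₁]
  have h3 : (![k 0 + (a * (0 : Z2) 0 + b * (0 : Z2) 1), k 1 + (c * (0 : Z2) 0 + d * (0 : Z2) 1)] :
      Z2) = k := by
    funext i
    fin_cases i <;> simp
  have h4 : (![k 0 + (a * e₁ 0 + b * e₁ 1), k 1 + (c * e₁ 0 + d * e₁ 1)] : Z2) =
      ![k 0 + a, k 1 + c] := by
    simp [e₁]
  rw [h1, h2, h3, h4, zero_sub]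

/-- The two edges share only the vertex `j`, where their values are `-h` and `h`; every other
cocycle factor is 1. -/
theorem bernoulliElem_triangle {i j k : Z2} (hij : i ≠ j) (hjk : j ≠ k) (hik : i ≠ k) (h : H) :
    bernoulliElem μ χ (Lam.pair i j h) * bernoulliElem μ χ (Lam.pair j k h) =
      (μ (-h) h : ℂ) • bernoulliElem μ χ (Lam.pair i k h) := by
  rw [bernoulliElem_mul, μ.tilde_pair_right _ hjk, Lam.pair_right hij,
    Lam.pair_of_ne hik.symm hjk.symm, μ.zero_left, mul_one, Lam.pair_add_pair]

/-- The element of `ℤ² ⋊ SL(2, ℤ)` which maps the edge `(0, e₁)` to `(e₁, e₁ + e₂)`. -/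
def edgeRight : AffineGroup := affineMk e₁ 0 (-1) 1 0 (by ring)
/-- The element of `SL(2, ℤ)` which maps the edge `(0, e₁)` to `(0, e₁ + e₂)`. -/
def edgeDiag : AffineGroup := affineMk 0 1 0 1 1 (by ring)
/-- The element of `SL(2, ℤ)` which maps the edge `(0, e₁)` to `(0, e₂)`. -/
def edgeLeft : AffineGroup := affineMk 0 0 (-1) 1 0 (by ring)
/-- The translation which maps the edge `(0, e₁)` to `(e₂, e₁ + e₂)`. -/
def edgeTop : AffineGroup := affineMk e₂ 1 0 0 1 (by ring)

theorem action_edgeRight (h : H) :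
    (twistedBernoulliShift μ χ).action edgeRight (bernoulliGen μ χ h) =
      (((χ h)⁻¹ : Circle) : ℂ) • bernoulliElem μ χ (Lam.pair e₁ ![1, 1] h) := by
  rw [edgeRight, action_affineMk_bernoulliGen]
  simp [e₁]

theorem action_edgeDiag (h : H) :
    (twistedBernoulliShift μ χ).action edgeDiag (bernoulliGen μ χ h) =
      bernoulliElem μ χ (Lam.pair 0 ![1, 1] h) := by
  rw [edgeDiag, action_affineMk_bernoulliGen]
  simp

theorem action_edgeLeft (h : H) :
    (twistedBernoulliShift μ χ).action edgeLeft (bernoulliGen μ χ h) =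
      bernoulliElem μ χ (Lam.pair 0 e₂ h) := by
  rw [edgeLeft, action_affineMk_bernoulliGen]
  simp [e₂]

theorem action_edgeTop (h : H) :
    (twistedBernoulliShift μ χ).action edgeTop (bernoulliGen μ χ h) =
      (χ h : ℂ) • bernoulliElem μ χ (Lam.pair e₂ ![1, 1] h) := by
  rw [edgeTop, action_affineMk_bernoulliGen]
  simp [e₂]

theorem Z2_ne {k l : Z2} (i : Fin 2) (h : k i ≠ l i) : k ≠ l := fun hkl => h (congrFun hkl i)

theorem bernoulliGen_lower_triangle (h : H) :
    bernoulliGen μ χ h * (twistedBernoulliShift μ χ).action edgeRight (bernoulliGen μ χ h) =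
      (((χ h)⁻¹ * μ (-h) h : Circle) : ℂ) •
        (twistedBernoulliShift μ χ).action edgeDiag (bernoulliGen μ χ h) := by
  rw [action_edgeRight, action_edgeDiag, VNSystem.mul_smul, bernoulliGen,
    bernoulliElem_triangle e₁_ne_zero (Z2_ne 1 (by simp [e₁])) (Z2_ne 1 (by simp)), VNSystem.smul_smul,
    Circle.coe_mul]

/-- Going round the unit square by e₂ instead of e₁ reaches the same diagonal, but with χ(h) in
place of its inverse; the comparison isolates χ(h)². -/
theorem bernoulliGen_upper_triangle (h : H) :
    (twistedBernoulliShift μ χ).action edgeLeft (bernoulliGen μ χ h) *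
        (twistedBernoulliShift μ χ).action edgeTop (bernoulliGen μ χ h) =
      ((χ h * μ (-h) h : Circle) : ℂ) •
        (twistedBernoulliShift μ χ).action edgeDiag (bernoulliGen μ χ h) := by
  simp only [action_edgeLeft, action_edgeTop, action_edgeDiag, VNSystem.mul_smul,
    bernoulliElem_triangle (Z2_ne (k := 0) (l := e₂) 1 (by simp [e₂]))
      (Z2_ne (l := ![1, 1]) 0 (by simp [e₂])) (Z2_ne 1 (by simp)),
    VNSystem.smul_smul, Circle.coe_mul]

theorem action_shear_bernoulliGen (n : ℤ) (h : H) :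
    (twistedBernoulliShift μ χ).action (affineMk 0 1 n 0 1 (by ring)) (bernoulliGen μ χ h) =
      bernoulliGen μ χ h := by
  rw [action_affineMk_bernoulliGen, bernoulliGen]
  simp [e₁]

variable (θ : VNSystem.Iso (twistedBernoulliShift μ χ) (twistedBernoulliShift μ' χ'))

/-- An equivariant isomorphism maps generators to multiples of generators. -/
theorem exists_map_bernoulliGen (h : H) :
    ∃ p : H' × ℂ, p.2 ≠ 0 ∧ θ.map (bernoulliGen μ χ h) = p.2 • bernoulliGen μ' χ' p.1 := by
  have hx : ∀ l, coeff (θ.map (bernoulliGen μ χ h)) l ≠ 0 → ∀ m, l.1 m ≠ 0 → m 1 = 0 := fun l hl m hm =>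
    coeff_eq_zero_of_fixed (fun n => by rw [← θ.map_action, action_shear_bernoulliGen]) hl hm
  have hg : bernoulliGen μ χ h ≠ 0 := bernoulliElem_ne_zero _
  -- The support of the image lies on ℤ × 0, which `edgeRight` carries to 1 × ℤ and `edgeDiag` to
  -- the diagonal; the triangle relation is preserved by θ.
  obtain ⟨a, c, hc⟩ := exists_eq_smul_pair (x := θ.map (bernoulliGen μ χ h))
    (y := (twistedBernoulliShift μ' χ').action edgeRight (θ.map (bernoulliGen μ χ h)))
    (z := (twistedBernoulliShift μ' χ').action edgeDiag (θ.map (bernoulliGen μ χ h)))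
    (c := (((χ h)⁻¹ * μ (-h) h : Circle) : ℂ)) hx
    (fun l hl m hm => by
      obtain ⟨l', hl', m', hm', rfl⟩ := coeff_action_ne_zero hl hm
      rw [edgeRight, affineAct_affineMk, hx l' hl' m' hm']
      simp [e₁])
    (fun l hl m hm => by
      obtain ⟨l', hl', m', hm', rfl⟩ := coeff_action_ne_zero hl hm
      rw [edgeDiag, affineAct_affineMk, hx l' hl' m' hm']
      simp)
    (by simp only [← θ.map_action, ← θ.map_mul, bernoulliGen_lower_triangle, θ.map_smul])
    (by
      rw [← θ.map_action]
      exact θ.map_ne_zero (VNSystem.action_ne_zero _ hg))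
  refine ⟨(a, c), fun h0 => θ.map_ne_zero hg ?_, hc⟩
  rw [hc, show c = 0 from h0, zero_smul]

/-- The homomorphism `H → H'` and the scalars determined by an equivariant isomorphism. -/
theorem exists_addMonoidHom_of_iso :
    ∃ (f : H →+ H') (c : H → ℂ), Function.Injective f ∧
      (∀ h, θ.map (bernoulliGen μ χ h) = c h • bernoulliGen μ' χ' (f h)) ∧
      (∀ h, χ' (f h) ^ 2 = χ h ^ 2) ∧
      (∀ h, c h * (χ' (f h) * μ' (-f h) (f h) : Circle) = (χ h * μ (-h) h : Circle)) ∧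
      ∀ h h', c h * c h' * (μ' (f h) (f h') * μ' (-f h) (-f h') : Circle) =
        (μ h h' * μ (-h) (-h') : Circle) * c (h + h') := by
  choose p hp0 hp using exists_map_bernoulliGen θ
  have hmul : ∀ h h', (p (h + h')).1 = (p h).1 + (p h').1 ∧
      (μ h h' * μ (-h) (-h') : Circle) * (p (h + h')).2 =
      (p h).2 * (p h').2 * (μ' (p h).1 (p h').1 * μ' (-(p h).1) (-(p h').1) : Circle) := by
    intro h h'
    have h1 := (θ.map_mul _ _).symm.trans <| congrArg θ.map (bernoulliGen_mul (μ := μ) (χ := χ) h h')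
    simp only [θ.map_smul, hp, VNSystem.smul_mul_smul, bernoulliGen_mul,
      VNSystem.smul_smul] at h1
    have h2 := smul_bernoulliElem_inj
      (by exact mul_ne_zero (mul_ne_zero (hp0 h) (hp0 h')) (Circle.coe_ne_zero _)) h1
    exact ⟨(Lam.pair_injective e₁_ne_zero h2.1).symm, h2.2.symm⟩
  have hlow : ∀ h, (p h).2 * ((χ' (p h).1)⁻¹ * μ' (-(p h).1) (p h).1 : Circle) =
      ((χ h)⁻¹ * μ (-h) h : Circle) := by
    intro h
    have h1 := (θ.map_mul _ _).symm.trans <| congrArg θ.map (bernoulliGen_lower_triangle (μ := μ) (χ := χ) h)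
    simp only [θ.map_smul, θ.map_action, hp] at h1
    simp only [VNSystem.action_smul, VNSystem.smul_mul_smul, bernoulliGen_lower_triangle, action_edgeDiag,
      VNSystem.smul_smul] at h1
    have h2 := (smul_bernoulliElem_inj
      (by exact mul_ne_zero (mul_ne_zero (hp0 h) (hp0 h)) (Circle.coe_ne_zero _)) h1).2
    refine mul_right_cancel₀ (hp0 h) ?_
    rw [← h2]
    ring
  have hupp : ∀ h, (p h).2 * (χ' (p h).1 * μ' (-(p h).1) (p h).1 : Circle) =
      (χ h * μ (-h) h : Circle) := by
    intro h
    have h1 := (θ.map_mul _ _).symm.trans <| congrArg θ.map (bernoulliGen_upper_triangle (μ := μ) (χ := χ) h)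
    simp only [θ.map_smul, θ.map_action, hp] at h1
    simp only [VNSystem.action_smul, VNSystem.smul_mul_smul, bernoulliGen_upper_triangle, action_edgeDiag,
      VNSystem.smul_smul] at h1
    have h2 := (smul_bernoulliElem_inj
      (by exact mul_ne_zero (mul_ne_zero (hp0 h) (hp0 h)) (Circle.coe_ne_zero _)) h1).2
    refine mul_right_cancel₀ (hp0 h) ?_
    rw [← h2]
    ring
  refine ⟨AddMonoidHom.mk' (fun h => (p h).1) fun h h' => (hmul h h').1, fun h => (p h).2, ?_, hp,
    fun h => ?_, hupp, fun h h' => (hmul h h').2.symm⟩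
  · rw [injective_iff_map_eq_zero]
    intro h hh
    have h0 : bernoulliGen μ' χ' 0 = 1 := by
      refine Subtype.ext ?_
      change twistedOp μ'.tilde (Lam.pair 0 e₁ 0) = 1
      rw [map_zero, twistedOp_zero]
    have h0' : bernoulliElem μ χ 0 = 1 := Subtype.ext (twistedOp_zero _)
    have h1 := hp h
    rw [show (p h).1 = 0 from hh, h0] at h1
    have h2 : (1 : ℂ) • bernoulliGen μ χ h = (p h).2 • bernoulliElem μ χ 0 := by
      refine θ.map_injective ?_
      rw [θ.map_smul, θ.map_smul, h1, h0', θ.map_one, one_smul]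
    have h3 := (smul_bernoulliElem_inj one_ne_zero h2).1
    rw [← map_zero (Lam.pair (H := H) 0 e₁)] at h3
    exact Lam.pair_injective e₁_ne_zero h3
  · have hl := hlow h
    have hu := hupp h
    change χ' (p h).1 ^ 2 = χ h ^ 2
    refine Circle.ext ?_
    have n1 := Circle.coe_ne_zero (χ' (p h).1)
    have n2 := Circle.coe_ne_zero (χ h)
    have n3 := Circle.coe_ne_zero (μ' (-(p h).1) (p h).1)
    have n4 := Circle.coe_ne_zero (μ (-h) h)
    push_cast at hl hu ⊢
    field_simp at hl
    refine mul_left_cancel₀ (mul_ne_zero (hp0 h) n3) ?_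
    linear_combination (χ' (p h).1 : ℂ) * hu - (χ h : ℂ) * hl
end EquivariantIsomorphisms

/-! ### Torsion recovers the set Q. -/

section Rigidity
variable {Q Q' : Set OddPrime}

theorem nsmul_hgroup (q : ℕ) (x : HGroup q) : q • x = 0 := Prod.ext (by simp) (by simp)

theorem eq_zero_of_nsmul_eq_zero {q q' : OddPrime} (h : q ≠ q') {x : HGroup q'.1}
    (hx : q.1 • x = 0) : x = 0 := by
  have hc : Nat.Coprime q.1 q'.1 :=
    (Nat.coprime_primes q.2.1 q'.2.1).2 fun he => h (Subtype.ext he)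
  have h1 := addOrderOf_dvd_of_nsmul_eq_zero hx
  have h2 := addOrderOf_dvd_of_nsmul_eq_zero (nsmul_hgroup q'.1 x)
  have h3 := Nat.dvd_gcd h1 h2
  rw [hc.gcd_eq_one, Nat.dvd_one, AddMonoid.addOrderOf_eq_one_iff] at h3
  exact h3

/-- A nonzero element of order q would have to map to q-torsion, and H_{Q'} has none when q ∉ Q'. -/
theorem subset_of_injective (f : HSum Q →+ HSum Q') (hf : Function.Injective f) : Q ⊆ Q' := by
  intro q hq
  by_contra hq'
  have : Fact (1 < q.1) := ⟨q.2.1.one_lt⟩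
  set x : HSum Q := DFinsupp.singleAddHom (fun q : Q => HGroup q.1.1) ⟨q, hq⟩ (1, 0) with hx
  have h1 : q.1 • x = 0 := by
    rw [hx, ← map_nsmul, nsmul_hgroup, map_zero]
  have h2 : f x = 0 := by
    refine DFinsupp.ext fun q' => ?_
    refine eq_zero_of_nsmul_eq_zero (q := q) (fun h => hq' (h ▸ q'.2)) ?_
    change q.1 • HSum.component Q' q' (f x) = 0
    rw [← map_nsmul, ← map_nsmul, h1, map_zero, map_zero]
  have h3 : x = 0 := hf (h2.trans (map_zero f).symm)
  have h4 := component_single Q ⟨q, hq⟩ (1, 0)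
  rw [← hx, h3, map_zero] at h4
  exact zero_ne_one (congrArg Prod.fst h4)

theorem subset_of_conjugate (h : (twistedBernoulliShift (muSum Q) (chiSum Q)).Conjugate
    (twistedBernoulliShift (muSum Q') (chiSum Q'))) : Q ⊆ Q' := by
  obtain ⟨θ, hθ⟩ := h
  obtain ⟨f, -, hf, -⟩ := exists_addMonoidHom_of_iso ⟨θ, hθ⟩
  exact subset_of_injective f hf

theorem eq_of_conjugate_betaTensor (h : (betaTensor Q).Conjugate (betaTensor Q')) : Q = Q' := by
  obtain ⟨I⟩ := nonempty_spatialIso_betaTensor Q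
  obtain ⟨I'⟩ := nonempty_spatialIso_betaTensor Q'
  have h1 := (I.conjugate.symm.trans h).trans I'.conjugate
  exact (subset_of_conjugate h1).antisymm (subset_of_conjugate h1.symm)

end Rigidity

/-! ### Monomial unitaries normalizing a twisted group algebra. -/

section MonomialAutomorphisms
variable {Γ : Type*} [AddCommGroup Γ] {ν : Cocycle Γ}

/-- A monomial unitary whose permutation is an automorphism under which the cocycle changes by the
coboundary of the coefficients normalizes the generators of the twisted group algebra. -/
theorem conj_monomial_twistedOp {σ : Γ ≃+ Γ} {K : Γ → Circle}
    (hK : ∀ γ γ', K γ * K γ' * ν (σ γ) (σ γ') = K (γ + γ') * ν γ γ') (γ : Γ) :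
    (monomial σ.toEquiv K).conjStarAlgEquiv (twistedOp ν γ) = (K γ : ℂ) • twistedOp ν (σ γ) := by
  refine clm_ext_delta fun γ' => ?_
  obtain ⟨γ', rfl⟩ := σ.surjective γ'
  have h1 : (monomial σ.toEquiv K).symm (delta (σ γ')) = (((K γ')⁻¹ : Circle) : ℂ) • delta γ' := by
    rw [LinearIsometryEquiv.symm_apply_eq, map_smul, monomial_delta, smul_smul, ← Circle.coe_mul,
      inv_mul_cancel, Circle.coe_one, one_smul]
    rfl
  rw [LinearIsometryEquiv.conjStarAlgEquiv_apply_apply, h1, map_smul, map_smul, twistedOp_delta,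
    map_smul, monomial_delta, smul_apply, twistedOp_delta, smul_smul, smul_smul,
    smul_smul, ← map_add]
  change _ • delta (σ (γ + γ')) = _
  have h2 : (K γ')⁻¹ * ν γ γ' * K (γ + γ') = K γ * ν (σ γ) (σ γ') := by
    rw [mul_assoc, inv_mul_eq_iff_eq_mul, mul_comm (ν γ γ'), ← hK, mul_comm (K γ), mul_assoc]
  rw [← Circle.coe_mul, ← Circle.coe_mul, ← Circle.coe_mul, h2]

theorem conj_monomial_mem_iff {σ : Γ ≃+ Γ} {K : Γ → Circle}
    (hK : ∀ γ γ', K γ * K γ' * ν (σ γ) (σ γ') = K (γ + γ') * ν γ γ') (x : L2 Γ →L[ℂ] L2 Γ) :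
    (monomial σ.toEquiv K).conjStarAlgEquiv x ∈ twistedGroupVN ν ↔ x ∈ twistedGroupVN ν := by
  set V := monomial σ.toEquiv K with hV
  refine ⟨fun hx => ?_, fun hx => conj_mem_vonNeumannClosure _ ?_ hx⟩
  · have h1 : V.symm.conjStarAlgEquiv (V.conjStarAlgEquiv x) ∈ twistedGroupVN ν := by
      refine conj_mem_vonNeumannClosure _ ?_ hx
      rintro _ ⟨γ, rfl⟩
      obtain ⟨γ, rfl⟩ := σ.surjective γ
      have h2 : twistedOp ν (σ γ) =
          V.conjStarAlgEquiv ((((K γ)⁻¹ : Circle) : ℂ) • twistedOp ν γ) := by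
        rw [map_smul, hV, conj_monomial_twistedOp hK, smul_smul, ← Circle.coe_mul, inv_mul_cancel,
          Circle.coe_one, one_smul]
      rw [h2, ← LinearIsometryEquiv.symm_conjStarAlgEquiv, StarAlgEquiv.symm_apply_apply]
      exact SMulMemClass.smul_mem (s := (twistedGroupVN ν).toStarSubalgebra) _ (twistedOp_mem ν γ)
    rwa [← LinearIsometryEquiv.symm_conjStarAlgEquiv, StarAlgEquiv.symm_apply_apply] at h1
  · rintro _ ⟨γ, rfl⟩
    rw [conj_monomial_twistedOp hK]
    exact SMulMemClass.smul_mem (s := (twistedGroupVN ν).toStarSubalgebra) _ (twistedOp_mem ν _)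

end MonomialAutomorphisms

/-! ### Automorphisms of a twisted Bernoulli shift and their uniqueness. -/

section BernoulliAutomorphisms
variable {H : Type*} [AddCommGroup H]

theorem Lam.map_add_equiv_left (f : H ≃+ H) (l : Lam H) :
    Lam.map f.symm.toAddMonoidHom (Lam.map f.toAddMonoidHom l) = l := Lam.ext fun k => by
  rw [Lam.map_val, Lam.map_val]
  exact f.symm_apply_apply _

/-- The automorphism of `Λ(H)` given by an automorphism of `H`. -/
def Lam.congr (f : H ≃+ H) : Lam H ≃+ Lam H where
  toFun := Lam.map f.toAddMonoidHom
  invFun := Lam.map f.symm.toAddMonoidHom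
  left_inv := Lam.map_add_equiv_left f
  right_inv := Lam.map_add_equiv_left f.symm
  map_add' := map_add _

theorem Lam.congr_val (f : H ≃+ H) (l : Lam H) (k : Z2) : (Lam.congr f l).1 k = f (l.1 k) :=
  Lam.map_val _ _ _

theorem Lam.congr_act (f : H ≃+ H) (g : AffineGroup) (l : Lam H) :
    Lam.congr f (Lam.act g l) = Lam.act g (Lam.congr f l) := Lam.ext fun k => by
  rw [Lam.congr_val, Lam.act_apply, Lam.act_apply, Lam.congr_val]

theorem Lam.congr_pair (f : H ≃+ H) (k l : Z2) (h : H) :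
    Lam.congr f (Lam.pair k l h) = Lam.pair k l (f h) := Lam.map_pair _ _ _ _

theorem phase_congr {χ : AddChar H Circle} {f : H ≃+ H} (hf : ∀ h, χ (f h) = χ h) (g : AffineGroup)
    (l : Lam H) : phase χ g (Lam.congr f l) = phase χ g l := by
  rw [phase_eq, phase_eq]
  exact finprod_congr fun m => by rw [Lam.congr_val, hf]

/-- The function `λ ↦ ∏ₖ κ(λ(k))` on `Λ(H)`. -/
def prodCoeff (κ : H → Circle) (l : Lam H) : Circle := ∏ᶠ k, κ (l.1 k)

theorem finite_mulSupport_coeff {κ : H → Circle} (h0 : κ 0 = 1) (l : Lam H) :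
    (Function.mulSupport fun k => κ (l.1 k)).Finite :=
  l.1.hasFiniteSupport.subset fun m hm hl => hm (by simp only [hl, h0])

theorem prodCoeff_act (κ : H → Circle) (g : AffineGroup) (l : Lam H) :
    prodCoeff κ (Lam.act g l) = prodCoeff κ l :=
  finprod_eq_of_bijective _ (affineAct g).symm.bijective fun _ => rfl

theorem prodCoeff_mul {μ : Cocycle H} {f : H ≃+ H} {κ : H → Circle} (h0 : κ 0 = 1)
    (hκ : ∀ h h', κ h * κ h' * μ (f h) (f h') = κ (h + h') * μ h h') (l l' : Lam H) :
    prodCoeff κ l * prodCoeff κ l' * μ.tilde (Lam.congr f l) (Lam.congr f l') =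
      prodCoeff κ (l + l') * μ.tilde l l' := by
  have h1 : ∀ l l' : Lam H, (Function.mulSupport fun k => μ (l.1 k) (l'.1 k)).Finite := fun l l' =>
    Cocycle.finite_mulSupport_comp (fun _ : Z2 => μ) l.1.hasFiniteSupport
  rw [prodCoeff, prodCoeff, prodCoeff, Cocycle.tilde_apply, Cocycle.tilde_apply,
    ← finprod_mul_distrib (finite_mulSupport_coeff h0 l) (finite_mulSupport_coeff h0 l'),
    ← finprod_mul_distrib (((finite_mulSupport_coeff h0 l).union
      (finite_mulSupport_coeff h0 l')).subset (Function.mulSupport_mul _ _)) (h1 _ _),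
    ← finprod_mul_distrib (finite_mulSupport_coeff h0 _) (h1 _ _)]
  refine finprod_congr fun k => ?_
  rw [Lam.congr_val, Lam.congr_val, hκ]
  rfl

variable {μ : Cocycle H} {χ : AddChar H Circle}

/-- The automorphism of a twisted Bernoulli shift `u(λ) ↦ ∏ₖ κ(λ(k)) u(f ∘ λ)`, for an automorphism
`f` of `H` which preserves `χ`, and under which `μ` changes by the coboundary of `κ`. -/
def bernoulliAut (f : H ≃+ H) (κ : H → Circle) (h0 : κ 0 = 1) (hχ : ∀ h, χ (f h) = χ h)
    (hκ : ∀ h h', κ h * κ h' * μ (f h) (f h') = κ (h + h') * μ h h') :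
    VNSystem.SpatialIso (twistedBernoulliShift μ χ) (twistedBernoulliShift μ χ) where
  V := monomial (Lam.congr f).toEquiv (prodCoeff κ)
  conj_mem_iff := conj_monomial_mem_iff (prodCoeff_mul h0 hκ)
  map_Ω := by
    refine (monomial_delta _ _ _).trans ?_
    have h1 : prodCoeff κ (0 : Lam H) = 1 := finprod_eq_one_of_forall_eq_one fun k => h0
    rw [h1, Circle.coe_one, one_smul]
    exact congrArg delta (map_zero (Lam.congr f))
  map_U g v := by
    have key : ((monomial (Lam.congr f).toEquiv (prodCoeff κ) : L2 (Lam H) →L[ℂ] L2 (Lam H)).comp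
        (shiftUnitary χ g : L2 (Lam H) →L[ℂ] L2 (Lam H))) =
        (shiftUnitary χ g : L2 (Lam H) →L[ℂ] L2 (Lam H)).comp
          (monomial (Lam.congr f).toEquiv (prodCoeff κ) : L2 (Lam H) →L[ℂ] L2 (Lam H)) := by
      refine clm_ext_delta fun l => ?_
      change monomial _ _ (shiftUnitary χ g (delta l)) = shiftUnitary χ g (monomial _ _ (delta l))
      rw [shiftUnitary_delta, map_smul, monomial_delta, monomial_delta, map_smul]
      change _ • _ • delta (Lam.congr f (Lam.act g l)) =
        _ • shiftUnitary χ g (delta (Lam.congr f l))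
      rw [shiftUnitary_delta, Lam.congr_act, smul_smul, smul_smul, prodCoeff_act, phase_congr hχ,
        mul_comm]
    exact DFunLike.congr_fun key v

theorem bernoulliAut_iso_bernoulliElem (f : H ≃+ H) (κ : H → Circle) (h0 : κ 0 = 1)
    (hχ : ∀ h, χ (f h) = χ h)
    (hκ : ∀ h h', κ h * κ h' * μ (f h) (f h') = κ (h + h') * μ h h') (l : Lam H) :
    (bernoulliAut f κ h0 hχ hκ).iso.map (bernoulliElem μ χ l) =
      (prodCoeff κ l : ℂ) • bernoulliElem μ χ (Lam.congr f l) :=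
  Subtype.ext (conj_monomial_twistedOp (prodCoeff_mul h0 hκ) l)

/-- Applied to β⁻¹ α, the density theorem for fixed points replaces continuity, which is not assumed
of α and β. -/
theorem iso_ext_of_bernoulliElem
    {α β : VNSystem.Iso (twistedBernoulliShift μ χ) (twistedBernoulliShift μ χ)}
    (h : ∀ l, α.map (bernoulliElem μ χ l) = β.map (bernoulliElem μ χ l)) : α = β := by
  refine VNSystem.Iso.ext fun x => ?_
  have h1 := map_eq_self_of_twistedElem (μ := μ.tilde) (α.toEquiv.trans β.toEquiv.symm)
    (fun l => (congrArg β.toEquiv.symm (h l)).trans (β.toEquiv.symm_apply_apply _)) x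
  exact (β.toEquiv.apply_symm_apply _).symm.trans (congrArg β.toEquiv h1)

theorem Lam.eq_sum_pair (l : Lam H) : l = ∑ k ∈ l.1.support, Lam.pair k 0 (l.1 k) := by
  refine Subtype.ext ?_
  rw [AddSubgroup.val_finsetSum]
  simp only [Lam.pair_val]
  rw [Finset.sum_sub_distrib, ← Finsupp.single_finsetSum]
  have h1 : ∑ k ∈ l.1.support, l.1 k = 0 := l.2
  rw [h1, Finsupp.single_zero, sub_zero]
  exact l.1.sum_single.symm

/-- A zero-sum function is a sum of edges from its support points to 0, and each such edge is a sum
along a lattice path of unit horizontal and vertical edges, traversed in either direction. -/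
theorem Lam.induction_pair {P : Lam H → Prop} (hadd : ∀ l l', P l → P l' → P (l + l'))
    (hright : ∀ (k : Z2) (h : H), P (Lam.pair k (k + e₁) h))
    (hup : ∀ (k : Z2) (h : H), P (Lam.pair k (k + e₂) h)) (l : Lam H) : P l := by
  have htrans : ∀ i j k : Z2, (∀ h : H, P (Lam.pair i j h)) → (∀ h : H, P (Lam.pair j k h)) →
      ∀ h : H, P (Lam.pair i k h) := fun i j k hij hjk h => by
    rw [← Lam.pair_add_pair i j k]
    exact hadd _ _ (hij h) (hjk h)
  have hsymm : ∀ i j : Z2, (∀ h : H, P (Lam.pair i j h)) → ∀ h : H, P (Lam.pair j i h) :=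
    fun i j hij h => by
      rw [Lam.pair_swap, ← map_neg]
      exact hij (-h)
  have hzero : ∀ k : Z2, ∀ h : H, P (Lam.pair k k h) := fun k =>
    htrans _ _ _ (hright k) (hsymm _ _ (hright k))
  have hline : ∀ (k e : Z2), (∀ k : Z2, ∀ h : H, P (Lam.pair k (k + e) h)) → ∀ n : ℤ,
      ∀ h : H, P (Lam.pair (k + n • e) k h) := by
    intro k e he n
    induction n with
    | zero => simpa using hzero k
    | succ n ih =>
      have h1 := hsymm _ _ (he (k + (n : ℤ) • e))
      rw [add_assoc, ← add_one_zsmul] at h1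
      exact htrans _ _ _ h1 ih
    | pred n ih =>
      have h1 := he (k + (-(n : ℤ) - 1) • e)
      rw [add_assoc, ← add_one_zsmul, sub_add_cancel] at h1
      exact htrans _ _ _ h1 ih
  have hall : ∀ k : Z2, ∀ h : H, P (Lam.pair k 0 h) := fun k => by
    have h1 := hline (0 + k 0 • e₁) e₂ hup (k 1)
    have h2 := hline 0 e₁ hright (k 0)
    have e : k = 0 + k 0 • e₁ + k 1 • e₂ := by
      funext i
      fin_cases i <;> simp [e₁, e₂]
    have h3 := htrans _ _ _ h1 h2
    rwa [← e] at h3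
  rw [Lam.eq_sum_pair l]
  refine Finset.sum_induction _ P hadd ?_ fun k _ => hall k _
  simpa using hall 0 0

/-- Equivariant automorphisms which agree on the generators `u(h δ₀ - h δ_{e₁})` are equal. -/
theorem iso_ext_of_bernoulliGen
    {α β : VNSystem.Iso (twistedBernoulliShift μ χ) (twistedBernoulliShift μ χ)}
    (h : ∀ a, α.map (bernoulliGen μ χ a) = β.map (bernoulliGen μ χ a)) : α = β := by
  -- Every such edge is the image of (0, e₁) under the group, so equivariance transfers agreement
  -- from the generators, up to a nonzero phase.
  have hedge : ∀ (k : Z2) (a b c d : ℤ) (hd : a * d - b * c = 1) (x : H),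
      α.map (bernoulliElem μ χ (Lam.pair k (![k 0 + a, k 1 + c]) x)) =
        β.map (bernoulliElem μ χ (Lam.pair k (![k 0 + a, k 1 + c]) x)) := fun k a b c d hd x => by
    have e := action_affineMk_bernoulliGen (μ := μ) (χ := χ) k a b c d hd x
    refine VNSystem.Iso.map_eq_of_smul (Circle.coe_ne_zero (χ x ^ (-(k 0 * c - k 1 * a)))) ?_
    refine (congrArg α.map e).symm.trans (Eq.trans ?_ (congrArg β.map e))
    exact (α.map_action _ _).trans ((congrArg _ (h x)).trans (β.map_action _ _).symm)
  refine iso_ext_of_bernoulliElem fun l => ?_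
  refine Lam.induction_pair
    (P := fun l => α.map (bernoulliElem μ χ l) = β.map (bernoulliElem μ χ l))
    (fun l l' hl hl' => ?_) (fun k x => ?_) (fun k x => ?_) l
  · have e := bernoulliElem_mul (μ := μ) (χ := χ) l l'
    refine VNSystem.Iso.map_eq_of_smul (Circle.coe_ne_zero (μ.tilde l l')) ?_
    refine (congrArg α.map e).symm.trans (Eq.trans ?_ (congrArg β.map e))
    exact (α.map_mul _ _).trans ((congrArg₂ (· * ·) hl hl').trans (β.map_mul _ _).symm)
  · have h1 : k + e₁ = ![k 0 + 1, k 1 + 0] := by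
      funext i
      fin_cases i <;> simp [e₁]
    have h2 := hedge k 1 0 0 1 (by ring) x
    rwa [← h1] at h2
  · have h1 : k + e₂ = ![k 0 + 0, k 1 + 1] := by
      funext i
      fin_cases i <;> simp [e₂]
    have h2 := hedge k 0 (-1) 1 0 (by ring) x
    rwa [← h1] at h2

/-- Equivariant automorphisms which induce the same map on `H` are equal. -/
theorem iso_ext_of_map_bernoulliGen
    {α β : VNSystem.Iso (twistedBernoulliShift μ χ) (twistedBernoulliShift μ χ)} {f : H → H}
    (hα : ∀ h, ∃ c : ℂ, α.map (bernoulliGen μ χ h) = c • bernoulliGen μ χ (f h))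
    (hβ : ∀ h, ∃ c : ℂ, β.map (bernoulliGen μ χ h) = c • bernoulliGen μ χ (f h)) : α = β := by
  obtain ⟨f₁, c₁, -, h₁, -, hc₁, -⟩ := exists_addMonoidHom_of_iso α
  obtain ⟨f₂, c₂, -, h₂, -, hc₂, -⟩ := exists_addMonoidHom_of_iso β
  have hne : ∀ {c z : ℂ} {w : Circle}, c * z = w → c ≠ 0 := fun h h0 => by
    rw [h0, zero_mul] at h
    exact Circle.coe_ne_zero _ h.symm
  refine iso_ext_of_bernoulliGen fun h => ?_
  obtain ⟨c, hc⟩ := hα h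
  obtain ⟨c', hc'⟩ := hβ h
  have e₁ := Lam.pair_injective e₁_ne_zero
    (smul_bernoulliElem_inj (hne (hc₁ h)) ((h₁ h).symm.trans hc)).1
  have e₂ := Lam.pair_injective e₁_ne_zero
    (smul_bernoulliElem_inj (hne (hc₂ h)) ((h₂ h).symm.trans hc')).1
  -- The diagonal relation expresses the scalar at h through f(h) alone, so equal maps on H force
  -- equal scalars.
  have e₃ := hc₁ h
  rw [e₁, ← e₂, ← hc₂ h] at e₃
  rw [h₁, h₂, mul_right_cancel₀ (Circle.coe_ne_zero _) e₃, e₁, e₂]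

end BernoulliAutomorphisms

/-! ### Shears of H_Q and the automorphisms they give. -/

section Shears
variable {Q : Set OddPrime}

/-- The automorphism `(s, t) ↦ (s, t + a s)` of `(ℤ/qℤ)²`. -/
def HGroup.shear {q : ℕ} (a : ZMod q) : HGroup q ≃+ HGroup q where
  toFun x := (x.1, x.2 + a * x.1)
  invFun x := (x.1, x.2 - a * x.1)
  left_inv x := by simp
  right_inv x := by simp
  map_add' x y := Prod.ext rfl (by simp only [Prod.fst_add, Prod.snd_add]; ring)

/-- The automorphism `(s_q, t_q) ↦ (s_q, t_q + a_q s_q)` of `H_Q`. -/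
def HSum.shear (a : ∀ q : Q, ZMod q.1.1) : HSum Q ≃+ HSum Q :=
  DFinsupp.mapRange.addEquiv fun q => HGroup.shear (a q)

theorem HSum.component_shear (a : ∀ q : Q, ZMod q.1.1) (q : Q) (h : HSum Q) :
    HSum.component Q q (HSum.shear a h) = HGroup.shear (a q) (HSum.component Q q h) := rfl

theorem HSum.ext {h h' : HSum Q} (H : ∀ q, HSum.component Q q h = HSum.component Q q h') : h = h' :=
  DFinsupp.ext H

theorem HSum.shear_add (a b : ∀ q : Q, ZMod q.1.1) (h : HSum Q) :
    HSum.shear (a + b) h = HSum.shear a (HSum.shear b h) := HSum.ext fun q => by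
  rw [component_shear, component_shear, component_shear]
  refine Prod.ext rfl ?_
  set x := HSum.component Q q h
  change x.2 + (a q + b q) * x.1 = x.2 + b q * x.1 + a q * x.1
  ring

theorem chiSum_shear (a : ∀ q : Q, ZMod q.1.1) (h : HSum Q) :
    chiSum Q (HSum.shear a h) = chiSum Q h := rfl

/-- The scalar `∏ exp(2πi a_q s_q² / 2q)`, where the division by two takes place in `ℤ/qℤ`. -/
def shearCoeff (a : ∀ q : Q, ZMod q.1.1) (h : HSum Q) : Circle :=
  ∏ᶠ q : Q, ZMod.toCircle (a q * (HSum.component Q q h).1 ^ 2 * (((q.1.1 + 1) / 2 : ℕ) : ZMod q.1.1))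

theorem finite_mulSupport_shearCoeff (a : ∀ q : Q, ZMod q.1.1) (h : HSum Q) :
    (Function.mulSupport fun q : Q =>
      (ZMod.toCircle (a q * (HSum.component Q q h).1 ^ 2 * (((q.1.1 + 1) / 2 : ℕ) : ZMod q.1.1)) :
        Circle)).Finite :=
  (HSum.finite_component h).subset fun q hq h0 => hq (by simp [h0])

theorem shearCoeff_zero_right (a : ∀ q : Q, ZMod q.1.1) : shearCoeff a 0 = 1 :=
  finprod_eq_one_of_forall_eq_one fun q => by simp

theorem shearCoeff_add (a b : ∀ q : Q, ZMod q.1.1) (h : HSum Q) :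
    shearCoeff (a + b) h = shearCoeff b h * shearCoeff a (HSum.shear b h) := by
  -- The coefficient depends only on the first coordinates, which a shear leaves unchanged.
  change _ = shearCoeff b h * shearCoeff a h
  rw [shearCoeff, shearCoeff, shearCoeff, ← finprod_mul_distrib (finite_mulSupport_shearCoeff b h)
    (finite_mulSupport_shearCoeff a h)]
  refine finprod_congr fun q => ?_
  rw [← AddChar.map_add_eq_mul]
  congr 1
  change (a q + b q) * _ * _ = _
  ring

theorem two_mul_half {q : ℕ} (hq : Odd q) : (2 : ZMod q) * ((q + 1) / 2 : ℕ) = 1 := by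
  obtain ⟨k, rfl⟩ := hq
  have h1 : (2 * k + 1 + 1) / 2 = k + 1 := by omega
  have h2 : ((2 * k + 1 : ℕ) : ZMod (2 * k + 1)) = 0 := ZMod.natCast_self _
  rw [h1]
  push_cast at h2 ⊢
  linear_combination h2

/-- In each component a (s + s')²/2 - a s²/2 - a s'²/2 = a s s', which is the change of the exponent
s t' under the shear. Halving is possible because q is odd. -/
theorem shearCoeff_mul (a : ∀ q : Q, ZMod q.1.1) (h h' : HSum Q) :
    shearCoeff a h * shearCoeff a h' * muSum Q (HSum.shear a h) (HSum.shear a h') =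
      shearCoeff a (h + h') * muSum Q h h' := by
  have h1 : ∀ x y : HSum Q, (Function.mulSupport fun q : Q =>
      muCocycle q.1.1 (HSum.component Q q x) (HSum.component Q q y)).Finite := fun x _ =>
    Cocycle.finite_mulSupport_comp _ (HSum.finite_component x)
  rw [shearCoeff, shearCoeff, shearCoeff, muSum_apply, muSum_apply,
    ← finprod_mul_distrib (finite_mulSupport_shearCoeff a h) (finite_mulSupport_shearCoeff a h'),
    ← finprod_mul_distrib (((finite_mulSupport_shearCoeff a h).union
      (finite_mulSupport_shearCoeff a h')).subset (Function.mulSupport_mul _ _)) (h1 _ _),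
    ← finprod_mul_distrib (finite_mulSupport_shearCoeff a _) (h1 _ _)]
  refine finprod_congr fun q => ?_
  rw [muCocycle_eq, muCocycle_eq, ← AddChar.map_add_eq_mul, ← AddChar.map_add_eq_mul,
    ← AddChar.map_add_eq_mul, map_add (HSum.component Q q), Prod.fst_add, HSum.component_shear, HSum.component_shear]
  congr 1
  change _ + (HSum.component Q q h).1 *
    ((HSum.component Q q h').2 + a q * (HSum.component Q q h').1) = _
  linear_combination -(a q * (HSum.component Q q h).1 * (HSum.component Q q h').1) *
    two_mul_half q.1.2.2

/-- The automorphism of the twisted Bernoulli shift given by a shear of `H_Q`. -/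
def shearAut (a : ∀ q : Q, ZMod q.1.1) : VNSystem.SpatialIso
    (twistedBernoulliShift (muSum Q) (chiSum Q)) (twistedBernoulliShift (muSum Q) (chiSum Q)) :=
  bernoulliAut (HSum.shear a) (shearCoeff a) (shearCoeff_zero_right a) (chiSum_shear a)
    (shearCoeff_mul a)

theorem shearAut_bernoulliElem (a : ∀ q : Q, ZMod q.1.1) (l : Lam (HSum Q)) :
    (shearAut a).iso.map (bernoulliElem (muSum Q) (chiSum Q) l) =
      (prodCoeff (shearCoeff a) l : ℂ) •
        bernoulliElem (muSum Q) (chiSum Q) (Lam.congr (HSum.shear a) l) :=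
  bernoulliAut_iso_bernoulliElem _ _ _ _ _ l

theorem shearAut_bernoulliGen (a : ∀ q : Q, ZMod q.1.1) (h : HSum Q) :
    (shearAut a).iso.map (bernoulliGen (muSum Q) (chiSum Q) h) =
      (prodCoeff (shearCoeff a) (Lam.pair 0 e₁ h) : ℂ) •
        bernoulliGen (muSum Q) (chiSum Q) (HSum.shear a h) :=
  (shearAut_bernoulliElem _ _).trans (by rw [Lam.congr_pair]; rfl)

theorem prodCoeff_shearCoeff_add (a b : ∀ q : Q, ZMod q.1.1) (l : Lam (HSum Q)) :
    prodCoeff (shearCoeff (a + b)) l =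
      prodCoeff (shearCoeff b) l * prodCoeff (shearCoeff a) (Lam.congr (HSum.shear b) l) := by
  rw [prodCoeff, prodCoeff, prodCoeff, ← finprod_mul_distrib
    (finite_mulSupport_coeff (shearCoeff_zero_right b) _)
    (finite_mulSupport_coeff (shearCoeff_zero_right a) _)]
  exact finprod_congr fun k => shearCoeff_add _ _ _

theorem shearAut_iso_add (a b : ∀ q : Q, ZMod q.1.1) :
    (shearAut (a + b)).iso = (shearAut a).iso.comp (shearAut b).iso := by
  refine iso_ext_of_bernoulliElem fun l => ?_
  have h1 : Lam.congr (HSum.shear (a + b)) l =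
      Lam.congr (HSum.shear a) (Lam.congr (HSum.shear b) l) := Lam.ext fun k => by
    rw [Lam.congr_val, Lam.congr_val, Lam.congr_val, HSum.shear_add]
  set m := Lam.congr (HSum.shear b) l
  set c := prodCoeff (shearCoeff b) l
  have h2 : (shearAut a).iso.map ((shearAut b).iso.map (bernoulliElem (muSum Q) (chiSum Q) l)) =
      (c : ℂ) • (shearAut a).iso.map (bernoulliElem (muSum Q) (chiSum Q) m) :=
    (congrArg (shearAut a).iso.map (shearAut_bernoulliElem b l)).trans (VNSystem.Iso.map_smul _ _ _)
  have h3 : (c : ℂ) • (shearAut a).iso.map (bernoulliElem (muSum Q) (chiSum Q) m) =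
      (c : ℂ) • (prodCoeff (shearCoeff a) m : ℂ) •
        bernoulliElem (muSum Q) (chiSum Q) (Lam.congr (HSum.shear a) m) :=
    congrArg (fun x : (twistedBernoulliShift (muSum Q) (chiSum Q)).Alg => (c : ℂ) • x)
      (shearAut_bernoulliElem a m)
  have h4 := shearAut_bernoulliElem (a + b) l
  have h5 := prodCoeff_shearCoeff_add a b l
  rw [h5, h1, Circle.coe_mul, ← VNSystem.smul_smul] at h4
  exact h4.trans ((h2.trans h3).symm.trans (VNSystem.Iso.comp_map _ _ _).symm)

end Shears

/-! ### Every element of the centralizer is given by a shear. -/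

section Centralizer
variable {Q : Set OddPrime}

theorem eq_of_sq_eq_sq_of_odd {z w : Circle} {n : ℕ} (hn : Odd n) (h : z ^ 2 = w ^ 2)
    (hz : z ^ n = 1) (hw : w ^ n = 1) : z = w := by
  obtain ⟨k, rfl⟩ := hn
  rw [pow_succ, pow_mul] at hz hw
  rw [← h] at hw
  exact mul_left_cancel (hz.trans hw.symm)

theorem muSum_neg_left (x y : HSum Q) : muSum Q (-x) y = (muSum Q x y)⁻¹ := by
  rw [eq_inv_iff_mul_eq_one, ← muSum_add_left, neg_add_cancel, Cocycle.zero_left]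

theorem muSum_neg_neg (x y : HSum Q) : muSum Q (-x) (-y) = muSum Q x y := by
  have h1 : muSum Q (-x) (-y) * muSum Q (-x) y = 1 := by
    rw [← muSum_add_right, neg_add_cancel, Cocycle.zero_right]
  rw [muSum_neg_left x y] at h1
  rwa [mul_inv_eq_one] at h1

theorem toCircle_inj {q : ℕ} [NeZero q] {x y : ZMod q}
    (h : (ZMod.toCircle x : Circle) = ZMod.toCircle y) : x = y := ZMod.injective_toCircle h

/-- The endomorphisms of `H_Q` which preserve the character `χ_Q` and the commutator of `μ_Q` are
shears. -/
theorem exists_eq_shear (f : HSum Q →+ HSum Q) (hχ : ∀ h, chiSum Q (f h) = chiSum Q h)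
    (hμ : ∀ h h', muSum Q (f h) (f h') * muSum Q h' h = muSum Q h h' * muSum Q (f h') (f h)) :
    ∃ a : ∀ q : Q, ZMod q.1.1, ∀ h, f h = HSum.shear a h := by
  set s : ∀ q : Q, HGroup q.1.1 →+ HSum Q :=
    fun q => DFinsupp.singleAddHom (fun q : Q => HGroup q.1.1) q with hs
  -- Torsion again: the image of a q-torsion element has no component at another prime.
  have hf : ∀ (q : Q) (y : HGroup q.1.1), f (s q y) = s q (HSum.component Q q (f (s q y))) := by
    intro q y
    refine HSum.ext fun q' => ?_
    by_cases hq : q' = q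
    · subst hq
      exact (component_single Q _ _).symm
    · rw [hs, component_single_ne Q hq]
      refine eq_zero_of_nsmul_eq_zero (q := q.1) (q' := q'.1)
        (fun h => hq (Subtype.ext h.symm)) ?_
      rw [← map_nsmul, ← map_nsmul, ← map_nsmul, nsmul_hgroup, map_zero, map_zero, map_zero]
  have hfst : ∀ (q : Q) (y : HGroup q.1.1), (HSum.component Q q (f (s q y))).1 = y.1 := by
    intro q y
    have h1 := hχ (s q y)
    rw [hf, hs, chiSum_single, chiSum_single] at h1
    exact toCircle_inj h1
  -- Pairing with (1, 0), whose image is (1, a), under the preserved form s t' - s' t determines the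
  -- second coordinate as t + a s.
  have hsnd : ∀ (q : Q) (y : HGroup q.1.1), (HSum.component Q q (f (s q y))).2 =
      y.2 + (HSum.component Q q (f (s q (1, 0)))).2 * y.1 := by
    intro q y
    have h1 := hμ (s q (1, 0)) (s q y)
    rw [hf q (1, 0), hf q y] at h1
    set u := HSum.component Q q (f (s q (1, 0))) with hu
    set v := HSum.component Q q (f (s q y)) with hv
    have hu1 : u.1 = 1 := hfst q (1, 0)
    have hv1 : v.1 = y.1 := hfst q y
    rw [hs, muSum_single_right, muSum_single_right, muSum_single_right, muSum_single_right,
      component_single, component_single, component_single, component_single,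
      muCocycle_eq, muCocycle_eq, muCocycle_eq, muCocycle_eq, ← AddChar.map_add_eq_mul,
      ← AddChar.map_add_eq_mul] at h1
    have h2 := toCircle_inj h1
    rw [hu1, hv1] at h2
    linear_combination h2
  refine ⟨fun q => (HSum.component Q q (f (s q (1, 0)))).2, fun h => ?_⟩
  refine (hsum_decomposition Q).induction (P := fun h => f h = HSum.shear _ h) ?_ ?_ ?_ h
  · rw [map_zero, map_zero]
  · intro x y hx hy
    rw [map_add, map_add, hx, hy]
  · intro q y
    change f (s q y) = _
    rw [hf]
    refine HSum.ext fun q' => ?_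
    rw [HSum.component_shear]
    by_cases hq : q' = q
    · subst hq
      rw [hs, component_single, component_single]
      exact Prod.ext (hfst _ y) (hsnd _ y)
    · rw [hs, component_single_ne Q hq, component_single_ne Q hq, map_zero]

theorem exists_eq_shear_of_relations {f : HSum Q →+ HSum Q} {c : HSum Q → ℂ}
    (hχ2 : ∀ h, chiSum Q (f h) ^ 2 = chiSum Q h ^ 2)
    (hc : ∀ h, c h * (chiSum Q (f h) * muSum Q (-f h) (f h) : Circle) =
      (chiSum Q h * muSum Q (-h) h : Circle))
    (hmul : ∀ h h', c h * c h' * (muSum Q (f h) (f h') * muSum Q (-f h) (-f h') : Circle) =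
      (muSum Q h h' * muSum Q (-h) (-h') : Circle) * c (h + h')) :
    ∃ a : ∀ q : Q, ZMod q.1.1, ∀ h, f h = HSum.shear a h := by
  have hχ : ∀ h, chiSum Q (f h) = chiSum Q h := by
    intro h
    obtain ⟨n, hn, h0⟩ := exists_odd_nsmul_eq_zero h
    refine eq_of_sq_eq_sq_of_odd hn (hχ2 h) ?_ ?_
    · rw [← AddChar.map_nsmul_eq_pow, ← map_nsmul, h0, map_zero, AddChar.map_zero_eq_one]
    · rw [← AddChar.map_nsmul_eq_pow, h0, AddChar.map_zero_eq_one]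
  -- Once χ is preserved it cancels from the diagonal relation, leaving c(h) = μ(f h, f h) / μ(h,
  -- h).
  have hc' : ∀ h, c h = (muSum Q (f h) (f h) * (muSum Q h h)⁻¹ : Circle) := fun h => by
    have h1 := hc h
    rw [hχ, muSum_neg_left, muSum_neg_left] at h1
    have n1 := Circle.coe_ne_zero (chiSum Q h)
    have n2 := Circle.coe_ne_zero (muSum Q h h)
    have n3 := Circle.coe_ne_zero (muSum Q (f h) (f h))
    push_cast at h1 ⊢
    field_simp at h1 ⊢
    linear_combination h1
  -- Inserting this formula, the diagonal terms of the product relation cancel, as does one factor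
  -- of each squared cocycle value; what remains is preservation of the commutator.
  have hμ : ∀ h h', muSum Q (f h) (f h') * muSum Q h' h = muSum Q h h' * muSum Q (f h') (f h) := by
    intro h h'
    have h1 := hmul h h'
    rw [hc', hc', hc', muSum_neg_neg, muSum_neg_neg, map_add, muSum_add_left, muSum_add_left,
      muSum_add_right, muSum_add_right, muSum_add_right, muSum_add_right] at h1
    refine Circle.ext ?_
    have n1 := Circle.coe_ne_zero (muSum Q h h)
    have n2 := Circle.coe_ne_zero (muSum Q h' h')
    have n3 := Circle.coe_ne_zero (muSum Q h h')
    have n4 := Circle.coe_ne_zero (muSum Q h' h)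
    have n5 := Circle.coe_ne_zero (muSum Q (f h) (f h))
    have n6 := Circle.coe_ne_zero (muSum Q (f h') (f h'))
    have n7 := Circle.coe_ne_zero (muSum Q (f h) (f h'))
    push_cast at h1 ⊢
    field_simp at h1
    linear_combination h1
  exact exists_eq_shear f hχ hμ

theorem shear_injective {a b : ∀ q : Q, ZMod q.1.1}
    (ha : ∀ h, HSum.shear a h = HSum.shear b h) : a = b := by
  funext q
  have h4 := congrArg (HSum.component Q q)
    (ha (DFinsupp.singleAddHom (fun q : Q => HGroup q.1.1) q (1, 0)))
  rw [HSum.component_shear, HSum.component_shear, component_single] at h4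
  have h5 : 0 + a q * 1 = 0 + b q * 1 := congrArg Prod.snd h4
  rwa [zero_add, zero_add, mul_one, mul_one] at h5

variable (Q) in
-- The parameter is recovered from the action on generators. Conversely the relations satisfied by
-- an equivariant automorphism make its map on H_Q a shear, and the automorphism is determined by
-- that map.
theorem shearAut_iso_bijective :
    Function.Bijective fun a : ∀ q : Q, ZMod q.1.1 => (shearAut a).iso := by
  refine ⟨fun a b hab => ?_, fun α => ?_⟩
  · refine shear_injective fun h => ?_
    have h1 := (shearAut_bernoulliGen a h).symm.trans
      ((congrArg (fun α => α.map (bernoulliGen (muSum Q) (chiSum Q) h)) hab).trans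
        (shearAut_bernoulliGen b h))
    exact Lam.pair_injective e₁_ne_zero (smul_bernoulliElem_inj (Circle.coe_ne_zero _) h1).1
  · obtain ⟨f, c, -, hfc, hχ2, hc, hmul⟩ := exists_addMonoidHom_of_iso α
    obtain ⟨a, ha⟩ := exists_eq_shear_of_relations hχ2 hc hmul
    have h1 : ∀ h, ∃ c : ℂ, (shearAut a).iso.map (bernoulliGen (muSum Q) (chiSum Q) h) =
        c • bernoulliGen (muSum Q) (chiSum Q) (f h) := fun h => by
      have e := congrArg (fun x => (prodCoeff (shearCoeff a) (Lam.pair 0 e₁ h) : ℂ) •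
        bernoulliGen (muSum Q) (chiSum Q) x) (ha h).symm
      exact ⟨_, (shearAut_bernoulliGen a h).trans e⟩
    exact ⟨a, iso_ext_of_map_bernoulliGen h1 fun h => ⟨c h, hfc h⟩⟩

end Centralizer

/-! ### The topology of the centralizer. -/

section CentralizerTopology
open Topology

theorem VNSystem.t2Space_centralizer {G : Type*} [Group G] {E : Type*} [NormedAddCommGroup E]
    [InnerProductSpace ℂ E] [CompleteSpace E] {S : VNSystem G E}
    (h : ∀ x y : S.Alg, (x : E →L[ℂ] E) S.Ω = (y : E →L[ℂ] E) S.Ω → x = y) :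
    T2Space S.centralizer :=
  T2Space.of_injective_continuous
    (f := fun (α : S.centralizer) (x : S.Alg) => ((α.1 x : S.Alg) : E →L[ℂ] E) S.Ω)
    (fun _ _ hαβ => Subtype.ext (StarAlgEquiv.ext fun x => h _ _ (congrFun hαβ x)))
    continuous_induced_dom

theorem VNSystem.SpatialIso.iso_map_apply_Ω {G : Type*} [Group G] {E E' : Type*}
    [NormedAddCommGroup E] [InnerProductSpace ℂ E] [CompleteSpace E] [NormedAddCommGroup E']
    [InnerProductSpace ℂ E'] [CompleteSpace E'] {S : VNSystem G E} {T : VNSystem G E'}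
    (I : SpatialIso S T) (x : S.Alg) :
    (I.iso.map x : E' →L[ℂ] E') T.Ω = I.V ((x : E →L[ℂ] E) S.Ω) := by
  rw [← I.map_Ω]
  exact I.equiv_apply_apply x S.Ω

theorem t2Space_centralizer_bernoulli {H : Type*} [AddCommGroup H] (μ : Cocycle H)
    (χ : AddChar H Circle) : T2Space (twistedBernoulliShift μ χ).centralizer :=
  VNSystem.t2Space_centralizer fun x y hxy => Subtype.ext (eq_of_apply_delta_zero x.2 y.2 hxy)

/-- A family of isometries of `ℓ²(Γ)` which is continuous on the standard basis vectors is strongly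
continuous. -/
theorem continuous_apply_of_delta {X Γ : Type*} [TopologicalSpace X]
    {V : X → (L2 Γ ≃ₗᵢ[ℂ] L2 Γ)} (hV : ∀ γ, Continuous fun a => V a (delta γ)) (v : L2 Γ) :
    Continuous fun a => V a v := by
  refine continuous_of_uniform_approx_of_continuous fun u hu => ?_
  obtain ⟨ε, hε, hεu⟩ := Metric.mem_uniformity_dist.1 hu
  -- Because every `V a` is an isometry, one finite partial sum approximates uniformly in the
  -- parameter.
  obtain ⟨s, hs⟩ := ((Metric.tendsto_nhds.1 (hasSum_delta v)) ε hε).exists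
  have h0 : ∀ γ, Continuous fun a => (v γ : ℂ) • V a (delta γ) := fun γ =>
    (lipschitzWith_smul (v γ : ℂ)).continuous.comp (hV γ)
  refine ⟨fun a => ∑ γ ∈ s, v γ • V a (delta γ), continuous_finsetSum _ fun γ _ => h0 γ,
    fun a => hεu ?_⟩
  have h1 : ∑ γ ∈ s, v γ • V a (delta γ) = V a (∑ γ ∈ s, v γ • delta γ) := by
    rw [map_sum]
    exact Finset.sum_congr rfl fun γ _ => (map_smul _ _ _).symm
  have h2 : dist (V a v) (V a (∑ γ ∈ s, v γ • delta γ)) < ε :=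
    ((V a).dist_map _ _).trans_lt ((dist_comm _ _).trans_lt hs)
  exact (congrArg (dist (V a v)) h1).trans_lt h2

variable {Q : Set OddPrime}

theorem shear_eq_of_eq_on {a b : ∀ q : Q, ZMod q.1.1} {h : HSum Q}
    (hab : ∀ q, HSum.component Q q h ≠ 0 → a q = b q) : HSum.shear a h = HSum.shear b h := by
  refine HSum.ext fun q => ?_
  rw [HSum.component_shear, HSum.component_shear]
  by_cases hq : HSum.component Q q h = 0
  · rw [hq, map_zero, map_zero]
  · rw [hab q hq]

theorem shearCoeff_eq_of_eq_on {a b : ∀ q : Q, ZMod q.1.1} {h : HSum Q}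
    (hab : ∀ q, HSum.component Q q h ≠ 0 → a q = b q) : shearCoeff a h = shearCoeff b h := by
  refine finprod_congr fun q => ?_
  by_cases hq : HSum.component Q q h = 0
  · simp [hq]
  · rw [hab q hq]

/-- Only the finitely many coordinates at primes occurring in the values of `l` matter, so the map
is locally constant. -/
theorem continuous_shearAut_delta (l : Lam (HSum Q)) :
    Continuous fun a : ∀ q : Q, ZMod q.1.1 => (shearAut a).V (delta l) := by
  have hF : {q : Q | ∃ k, HSum.component Q q (l.1 k) ≠ 0}.Finite := by
    refine (l.1.hasFiniteSupport.biUnion fun k _ => HSum.finite_component (l.1 k)).subset ?_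
    rintro q ⟨k, hk⟩
    refine Set.mem_biUnion (x := k) (fun h0 => hk ?_) hk
    rw [h0, map_zero]
  refine continuous_iff_continuousAt.2 fun a => ?_
  have h1 : ∀ᶠ b in 𝓝 a, ∀ q ∈ {q : Q | ∃ k, HSum.component Q q (l.1 k) ≠ 0}, b q = a q :=
    (eventually_all_finite hF).2 fun q _ =>
      (continuous_apply q).continuousAt.eventually_mem ((isOpen_discrete {a q}).mem_nhds rfl)
  refine ContinuousAt.congr continuousAt_const (EventuallyEq.symm ?_) (f := fun _ => (shearAut a).V (delta l))
  filter_upwards [h1] with b hb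
  have h2 : ∀ b, (shearAut b).V (delta l) = (prodCoeff (shearCoeff b) l : ℂ) •
      (delta (Lam.congr (HSum.shear b) l) : L2 (Lam (HSum Q))) := fun b => monomial_delta _ _ _
  have h3 : Lam.congr (HSum.shear b) l = Lam.congr (HSum.shear a) l := Lam.ext fun k => by
    rw [Lam.congr_val, Lam.congr_val]
    exact shear_eq_of_eq_on fun q hq => hb q ⟨k, hq⟩
  have h4 : prodCoeff (shearCoeff b) l = prodCoeff (shearCoeff a) l :=
    finprod_congr fun k => shearCoeff_eq_of_eq_on fun q hq => hb q ⟨k, hq⟩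
  rw [h2, h2, h3, h4]

variable (Q) in
/-- The centralizer of the twisted Bernoulli shift `β(H_Q, μ_Q, χ_Q)`. -/
def bernoulliCentralizerEquiv : (twistedBernoulliShift (muSum Q) (chiSum Q)).centralizer ≃ₜ*
    Multiplicative (∀ q : Q, ZMod q.1.1) :=
  have := t2Space_centralizer_bernoulli (muSum Q) (chiSum Q)
  let e : Multiplicative (∀ q : Q, ZMod q.1.1) ≃
      (twistedBernoulliShift (muSum Q) (chiSum Q)).centralizer :=
    Multiplicative.toAdd.trans
      ((Equiv.ofBijective _ (shearAut_iso_bijective Q)).trans VNSystem.Iso.equivCentralizer)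
  have he : Continuous e := continuous_induced_rng.2 (continuous_pi fun x =>
    ((continuous_apply_of_delta continuous_shearAut_delta _).comp continuous_toAdd).congr fun a =>
      ((shearAut a.toAdd).iso_map_apply_Ω x).symm)
  ContinuousMulEquiv.symm
    { e with
      map_mul' := fun a b => Subtype.ext
        (congrArg VNSystem.Iso.toEquiv (shearAut_iso_add a.toAdd b.toAdd))
      continuous_toFun := he
      -- A product of finite groups is compact, and the centralizer is Hausdorff because δ₀ is
      -- separating.
      continuous_invFun := he.continuous_symm_of_equiv_compact_to_t2 }

end CentralizerTopology

/-! ### Transport from the single shift back to the tensor product. -/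

section Results
variable (Q : Set OddPrime)

theorem isAFDII₁Factor_betaTensor (hQ : Q.Nonempty) : IsAFDII₁Factor (betaTensor Q).alg :=
  (nonempty_spatialIso_betaTensor Q).elim fun I =>
    IsAFDII₁Factor.of_spatial I.V I.conj_mem_iff (isAFDII₁Factor_bernoulli hQ)

theorem betaTensor_conjugate :
    (betaTensor Q).Conjugate (twistedBernoulliShift (muSum Q) (chiSum Q)) :=
  (nonempty_spatialIso_betaTensor Q).elim fun I => I.conjugate

end Results

end TwistedBernoulli
end

theorem corollary5p9 (Q : Set OddPrime) :
    (Q.Nonempty → IsAFDII₁Factor (betaTensor Q).alg) ∧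
    (betaTensor Q).Conjugate (twistedBernoulliShift (muSum Q) (chiSum Q)) ∧
    Nonempty ((betaTensor Q).centralizer ≃ₜ* Multiplicative (∀ q : Q, ZMod q.1.1)) ∧
    ∀ Q' : Set OddPrime, Q ≠ Q' → ¬ (betaTensor Q).Conjugate (betaTensor Q') :=
  ⟨isAFDII₁Factor_betaTensor Q, betaTensor_conjugate Q,
    (nonempty_spatialIso_betaTensor Q).map fun I =>
      I.centralizerEquiv.trans (bernoulliCentralizerEquiv Q),
    fun _ hne h => hne (eq_of_conjugate_betaTensor h)⟩
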